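/- **Notation.** Let $\Omega\subset\hat{\mathbb C}=\mathbb C\cup\{\infty\}$ be a domain, and let $\mathcal C(\Omega)$ be the set of connected components of $\hat{\mathbb C}\setminus\Omega$. Let $\operatorname{diam}(p)\in[0,\infty]$ be the Euclidean diameter of $p\cap\mathbb C$ and $\mathcal C_N(\Omega)=\{p\in\mathcal C(\Omega):\operatorname{diam}(p)>0\}$. The domain is *finitely connected* if $\mathcal C(\Omega)$ is finite. Let $\hat\Omega$ be the quotient space of $\hat{\mathbb C}$ in which every $p\in\mathcal C(\Omega)$ is collapsed to a point, with quotient map $\pi_\Omega$; we identify $p\in\mathcal C(\Omega)$ with the point $\pi_\Omega(p)\in\hat\Omega$, and points of $\hat\Omega$ with their preimages under $\pi_\Omega$. We write $\mathbb D(a,r)$ for the open Euclidean disk, $\mathbb S(a,r)$ for its boundary circle, and $\overline{\mathbb A}(a,R)=\{z\in\mathbb C: R/2\le |z-a|\le 4R\}$. An *$H$-quasitripod* is a set $T\subset\mathbb C$ for which there is a homeomorphism $\phi\colon T_0\to T$ from the standard tripod $T_0=\bigcup_{j=0}^{2}[0,e^{2\pi i j/3}]$ such that $|\phi(z_2)-\phi(z_1)|\le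 H|\phi(z_3)-\phi(z_1)|$ whenever $z_1,z_2,z_3\in T_0$ and $|z_2-z_1|\le|z_3-z_1|$. A path in $\hat\Omega$ is a continuous map $\gamma$ from a compact interval to $\hat\Omega$; constant paths are allowed, and $|\gamma|$ denotes the image. For a family $\Gamma$ of paths in $\hat\Omega$, the *transboundary modulus* is $$\operatorname{Mod}(\Gamma)=\inf_{\rho}\Big(\int_{\Omega\cap\mathbb C}\rho^2\,dA+\sum_{p\in\mathcal C(\Omega)}\rho(p)^2\Big),$$ where the infimum is over all Borel functions $\rho\colon\hat\Omega\to[0,\infty]$ with $$\int_\gamma\rho\,ds+\sum_{p\in\mathcal C(\Omega)\cap|\gamma|}\rho(p)\ge 1$$ for all $\gamma\in\Gamma$ whose restriction to $\gamma^{-1}(\Omega\cap\mathbb C)$ is locally rectifiable. Here $\int_\gamma\rho\,ds$ is the sum of the arc length integrals of $\rho$ over the restrictions of $\gamma$ to the components of $\gamma^{-1}(\Omega\cap\mathbb C)$. **Theorem.** For all $H\ge 1$ and $N\ge 1$ there is $M=M(H,N)\in(0,\infty)$ with the following property. Let $\Omega\subset\hat{\mathbb C}$ be a finitely connected domain such that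 (i) every $p\in\mathcal C_N(\Omega)$ contains an $H$-quasitripod $T$ with $\operatorname{diam}(T)\ge\operatorname{diam}(p)/H$, and (ii) $\operatorname{card}\{p\in\mathcal C_N(\Omega):\operatorname{diam}(p)\ge r,\ p\cap\mathbb D(z_0,r)\ne\emptyset\}\le N$ for all $z_0\in\mathbb C$ and $r>0$. Let $\bar p\in\hat\Omega$ (a point of $\Omega$ or a component of $\hat{\mathbb C}\setminus\Omega$), let $a\in\bar p\cap\mathbb C$, and let $R>0$. Then $\operatorname{Mod}(\Gamma)\le M$, where $\Gamma$ is the family of all paths in $\pi_\Omega(\overline{\mathbb A}(a,R))\setminus\{\bar p\}$ that join $\pi_\Omega(\mathbb S(a,4R))$ and $\pi_\Omega(\mathbb S(a,R/2))$. -/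

import Mathlib

open Set
open scoped ENNReal

noncomputable section

/-- The Riemann sphere. -/
abbrev Sphere : Type := OnePoint ℂ

/-- The connected components of a subset `S` of a topological space. -/
def componentsOf {X : Type*} [TopologicalSpace X] (S : Set X) : Set (Set X) :=
  {p | ∃ x ∈ S, p = connectedComponentIn S x}

/-- The collection `𝒞(G)` of components of the complement of `G` in the sphere. -/
def compl𝒞 (G : Set Sphere) : Set (Set Sphere) :=
  componentsOf Gᶜ

/-- The part of a subset of the sphere that lies in the plane. -/
def planePart (p : Set Sphere) : Set ℂ :=
  {z | (z : Sphere) ∈ p}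

/-- The Euclidean diameter of `p ∩ ℂ`, with value `⊤` if `p ∩ ℂ` is unbounded. -/
def ediamC (p : Set Sphere) : ℝ≥0∞ :=
  Metric.ediam (planePart p)

/-- The collection `𝒞_N(G)` of non-trivial complementary components. -/
def compl𝒞N (G : Set Sphere) : Set (Set Sphere) :=
  {p | p ∈ compl𝒞 G ∧ 0 < ediamC p}

/-! ### Quasitripods and the two conditions -/

/-- The standard tripod: the union of the segments `[0, exp (2 π i j / 3)]`, `j = 0, 1, 2`. -/
def standardTripod : Set ℂ :=
  ⋃ j : Fin 3, segment ℝ (0 : ℂ) (Complex.exp (2 * Real.pi * Complex.I * ((j : ℕ) : ℂ) / 3))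

/-- Weak `H`-quasisymmetry of a homeomorphism between subsets of the plane. -/
def IsWeaklyQuasisymmetric (H : ℝ) {E F : Set ℂ} (φ : E ≃ₜ F) : Prop :=
  ∀ z₁ z₂ z₃ : E, ‖(z₂ : ℂ) - z₁‖ ≤ ‖(z₃ : ℂ) - z₁‖ →
    ‖(φ z₂ : ℂ) - φ z₁‖ ≤ H * ‖(φ z₃ : ℂ) - φ z₁‖

/-- `T` is an `H`-quasitripod. -/
def IsQuasitripod (H : ℝ) (T : Set ℂ) : Prop :=
  ∃ φ : standardTripod ≃ₜ T, IsWeaklyQuasisymmetric H φ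

/-- Every non-trivial complementary component `p` contains an `H`-quasitripod of diameter at least
`diam p / H`. -/
def QuasitripodCondition (H : ℝ) (G : Set Sphere) : Prop :=
  ∀ p ∈ compl𝒞N G, ∃ T : Set ℂ,
    T ⊆ planePart p ∧ IsQuasitripod H T ∧ ediamC p / ENNReal.ofReal H ≤ Metric.ediam T

/-- For all `z₀ ∈ ℂ` and `r > 0`, at most `N` non-trivial complementary components of diameter at
least `r` meet the open disk `𝔻(z₀, r)`. -/
def PackingCondition (N : ℕ) (G : Set Sphere) : Prop :=
  ∀ (z₀ : ℂ) (r : ℝ), 0 < r →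
    {p | p ∈ compl𝒞N G ∧ ENNReal.ofReal r ≤ ediamC p ∧
      (planePart p ∩ Metric.ball z₀ r).Nonempty}.encard ≤ (N : ℕ∞)

/-! ### The quotient of the sphere that collapses every complementary component to a point -/

theorem componentsOf_eq {X : Type*} [TopologicalSpace X] {S : Set X} {p q : Set X} {x : X}
    (hp : p ∈ componentsOf S) (hq : q ∈ componentsOf S) (hxp : x ∈ p) (hxq : x ∈ q) : p = q := by
  obtain ⟨y, -, rfl⟩ := hp
  obtain ⟨z, -, rfl⟩ := hq
  rw [connectedComponentIn_eq hxp, connectedComponentIn_eq hxq]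

/-- `z ∼ w` if `z = w ∈ G`, or `z` and `w` belong to the same complementary component of `G`. -/
def hatSetoid (G : Set Sphere) : Setoid Sphere where
  r z w := (z = w ∧ z ∈ G) ∨ ∃ p ∈ compl𝒞 G, z ∈ p ∧ w ∈ p
  iseqv :=
    { refl := fun z => by
        by_cases hz : z ∈ G
        · exact Or.inl ⟨rfl, hz⟩
        · exact Or.inr ⟨_, ⟨z, hz, rfl⟩, mem_connectedComponentIn hz, mem_connectedComponentIn hz⟩
      symm := by
        rintro z w (⟨rfl, h⟩ | ⟨p, hp, hz, hw⟩)
        · exact Or.inl ⟨rfl, h⟩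
        · exact Or.inr ⟨p, hp, hw, hz⟩
      trans := by
        rintro x y z (⟨rfl, -⟩ | ⟨p, hp, hx, hy⟩) h
        · exact h
        · rcases h with ⟨rfl, -⟩ | ⟨q, hq, hy', hz⟩
          · exact Or.inr ⟨p, hp, hx, hy⟩
          · rw [← componentsOf_eq hp hq hy hy'] at hz
            exact Or.inr ⟨p, hp, hx, hz⟩ }

/-- The quotient space `Ĝ`. -/
def Hat (G : Set Sphere) : Type :=
  Quotient (hatSetoid G)

/-- The quotient map `π_G` from the sphere to `Ĝ`. -/
def proj (G : Set Sphere) (z : Sphere) : Hat G :=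
  Quotient.mk (hatSetoid G) z

instance (G : Set Sphere) : TopologicalSpace (Hat G) :=
  TopologicalSpace.coinduced (proj G) inferInstance

instance (G : Set Sphere) : MeasurableSpace (Hat G) :=
  borel (Hat G)

instance (G : Set Sphere) : BorelSpace (Hat G) :=
  ⟨rfl⟩

/-- The projection of a subset of the plane. -/
def projC (G : Set Sphere) (A : Set ℂ) : Set (Hat G) :=
  (fun z : ℂ => proj G z) '' A

/-- The set of points of `Ĝ` that are (collapsed) complementary components of `G`. -/
def hat𝒞 (G : Set Sphere) : Set (Hat G) :=
  proj G '' Gᶜ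

/-- The set of points of `Ĝ` that are points of `G ∩ ℂ`. -/
def hatPlane (G : Set Sphere) : Set (Hat G) :=
  projC G (planePart G)

open Classical in
/-- The point `z ∈ G ∩ ℂ` represented by `q ∈ Ĝ`; the value is irrelevant if there is none. -/
def planeCoord (G : Set Sphere) (q : Hat G) : ℂ :=
  if h : ∃ z : ℂ, z ∈ planePart G ∧ proj G z = q then h.choose else 0

theorem proj_eq_proj_iff {G : Set Sphere} {z w : Sphere} :
    proj G z = proj G w ↔ (z = w ∧ z ∈ G) ∨ ∃ p ∈ compl𝒞 G, z ∈ p ∧ w ∈ p :=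
  Quotient.eq (r := hatSetoid G)

theorem planeCoord_proj {G : Set Sphere} {z : ℂ} (hz : z ∈ planePart G) :
    planeCoord G (proj G z) = z := by
  have h : ∃ w : ℂ, w ∈ planePart G ∧ proj G w = proj G z := ⟨z, hz, rfl⟩
  rw [planeCoord, dif_pos h]
  rcases proj_eq_proj_iff.1 h.choose_spec.2 with ⟨h', -⟩ | ⟨p, ⟨x, -, rfl⟩, -, hzp⟩
  · exact OnePoint.coe_injective h'
  · exact absurd hz (connectedComponentIn_subset _ _ hzp)

/-! ### Transboundary modulus -/

/-- A path in `Ĝ`; the parameter interval is normalized to be `[0, 1]`. -/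
abbrev HatPath (G : Set Sphere) : Type :=
  C(unitInterval, Hat G)

/-- The path in the plane that is the restriction of `γ` to `G ∩ ℂ`; it is meaningful at the times
at which `γ` is in `G ∩ ℂ`. -/
def planePath {G : Set Sphere} (γ : HatPath G) (t : unitInterval) : ℂ :=
  planeCoord G (γ t)

/-- The restriction of `γ` to `G` is locally rectifiable: it has finite length on every compact
parameter interval on which it stays in `G ∩ ℂ`. -/
def IsLocallyRectifiable {G : Set Sphere} (γ : HatPath G) : Prop :=
  ∀ c d : unitInterval, Icc c d ⊆ γ ⁻¹' hatPlane G → eVariationOn (planePath γ) (Icc c d) ≠ ⊤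

/-- The path integral `∫ ρ ds` over the rectifiable path `f` restricted to `[c, d]`, through the
parametrization by arc length. -/
def arcIntegral (f : unitInterval → ℂ) (c d : unitInterval) (ρ : ℂ → ℝ≥0∞) : ℝ≥0∞ :=
  ∫⁻ s in Icc 0 (variationOnFromTo f (Icc c d) c d),
    ρ (naturalParameterization f (Icc c d) c s)

/-- The path integral over the restriction of `γ` to `G`. This restriction consists of the paths
`γ|J`, where `J` runs over the components of the set of times at which `γ` is in `G ∩ ℂ`, and the
integral over `γ|J` is the supremum of the integrals over compact subintervals. -/
def pathIntegral {G : Set Sphere} (ρ : Hat G → ℝ≥0∞) (γ : HatPath G) : ℝ≥0∞ :=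
  ∑' J : componentsOf (γ ⁻¹' hatPlane G),
    ⨆ (c : unitInterval) (d : unitInterval) (_ : c ≤ d) (_ : Icc c d ⊆ (J : Set unitInterval)),
      arcIntegral (planePath γ) c d (fun z => ρ (proj G z))

/-- The collection `X(Γ)` of admissible functions. As always for moduli of path families, the
inequality is required for the locally rectifiable paths, as path integrals are defined for
these. -/
def IsAdmissible {G : Set Sphere} (Γ : Set (HatPath G)) (ρ : Hat G → ℝ≥0∞) : Prop :=
  Measurable ρ ∧ ∀ γ ∈ Γ, IsLocallyRectifiable γ →
    1 ≤ pathIntegral ρ γ + ∑' q : ↥(hat𝒞 G ∩ range γ), ρ q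

/-- The energy `∫_{G ∩ ℂ} ρ² dA + ∑_{p ∈ 𝒞(G)} ρ(p)²`. -/
def energy {G : Set Sphere} (ρ : Hat G → ℝ≥0∞) : ℝ≥0∞ :=
  (∫⁻ z in planePart G, ρ (proj G z) ^ 2) + ∑' q : hat𝒞 G, ρ q ^ 2

/-- The transboundary modulus of a family of paths in `Ĝ`. -/
def transboundaryModulus {G : Set Sphere} (Γ : Set (HatPath G)) : ℝ≥0∞ :=
  ⨅ (ρ : Hat G → ℝ≥0∞) (_ : IsAdmissible Γ ρ), energy ρ

/-- `γ` joins `A` and `B`: one of its endpoints is in `A` and the other one is in `B`. -/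
def Joins {G : Set Sphere} (γ : HatPath G) (A B : Set (Hat G)) : Prop :=
  (γ 0 ∈ A ∧ γ 1 ∈ B) ∨ (γ 0 ∈ B ∧ γ 1 ∈ A)

/-- The closure of the annulus `𝔸(a, R) = 𝔻(a, 4R) \ closure 𝔻(a, R/2)`, `R > 0`. -/
def closedAnnulus (a : ℂ) (R : ℝ) : Set ℂ :=
  {z | R / 2 ≤ dist z a ∧ dist z a ≤ 4 * R}

/-- The paths in `π_G(closedAnnulus a R) \ {p}` that join the projections of the circles
`𝕊(a, 4R)` and `𝕊(a, R/2)`. -/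
def annulusPaths (G : Set Sphere) (p : Hat G) (a : ℂ) (R : ℝ) : Set (HatPath G) :=
  {γ | range γ ⊆ projC G (closedAnnulus a R) \ {p} ∧
    Joins γ (projC G (Metric.sphere a (4 * R))) (projC G (Metric.sphere a (R / 2)))}

end

/-! The modulus is bounded by testing one density: `1/R` on the part of `Ω` in the disk of radius
`5R`, the value `1` on the components of diameter at least `R/20` that meet the annulus, and
`w(p)/R` on the smaller ones. Packing bounds the number of large components, and a path through one
of them is long at once. What remains is to find weights `w` on the small components such that `∑ w²
≤ C R²`, while every path that avoids the large components has length plus collected weight at least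
`R`.

The choice `w = diam` satisfies the length requirement (`dominatesDist_of_diam_le`) but not the
energy bound: packing controls the number of components at each scale, so every scale may contribute
a fixed multiple of `R²`, and the number of scales is not bounded. The tripods repair this. A
quasitripod of diameter comparable to `d` is not flat and its arms are porous, so near its centre
there is a hole, a disk about some `w` of radius `2εd` that misses it
(`IsQuasitripod.exists_isObstacle`). A continuum that runs through the hole without touching the
tripod cannot be nearly straight, since the tripod would cross it; hence it makes a detour of order
`σd` (`DominatesDist.add_le_cost_of_obstacle`). A continuum that contains the component itself pays
for it, because weights start at a large multiple of the diameter. Therefore all weights inside the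
disk about `w` of radius `εd` may be multiplied by `1 - σ/80` without spoiling the length estimate,
up to an error for endpoints near the obstacle (`DominatesDist.discount`).

This is repeated over a selected family of obstacles, in order of increasing diameter, where
obstacles of comparable size are far apart (`IsSeparatedFamily.exists_dominatesDist`). The final
weight is a multiple of `diam · (1 - σ/80)^depth`. For the energy, each component is charged to a
selected obstacle of comparable size nearby, with boundedly many charges per obstacle. The obstacles
around a fixed point have distinct ranks, so the charges over that point form a geometric series;
integrating over a disk of radius `5R` gives the bound
(`IsSeparatedFamily.sum_sq_diam_mul_pow_depth_le`).

Paths are replaced by continua throughout. The fibres of the quotient map are connected, so the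
preimage of a path is a continuum that is a union of components and points of `Ω`, and the path
integral dominates the one-dimensional Hausdorff measure of its part in `Ω`. -/

noncomputable section

open MeasureTheory Measure
open scoped ComplexConjugate

/-! ### Saturated continua -/

/-- Boundary bumping: a component of `K \ U` reaches the closure of the open set `U`. -/
theorem exists_mem_connectedComponentIn_closure {X : Type*} [TopologicalSpace X] [T2Space X]
    {K U : Set X} {x : X} (hK : IsCompact K) (hKc : IsPreconnected K) (hU : IsOpen U)
    (hx : x ∈ K \ U) (hKU : (K ∩ U).Nonempty) :
    ∃ b ∈ connectedComponentIn (K \ U) x, b ∈ closure U := by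
  by_contra! hcon
  have hF : IsCompact (K \ U) := hK.diff hU
  have : CompactSpace (K \ U : Set X) := isCompact_iff_compactSpace.1 hF
  set x' : (K \ U : Set X) := ⟨x, hx⟩
  have hC : connectedComponentIn (K \ U) x = Subtype.val '' connectedComponent x' := by
    rw [connectedComponentIn, dif_pos hx]
  have hdisj : Disjoint (Subtype.val ⁻¹' closure U : Set (K \ U : Set X))
      (⋂ s : { s : Set (K \ U : Set X) // IsClopen s ∧ x' ∈ s }, (s : Set (K \ U : Set X))) := by
    rw [← connectedComponent_eq_iInter_isClopen, Set.disjoint_left]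
    intro z hz hz'
    exact hcon z (hC ▸ ⟨z, hz', rfl⟩) hz
  -- In a compact Hausdorff space a component is the intersection of the clopen sets around it, so
  -- by compactness a single clopen `V` already misses `closure U`. Then `V` and its complement
  -- joined with `closure U` disconnect `K`.
  obtain ⟨V, hV, hxV, hVU⟩ : ∃ V : Set (K \ U : Set X), IsClopen V ∧ x' ∈ V ∧
      Disjoint (Subtype.val ⁻¹' closure U) V := by
    have hcl : IsClosed (Subtype.val ⁻¹' closure U : Set (K \ U : Set X)) :=
      isClosed_closure.preimage continuous_subtype_val
    have H1 := hcl.isCompact.inter_iInter_nonempty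
      (fun s : { s : Set (K \ U : Set X) // IsClopen s ∧ x' ∈ s } => (s : Set (K \ U : Set X)))
      fun s => s.2.1.1
    rw [← not_disjoint_iff_nonempty_inter, imp_not_comm, not_forall] at H1
    obtain ⟨si, H2⟩ := H1 hdisj
    refine ⟨⋂ U ∈ si, Subtype.val U, ?_, ?_, ?_⟩
    · exact isClopen_biInter_finset fun s _ => s.2.1
    · exact mem_iInter₂.2 fun s _ => s.2.2
    · rwa [disjoint_iff_inter_eq_empty, ← not_nonempty_iff_eq_empty]
  set V' : Set X := Subtype.val '' V
  have hV'c : IsClosed V' := (hV.1.isCompact.image continuous_subtype_val).isClosed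
  have hW'c : IsClosed (Subtype.val '' Vᶜ : Set X) :=
    (hV.compl.1.isCompact.image continuous_subtype_val).isClosed
  have hVdisj : ∀ z ∈ V', z ∉ closure U := by
    rintro _ ⟨z, hz, rfl⟩ hzU
    exact (Set.disjoint_left.1 hVU) hzU hz
  obtain ⟨u, huK, huU⟩ := hKU
  have := isPreconnected_closed_iff.1 hKc V' (Subtype.val '' Vᶜ ∪ closure U) hV'c
    (hW'c.union isClosed_closure) (by
      intro z hz
      by_cases hzU : z ∈ U
      · exact Or.inr (Or.inr (subset_closure hzU))
      · by_cases hzV : (⟨z, hz, hzU⟩ : (K \ U : Set X)) ∈ V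
        · exact Or.inl ⟨_, hzV, rfl⟩
        · exact Or.inr (Or.inl ⟨_, hzV, rfl⟩))
    ⟨x, hx.1, x', hxV, rfl⟩ ⟨u, huK, Or.inr (subset_closure huU)⟩
  obtain ⟨z, -, hzV, hz⟩ := this
  rcases hz with hz | hz
  · obtain ⟨v, hv, rfl⟩ := hzV
    obtain ⟨v', hv', h⟩ := hz
    exact hv' (Subtype.val_injective h ▸ hv)
  · exact hVdisj z hzV hz

section

variable {ι : Type*}

/-- A finite family of pairwise disjoint continua in the plane. -/
structure IsContinuumFamily (P : ι → Set ℂ) : Prop where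
  isCompact : ∀ i, IsCompact (P i)
  isConnected : ∀ i, IsConnected (P i)
  disjoint : Pairwise fun i j => Disjoint (P i) (P j)

/-- A continuum that is a union of members of the family and of points outside the family. -/
structure IsSaturatedContinuum (P : ι → Set ℂ) (K : Set ℂ) : Prop where
  isCompact : IsCompact K
  isConnected : IsConnected K
  saturated : ∀ i, P i ⊆ K ∨ Disjoint (P i) K

/-- The part of `O` obtained by deleting the members of the family that are not inside `O`. -/
def core (P : ι → Set ℂ) (O : Set ℂ) : Set ℂ :=
  O \ ⋃ i ∈ {i | ¬ P i ⊆ O}, P i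

variable {P : ι → Set ℂ} {K O : Set ℂ}

theorem core_subset : core P O ⊆ O := sdiff_subset

theorem isOpen_core [Finite ι] (hP : IsContinuumFamily P) (hO : IsOpen O) : IsOpen (core P O) := by
  refine hO.sdiff ?_
  exact (Set.toFinite _).isClosed_biUnion fun i _ => (hP.isCompact i).isClosed

theorem subset_core (hP : IsContinuumFamily P) {i : ι} (h : P i ⊆ O) : P i ⊆ core P O := by
  intro z hz
  refine ⟨h hz, ?_⟩
  simp only [mem_iUnion, not_exists]
  rintro j hj hzj
  by_cases hij : i = j
  · exact hj (hij ▸ h)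
  · exact (Set.disjoint_left.1 (hP.disjoint hij)) hz hzj

theorem disjoint_core {i : ι} (h : ¬ P i ⊆ O) : Disjoint (P i) (core P O) := by
  rw [Set.disjoint_left]
  rintro z hz ⟨-, hz'⟩
  exact hz' (mem_biUnion (show i ∈ {i | ¬ P i ⊆ O} from h) hz)

theorem mem_core_of_forall {z : ℂ} (hz : z ∈ O) (h : ∀ i, z ∈ P i → P i ⊆ O) : z ∈ core P O := by
  refine ⟨hz, ?_⟩
  simp only [mem_iUnion, not_exists]
  rintro j hj hzj
  exact hj (h j hzj)

/-- This is why `core P O` is removed rather than `O`: a member of the family lies wholly inside or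
wholly outside the core, so no member is cut, and a connected member outside it stays in one
component. -/
theorem isSaturatedContinuum_connectedComponentIn [Finite ι] (hP : IsContinuumFamily P)
    (hK : IsSaturatedContinuum P K) (hO : IsOpen O) {x : ℂ} (hx : x ∈ K \ core P O) :
    IsSaturatedContinuum P (connectedComponentIn (K \ core P O) x) where
  isCompact := by
    have hF : IsCompact (K \ core P O) := hK.isCompact.diff (isOpen_core hP hO)
    have : CompactSpace (K \ core P O : Set ℂ) := isCompact_iff_compactSpace.1 hF
    rw [connectedComponentIn, dif_pos hx]
    exact isClosed_connectedComponent.isCompact.image continuous_subtype_val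
  isConnected := isConnected_connectedComponentIn_iff.2 hx
  saturated := by
    intro i
    by_cases hdis : Disjoint (P i) (connectedComponentIn (K \ core P O) x)
    · exact Or.inr hdis
    left
    obtain ⟨z, hzi, hz⟩ := Set.not_disjoint_iff.1 hdis
    have hzK := connectedComponentIn_subset _ _ hz
    have hiK : P i ⊆ K := (hK.saturated i).resolve_right fun h => (Set.disjoint_left.1 h) hzi hzK.1
    have hiO : ¬ P i ⊆ O := fun h => hzK.2 (subset_core hP h hzi)
    have hsub : P i ⊆ K \ core P O := fun w hw =>
      ⟨hiK hw, fun h => (Set.disjoint_left.1 (disjoint_core hiO)) hw h⟩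
    rw [connectedComponentIn_eq hz]
    exact (hP.isConnected i).isPreconnected.subset_connectedComponentIn hzi hsub

/-- Cutting a hole in a saturated continuum. -/
theorem IsSaturatedContinuum.exists_excision [Finite ι] (hP : IsContinuumFamily P)
    (hK : IsSaturatedContinuum P K) (hO : IsOpen O) {x : ℂ} (hx : x ∈ K) (hxO : x ∉ core P O)
    (hne : (K ∩ core P O).Nonempty) :
    ∃ L, IsSaturatedContinuum P L ∧ x ∈ L ∧ L ⊆ K \ core P O ∧ ∃ b ∈ L, b ∈ closure O := by
  refine ⟨_, isSaturatedContinuum_connectedComponentIn hP hK hO ⟨hx, hxO⟩,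
    mem_connectedComponentIn ⟨hx, hxO⟩, connectedComponentIn_subset _ _, ?_⟩
  obtain ⟨b, hb, hb'⟩ := exists_mem_connectedComponentIn_closure hK.isCompact
    hK.isConnected.isPreconnected (isOpen_core hP hO) ⟨hx, hxO⟩ hne
  exact ⟨b, hb, closure_mono core_subset hb'⟩

theorem IsSaturatedContinuum.exists_excision_pair [Finite ι] (hP : IsContinuumFamily P)
    (hK : IsSaturatedContinuum P K) (hO : IsOpen O) {x y : ℂ} (hx : x ∈ K) (hxO : x ∉ core P O)
    (hy : y ∈ K) (hyO : y ∉ core P O) (hne : (K ∩ core P O).Nonempty) :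
    (∃ L, IsSaturatedContinuum P L ∧ x ∈ L ∧ y ∈ L ∧ L ⊆ K \ core P O) ∨
    ∃ L L', IsSaturatedContinuum P L ∧ IsSaturatedContinuum P L' ∧ x ∈ L ∧ y ∈ L' ∧
      Disjoint L L' ∧ L ⊆ K \ core P O ∧ L' ⊆ K \ core P O ∧
      (∃ b ∈ L, b ∈ closure O) ∧ ∃ b ∈ L', b ∈ closure O := by
  have bump : ∀ z ∈ K, z ∉ core P O →
      ∃ b ∈ connectedComponentIn (K \ core P O) z, b ∈ closure O := by
    intro z hz hzO
    obtain ⟨b, hb, hb'⟩ := exists_mem_connectedComponentIn_closure hK.isCompact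
      hK.isConnected.isPreconnected (isOpen_core hP hO) ⟨hz, hzO⟩ hne
    exact ⟨b, hb, closure_mono core_subset hb'⟩
  have hLx := isSaturatedContinuum_connectedComponentIn hP hK hO ⟨hx, hxO⟩
  have hLy := isSaturatedContinuum_connectedComponentIn hP hK hO ⟨hy, hyO⟩
  by_cases h : Disjoint (connectedComponentIn (K \ core P O) x)
      (connectedComponentIn (K \ core P O) y)
  · exact Or.inr ⟨_, _, hLx, hLy, mem_connectedComponentIn ⟨hx, hxO⟩,
      mem_connectedComponentIn ⟨hy, hyO⟩, h, connectedComponentIn_subset _ _,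
      connectedComponentIn_subset _ _, bump x hx hxO, bump y hy hyO⟩
  · obtain ⟨z, hz, hz'⟩ := Set.not_disjoint_iff.1 h
    refine Or.inl ⟨_, hLx, mem_connectedComponentIn ⟨hx, hxO⟩, ?_, connectedComponentIn_subset _ _⟩
    rw [connectedComponentIn_eq hz, ← connectedComponentIn_eq hz']
    exact mem_connectedComponentIn ⟨hy, hyO⟩

end

/-! ### The cost of a saturated continuum -/

section

variable {ι : Type*}

/-- The part of a set that belongs to no member of the family. -/
def freePart (P : ι → Set ℂ) (K : Set ℂ) : Set ℂ := K \ ⋃ i, P i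

theorem freePart_mono {P : ι → Set ℂ} {K L : Set ℂ} (h : L ⊆ K) : freePart P L ⊆ freePart P K :=
  sdiff_subset_sdiff_left h

theorem hausdorffMeasure_freePart_ne_top {P : ι → Set ℂ} {K L : Set ℂ}
    (hK : μH[1] (freePart P K) ≠ ⊤) (h : L ⊆ K) : μH[1] (freePart P L) ≠ ⊤ :=
  ne_top_of_le_ne_top hK (measure_mono (freePart_mono h))

variable [Fintype ι]

open Classical in
/-- The length of the free part of `K` plus the weights of the members of the family in `K`. -/
def cost (P : ι → Set ℂ) (ρ : ι → ℝ) (K : Set ℂ) : ℝ :=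
  (μH[1] (freePart P K)).toReal + ∑ i with P i ⊆ K, ρ i

/-- The cost of a saturated continuum through `x` and `y` is at least the distance of `x` and `y`,
up to the errors `E x` and `E y`. -/
def DominatesDist (P : ι → Set ℂ) (ρ : ι → ℝ) (E : ℂ → ℝ) : Prop :=
  ∀ K, IsSaturatedContinuum P K → μH[1] (freePart P K) ≠ ⊤ → ∀ x ∈ K, ∀ y ∈ K,
    dist x y - E x - E y ≤ cost P ρ K

variable {P : ι → Set ℂ} {ρ : ι → ℝ} {K L L' : Set ℂ}

theorem measurableSet_freePart (hP : IsContinuumFamily P) (hK : IsCompact K) :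
    MeasurableSet (freePart P K) :=
  hK.measurableSet.diff (MeasurableSet.iUnion fun i => (hP.isCompact i).measurableSet)

theorem cost_empty (hP : IsContinuumFamily P) : cost P ρ ∅ = 0 := by
  classical
  have : ∀ i, ¬ P i ⊆ ∅ := fun i h => (hP.isConnected i).nonempty.ne_empty (subset_empty_iff.1 h)
  simp [cost, freePart, this]

open Classical in
-- Superadditivity of the cost over disjoint pieces, with an additional bonus for members of `K`
-- that neither piece uses. All later gains are extracted through this inequality.
theorem cost_add_cost_add_sum_le (hP : IsContinuumFamily P) (hρ : ∀ i, 0 ≤ ρ i)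
    (hK : μH[1] (freePart P K) ≠ ⊤) (hL : L ⊆ K) (hL' : L' ⊆ K) (hd : Disjoint L L')
    (hLc : IsCompact L') (F : Finset ι)
    (hF : ∀ i ∈ F, P i ⊆ K ∧ Disjoint (P i) L ∧ Disjoint (P i) L') :
    cost P ρ L + cost P ρ L' + ∑ i ∈ F, ρ i ≤ cost P ρ K := by
  have hne : ∀ i, (P i).Nonempty := fun i => (hP.isConnected i).nonempty
  have hfree : Disjoint (freePart P L) (freePart P L') := hd.mono sdiff_subset sdiff_subset
  have h1 : (μH[1] (freePart P L)).toReal + (μH[1] (freePart P L')).toReal ≤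
      (μH[1] (freePart P K)).toReal := by
    rw [← ENNReal.toReal_add (hausdorffMeasure_freePart_ne_top hK hL)
      (hausdorffMeasure_freePart_ne_top hK hL'),
      ← measure_union hfree (measurableSet_freePart hP hLc)]
    exact ENNReal.toReal_mono hK
      (measure_mono (union_subset (freePart_mono hL) (freePart_mono hL')))
  have hdis {A B : Set ℂ} (h : Disjoint A B) {i : ι} (hA : P i ⊆ A) (hB : P i ⊆ B) : False := by
    obtain ⟨z, hz⟩ := hne i
    exact (Set.disjoint_left.1 h) (hA hz) (hB hz)
  have h2 : (∑ i with P i ⊆ L, ρ i) + (∑ i with P i ⊆ L', ρ i) + ∑ i ∈ F, ρ i ≤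
      ∑ i with P i ⊆ K, ρ i := by
    rw [← Finset.sum_union, ← Finset.sum_union]
    · refine Finset.sum_le_sum_of_subset_of_nonneg ?_ fun i _ _ => hρ i
      intro i hi
      simp only [Finset.mem_union, Finset.mem_filter, Finset.mem_univ, true_and] at hi ⊢
      rcases hi with (hi | hi) | hi
      exacts [hi.trans hL, hi.trans hL', (hF i hi).1]
    · rw [Finset.disjoint_left]
      intro i hi hi'
      simp only [Finset.mem_union, Finset.mem_filter, Finset.mem_univ, true_and] at hi
      rcases hi with hi | hi
      exacts [hdis (hF i hi').2.1 subset_rfl hi, hdis (hF i hi').2.2 subset_rfl hi]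
    · rw [Finset.disjoint_left]
      intro i hi hi'
      simp only [Finset.mem_filter, Finset.mem_univ, true_and] at hi hi'
      exact hdis hd hi hi'
  unfold cost
  linarith

theorem cost_add_cost_le (hP : IsContinuumFamily P) (hρ : ∀ i, 0 ≤ ρ i)
    (hK : μH[1] (freePart P K) ≠ ⊤) (hL : L ⊆ K) (hL' : L' ⊆ K) (hd : Disjoint L L')
    (hLc : IsCompact L') : cost P ρ L + cost P ρ L' ≤ cost P ρ K := by
  simpa using cost_add_cost_add_sum_le hP hρ hK hL hL' hd hLc ∅ (by simp)

open Classical in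
theorem cost_add_sum_le (hP : IsContinuumFamily P) (hρ : ∀ i, 0 ≤ ρ i)
    (hK : μH[1] (freePart P K) ≠ ⊤) (hL : L ⊆ K) (F : Finset ι)
    (hF : ∀ i ∈ F, P i ⊆ K ∧ Disjoint (P i) L) :
    cost P ρ L + ∑ i ∈ F, ρ i ≤ cost P ρ K := by
  simpa [cost_empty hP] using
    cost_add_cost_add_sum_le hP hρ hK hL (empty_subset K) (disjoint_empty L) isCompact_empty F
      fun i hi => ⟨(hF i hi).1, (hF i hi).2, disjoint_empty _⟩

/-- If the weights are at least the diameters, then the cost dominates the distance. -/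
theorem dominatesDist_of_diam_le (hP : IsContinuumFamily P)
    (hρ : ∀ i, Metric.diam (P i) ≤ ρ i) : DominatesDist P ρ 0 := by
  classical
  intro K hK hKt x hx y hy
  simp only [Pi.zero_apply, sub_zero]
  set f : ℂ → ℝ := fun z => dist x z
  have hf : LipschitzWith 1 f := LipschitzWith.dist_right x
  have hIcc : Icc 0 (dist x y) ⊆ f '' K := by
    have := hK.isConnected.isPreconnected.image f hf.continuous.continuousOn
    have h := this.Icc_subset (mem_image_of_mem f hx) (mem_image_of_mem f hy)
    simpa [f] using h
  have hcov : f '' K ⊆ f '' freePart P K ∪ ⋃ i ∈ (Finset.univ.filter fun i => P i ⊆ K),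
      f '' P i := by
    rintro _ ⟨z, hz, rfl⟩
    by_cases hzP : z ∈ ⋃ i, P i
    · obtain ⟨i, hi⟩ := mem_iUnion.1 hzP
      have hiK : P i ⊆ K := (hK.saturated i).resolve_right fun h => (Set.disjoint_left.1 h) hi hz
      exact Or.inr (mem_iUnion₂.2 ⟨i, by simpa using hiK, z, hi, rfl⟩)
    · exact Or.inl ⟨z, ⟨hz, hzP⟩, rfl⟩
  have hPi : ∀ i, volume (f '' P i) ≤ ENNReal.ofReal (Metric.diam (P i)) := by
    intro i
    refine (Real.volume_le_diam _).trans ?_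
    have h1 := hf.ediam_image_le (P i)
    rw [ENNReal.coe_one, one_mul] at h1
    rw [Metric.diam, ENNReal.ofReal_toReal (hP.isCompact i).isBounded.ediam_ne_top]
    exact h1
  have hfree : volume (f '' freePart P K) ≤ μH[1] (freePart P K) := by
    rw [← hausdorffMeasure_real]
    have := hf.hausdorffMeasure_image_le (d := 1) zero_le_one (freePart P K)
    simpa using this
  have key : ENNReal.ofReal (dist x y) ≤
      μH[1] (freePart P K) + ∑ i with P i ⊆ K, ENNReal.ofReal (Metric.diam (P i)) := by
    calc ENNReal.ofReal (dist x y) = volume (Icc 0 (dist x y)) := by simp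
      _ ≤ volume (f '' freePart P K ∪ ⋃ i ∈ (Finset.univ.filter fun i => P i ⊆ K), f '' P i) :=
          measure_mono (hIcc.trans hcov)
      _ ≤ _ := (measure_union_le _ _).trans (add_le_add hfree
          ((measure_biUnion_finset_le _ _).trans (Finset.sum_le_sum fun i _ => hPi i)))
  rw [← ENNReal.ofReal_sum_of_nonneg fun i _ => Metric.diam_nonneg,
    ← ENNReal.ofReal_toReal hKt, ← ENNReal.ofReal_add ENNReal.toReal_nonneg
      (Finset.sum_nonneg fun i _ => Metric.diam_nonneg)] at key
  have := (ENNReal.ofReal_le_ofReal_iff (add_nonneg ENNReal.toReal_nonneg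
      (Finset.sum_nonneg fun i _ => Metric.diam_nonneg))).1 key
  refine this.trans ?_
  unfold cost
  gcongr with i
  exact hρ i

end

section

variable {ι : Type*} [Fintype ι] {P : ι → Set ℂ} {ρ : ι → ℝ} {K : Set ℂ} {E : ℂ → ℝ}

open Classical in
/-- Lower bound for the cost of `K` by the costs outside a disk and the weights inside it. -/
theorem dist_sub_add_sum_le_cost (hP : IsContinuumFamily P) (hρ : ∀ i, 0 ≤ ρ i)
    (hE : ∀ z, 0 ≤ E z) (hK : IsSaturatedContinuum P K) (hKt : μH[1] (freePart P K) ≠ ⊤)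
    {c : ℂ} {r e : ℝ} (he : ∀ z ∈ Metric.closedBall c r, E z ≤ e)
    (hout : ∀ L, IsSaturatedContinuum P L → L ⊆ K \ core P (Metric.ball c r) →
      ∀ x ∈ L, ∀ y ∈ L, dist x y - E x - E y ≤ cost P ρ L)
    (hr : 0 < r) (hne : (K ∩ core P (Metric.ball c r)).Nonempty)
    (F : Finset ι) (hF : ∀ i ∈ F, P i ⊆ K ∧ P i ⊆ Metric.ball c r)
    {x y : ℂ} (hx : x ∈ K) (hy : y ∈ K) :
    dist x y - E x - E y - 2 * r - 2 * e + ∑ i ∈ F, ρ i ≤ cost P ρ K := by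
  have hO : IsOpen (Metric.ball c r) := Metric.isOpen_ball
  have he0 : 0 ≤ e := (hE c).trans (he c (Metric.mem_closedBall_self hr.le))
  have hFd : ∀ L ⊆ K \ core P (Metric.ball c r), ∀ i ∈ F, P i ⊆ K ∧ Disjoint (P i) L := by
    intro L hL i hi
    refine ⟨(hF i hi).1, Set.disjoint_left.2 fun z hz hzL => ?_⟩
    exact (hL hzL).2 (subset_core hP (hF i hi).2 hz)
  have hcl : ∀ b ∈ closure (Metric.ball c r), dist b c ≤ r ∧ E b ≤ e := fun b hb =>
    ⟨Metric.closure_ball_subset_closedBall hb, he b (Metric.closure_ball_subset_closedBall hb)⟩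
  -- The disk is jumped over: a piece of `K` outside its core joins `y` to a point `b` of the closed
  -- disk, and going from `x` to `b` costs at most `2 * r` in distance.
  have hone : ∀ x ∈ K, ∀ y ∈ K, x ∈ core P (Metric.ball c r) → y ∉ core P (Metric.ball c r) →
      dist x y - E x - E y - 2 * r - 2 * e + ∑ i ∈ F, ρ i ≤ cost P ρ K := by
    intro x hx y hy hxO hyO
    obtain ⟨L, hL, hyL, hLK, b, hb, hbO⟩ := hK.exists_excision hP hO hy hyO hne
    have h1 := cost_add_sum_le hP hρ hKt (hLK.trans sdiff_subset) F (hFd L hLK)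
    have h2 := hout L hL hLK b hb y hyL
    have h3 := hcl b hbO
    have h4 : dist x c < r := core_subset hxO
    have h5 := dist_triangle4 x c b y
    have h6 := hE x
    rw [dist_comm c b] at h5
    linarith
  by_cases hxO : x ∈ core P (Metric.ball c r) <;> by_cases hyO : y ∈ core P (Metric.ball c r)
  · have h1 := cost_add_sum_le hP hρ hKt (empty_subset K) F (hFd ∅ (empty_subset _))
    rw [cost_empty hP] at h1
    have h2 : dist x c < r := core_subset hxO
    have h3 : dist y c < r := core_subset hyO
    have h4 := dist_triangle_right x y c
    have h5 := hE x
    have h6 := hE y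
    linarith
  · exact hone x hx y hy hxO hyO
  · have := hone y hy x hx hyO hxO
    rw [dist_comm] at this
    linarith
  · rcases hK.exists_excision_pair hP hO hx hxO hy hyO hne with
      ⟨L, hL, hxL, hyL, hLK⟩ | ⟨L, L', hL, hL', hxL, hyL', hd, hLK, hLK', ⟨b, hb, hbO⟩,
        b', hb', hbO'⟩
    · have h1 := cost_add_sum_le hP hρ hKt (hLK.trans sdiff_subset) F (hFd L hLK)
      have h2 := hout L hL hLK x hxL y hyL
      linarith
    · have h1 := cost_add_cost_add_sum_le hP hρ hKt (hLK.trans sdiff_subset)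
        (hLK'.trans sdiff_subset) hd hL'.isCompact F
        fun i hi => ⟨(hFd L hLK i hi).1, (hFd L hLK i hi).2, (hFd L' hLK' i hi).2⟩
      have h2 := hout L hL hLK x hxL b hb
      have h3 := hout L' hL' hLK' b' hb' y hyL'
      have h4 := hcl b hbO
      have h5 := hcl b' hbO'
      have h6 := dist_triangle4 x b b' y
      have h7 := dist_triangle_right b b' c
      linarith

/-- A saturated continuum that contains a member of the family has large cost. -/
theorem DominatesDist.add_weight_le_cost (hD : DominatesDist P ρ E) (hP : IsContinuumFamily P)
    (hρ : ∀ i, 0 ≤ ρ i) (hE : ∀ z, 0 ≤ E z) {M : ℝ} (hM : ∀ z, E z ≤ M)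
    (hK : IsSaturatedContinuum P K) (hKt : μH[1] (freePart P K) ≠ ⊤) {i : ι} (hi : P i ⊆ K)
    (hdi : 0 < Metric.diam (P i)) {x y : ℂ} (hx : x ∈ K) (hy : y ∈ K) :
    dist x y - E x - E y - 4 * Metric.diam (P i) - 2 * M + ρ i ≤ cost P ρ K := by
  classical
  obtain ⟨c, hc⟩ := (hP.isConnected i).nonempty
  -- The radius is twice the diameter so that the open disk contains `P i`; jumping over this disk
  -- is the loss `4 * Metric.diam (P i)`.
  have hsub : P i ⊆ Metric.ball c (2 * Metric.diam (P i)) := by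
    intro z hz
    have := Metric.dist_le_diam_of_mem (hP.isCompact i).isBounded hz hc
    rw [Metric.mem_ball]
    linarith
  have := dist_sub_add_sum_le_cost hP hρ hE hK hKt (c := c) (r := 2 * Metric.diam (P i)) (e := M)
    (fun z _ => hM z) (fun L hL hLK x hx y hy => hD L hL
      (hausdorffMeasure_freePart_ne_top hKt (hLK.trans sdiff_subset)) x hx y hy)
    (by positivity) ⟨c, hi hc, subset_core hP hsub hc⟩ {i} (by simp [hi, hsub]) hx hy
  rw [Finset.sum_singleton] at this
  linarith

/-- Either a small disk around a point of `K` separates `x` and `y` in `K`, or the cost of `K` is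
larger than expected. -/
theorem DominatesDist.gain_or_separates (hD : DominatesDist P ρ E) (hP : IsContinuumFamily P)
    (hρ : ∀ i, 0 ≤ ρ i) (hE : ∀ z, 0 ≤ E z) {M : ℝ} (hM : ∀ z, E z ≤ M)
    (hK : IsSaturatedContinuum P K) (hKt : μH[1] (freePart P K) ≠ ⊤)
    {z : ℂ} {s e A : ℝ} (hs : 0 < s) (he : ∀ u ∈ Metric.closedBall z s, E u ≤ e)
    (hA : 4 ≤ A) (hAs : s + 2 * M ≤ (A - 4) * (s / 2))
    (hund : ∀ i, (P i ∩ Metric.closedBall z (s / 2)).Nonempty → s / 2 ≤ Metric.diam (P i) →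
      A * Metric.diam (P i) ≤ ρ i)
    (hz : z ∈ K) {x y : ℂ} (hx : x ∈ K) (hy : y ∈ K) (hxz : s ≤ dist x z) (hyz : s ≤ dist y z) :
    dist x y - E x - E y + (s / 2 - 2 * e) ≤ cost P ρ K ∨
    ∃ L L', IsSaturatedContinuum P L ∧ IsSaturatedContinuum P L' ∧ L ⊆ K ∧ L' ⊆ K ∧
      Disjoint L L' ∧ x ∈ L ∧ y ∈ L' ∧ (∃ b ∈ L, dist b z ≤ s) ∧ ∃ b ∈ L', dist b z ≤ s := by
  have he0 : 0 ≤ e := (hE z).trans (he z (Metric.mem_closedBall_self hs.le))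
  -- A member reaching from the half disk out of the disk has diameter at least `s / 2` and full
  -- weight, so its weight alone yields the gain. Without such members, cuts at radii `s / 2` and
  -- `s` do not interfere.
  by_cases hbig : ∃ i, P i ⊆ K ∧ (P i ∩ Metric.closedBall z (s / 2)).Nonempty ∧
      ¬ P i ⊆ Metric.ball z s
  · left
    obtain ⟨i, hiK, ⟨u, hui, huz⟩, hi⟩ := hbig
    obtain ⟨v, hvi, hvz⟩ := Set.not_subset.1 hi
    rw [Metric.mem_closedBall] at huz
    rw [Metric.mem_ball, not_lt] at hvz
    have h1 := Metric.dist_le_diam_of_mem (hP.isCompact i).isBounded hvi hui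
    have h2 := dist_triangle v u z
    have h3 : s / 2 ≤ Metric.diam (P i) := by linarith
    have h4 := hund i ⟨u, hui, huz⟩ h3
    have h5 := hD.add_weight_le_cost hP hρ hE hM hK hKt hiK (by linarith) hx hy
    have h6 : (A - 4) * (s / 2) ≤ (A - 4) * Metric.diam (P i) :=
      mul_le_mul_of_nonneg_left h3 (by linarith)
    linarith
  push Not at hbig
  have hOo : IsOpen (Metric.ball z s) := Metric.isOpen_ball
  have hin : ∀ u ∈ K, u ∉ core P (Metric.closedBall z (s / 2))ᶜ → u ∈ core P (Metric.ball z s) := by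
    intro u hu hu'
    by_cases huz : u ∈ Metric.closedBall z (s / 2)
    · refine mem_core_of_forall (Metric.closedBall_subset_ball (by linarith) huz) fun i hui => ?_
      exact hbig i ((hK.saturated i).resolve_right fun h => (Set.disjoint_left.1 h) hui hu)
        ⟨u, hui, huz⟩
    · have : ∃ i, u ∈ P i ∧ ¬ P i ⊆ (Metric.closedBall z (s / 2))ᶜ := by
        by_contra! hcon
        exact hu' (mem_core_of_forall huz hcon)
      obtain ⟨i, hui, hi⟩ := this
      obtain ⟨v, hvi, hv⟩ := Set.not_subset.1 hi
      exact subset_core hP (hbig i ((hK.saturated i).resolve_right fun h =>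
        (Set.disjoint_left.1 h) hui hu) ⟨v, hvi, not_not.1 hv⟩) hui
  have hzO : z ∈ core P (Metric.ball z s) := hin z hz fun h =>
    core_subset h (Metric.mem_closedBall_self (by linarith))
  have hxO : x ∉ core P (Metric.ball z s) := fun h => (not_lt.2 hxz) (core_subset h)
  have hyO : y ∉ core P (Metric.ball z s) := fun h => (not_lt.2 hyz) (core_subset h)
  rcases hK.exists_excision_pair hP hOo hx hxO hy hyO ⟨z, hz, hzO⟩ with
    ⟨L, hL, hxL, hyL, hLK⟩ | ⟨L, L', hL, hL', hxL, hyL', hd, hLK, hLK', ⟨b, hb, hbO⟩,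
      b', hb', hbO'⟩
  -- Here `x` and `y` are still joined by `L` away from `z`, so the piece `Y` of `K` from `z` out to
  -- distance `s / 2` is superfluous; it is disjoint from `L` and costs at least `s / 2 - 2 * e`.
  · left
    have hxO2 : x ∈ core P (Metric.closedBall z (s / 2))ᶜ := by
      by_contra h
      exact hxO (hin x hx h)
    obtain ⟨Y, hY, hzY, hYK, b, hb, hbO⟩ := hK.exists_excision hP
      Metric.isClosed_closedBall.isOpen_compl hz
      (fun h => core_subset h (Metric.mem_closedBall_self (by linarith))) ⟨x, hx, hxO2⟩
    have hYO : Y ⊆ core P (Metric.ball z s) := fun u hu => hin u (hYK hu).1 (hYK hu).2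
    have hdis : Disjoint L Y := Set.disjoint_left.2 fun u hu huY => (hLK hu).2 (hYO huY)
    have h1 := cost_add_cost_le hP hρ hKt (hLK.trans sdiff_subset) (hYK.trans sdiff_subset)
      hdis hY.isCompact
    have h2 := hD L hL (hausdorffMeasure_freePart_ne_top hKt (hLK.trans sdiff_subset)) x hxL y hyL
    have h3 := hD Y hY (hausdorffMeasure_freePart_ne_top hKt (hYK.trans sdiff_subset)) b hb z hzY
    have h4 : s / 2 ≤ dist b z := by
      have hcl : closure (Metric.closedBall z (s / 2))ᶜ ⊆ {u | s / 2 ≤ dist u z} := by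
        refine closure_minimal (fun u hu => ?_)
          (isClosed_le continuous_const (continuous_id.dist continuous_const))
        rw [mem_compl_iff, Metric.mem_closedBall, not_le] at hu
        exact hu.le
      exact hcl hbO
    have h5 := he b (Metric.ball_subset_closedBall (core_subset (hYO hb)))
    have h6 := he z (Metric.mem_closedBall_self hs.le)
    linarith
  · right
    exact ⟨L, L', hL, hL', hLK.trans sdiff_subset, hLK'.trans sdiff_subset, hd, hxL, hyL',
      ⟨b, hb, Metric.closure_ball_subset_closedBall hbO⟩,
      b', hb', Metric.closure_ball_subset_closedBall hbO'⟩

end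

/-! ### Crossing continua -/

theorem abs_sub_lt_pi_of_sin_ne_zero {φ : ℝ → ℝ} (hφ : Continuous φ)
    (h : ∀ t ∈ Icc (0 : ℝ) 1, Real.sin (φ t) ≠ 0) : |φ 1 - φ 0| < Real.pi := by
  by_contra! hcon
  have hpi := Real.pi_pos
  have hcov : uIcc (φ 0) (φ 1) ⊆ φ '' Icc 0 1 := by
    have := intermediate_value_uIcc (a := (0 : ℝ)) (b := 1) hφ.continuousOn
    rwa [uIcc_of_le zero_le_one] at this
  set m := min (φ 0) (φ 1)
  set n : ℤ := ⌈m / Real.pi⌉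
  have h1 : m ≤ n * Real.pi := by
    have := Int.le_ceil (m / Real.pi)
    rwa [div_le_iff₀ hpi] at this
  have h2 : n * Real.pi ≤ max (φ 0) (φ 1) := by
    have := Int.ceil_lt_add_one (m / Real.pi)
    have h3 : (n : ℝ) * Real.pi < (m / Real.pi + 1) * Real.pi := by gcongr
    rw [add_mul, div_mul_cancel₀ _ hpi.ne', one_mul] at h3
    have h4 := max_sub_min_eq_abs (φ 0) (φ 1)
    linarith
  obtain ⟨t, ht, htn⟩ := hcov ⟨h1, h2⟩
  exact h t ht (by rw [htn]; exact Real.sin_int_mul_pi n)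

theorem abs_sub_lt_pi_of_cos_ne_zero {φ : ℝ → ℝ} (hφ : Continuous φ)
    (h : ∀ t ∈ Icc (0 : ℝ) 1, Real.cos (φ t) ≠ 0) : |φ 1 - φ 0| < Real.pi := by
  have := abs_sub_lt_pi_of_sin_ne_zero (φ := fun t => φ t + Real.pi / 2) (by fun_prop)
    (fun t ht => by rw [Real.sin_add_pi_div_two]; exact h t ht)
  simpa using this

/-- Here `y` is the representative of the angle in `(-π, π]`, so that the signs of sine and cosine
determine its quadrant. -/
theorem exists_int_quadrant (x : ℝ) : ∃ (k : ℤ) (y : ℝ), x = y + k * (2 * Real.pi) ∧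
    (0 < Real.sin x → 0 < y ∧ y < Real.pi) ∧ (Real.sin x < 0 → -Real.pi < y ∧ y < 0) ∧
    (0 < Real.cos x → -(Real.pi / 2) < y ∧ y < Real.pi / 2) ∧
    (Real.cos x < 0 → y < -(Real.pi / 2) ∨ Real.pi / 2 < y) := by
  have hpi := Real.pi_pos
  obtain ⟨k, hk, -⟩ := existsUnique_add_zsmul_mem_Ioc (by positivity : 0 < 2 * Real.pi) x (-Real.pi)
  rw [zsmul_eq_mul] at hk
  set y := x + k * (2 * Real.pi)
  have h1 : -Real.pi < y := hk.1
  have h2 : y ≤ Real.pi := by have := hk.2; linarith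
  have hx : x = y + ((-k : ℤ) : ℝ) * (2 * Real.pi) := by simp only [y]; push_cast; ring
  have hs : Real.sin x = Real.sin y := by rw [hx, Real.sin_add_int_mul_two_pi]
  have hc : Real.cos x = Real.cos y := by rw [hx, Real.cos_add_int_mul_two_pi]
  refine ⟨-k, y, hx, ?_, ?_, ?_, ?_⟩
  · rw [hs]
    intro h
    refine ⟨?_, lt_of_le_of_ne h2 ?_⟩
    · by_contra! hy
      exact absurd (Real.sin_nonpos_of_nonpos_of_neg_pi_le hy h1.le) (not_le.2 h)
    · rintro hy
      rw [hy, Real.sin_pi] at h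
      exact lt_irrefl _ h
  · rw [hs]
    intro h
    refine ⟨h1, ?_⟩
    by_contra! hy
    exact absurd (Real.sin_nonneg_of_nonneg_of_le_pi hy h2) (not_le.2 h)
  · rw [hc]
    intro h
    constructor
    · by_contra! hy
      have := Real.cos_nonpos_of_pi_div_two_le_of_le (x := -y) (by linarith) (by linarith)
      rw [Real.cos_neg] at this
      linarith
    · by_contra! hy
      have := Real.cos_nonpos_of_pi_div_two_le_of_le (x := y) (by linarith) (by linarith)
      linarith
  · rw [hc]
    intro h
    by_contra! hy
    have := Real.cos_nonneg_of_neg_pi_div_two_le_of_le (x := y) hy.1 hy.2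
    linarith

theorem int_eq_zero_of_abs_lt_pi {n : ℤ} {r : ℝ} (h : |r + n * (2 * Real.pi)| < Real.pi)
    (h0 : -Real.pi < r) (h1 : r < Real.pi) : n = 0 := by
  have hpi := Real.pi_pos
  rw [abs_lt] at h
  have h2 : (n : ℝ) < 1 := by
    by_contra! hc
    have := mul_le_mul_of_nonneg_right hc (by positivity : 0 ≤ 2 * Real.pi)
    linarith
  have h3 : (-1 : ℝ) < n := by
    by_contra! hc
    have := mul_le_mul_of_nonneg_right hc (by positivity : 0 ≤ 2 * Real.pi)
    linarith
  have h4 : n < 1 := by exact_mod_cast h2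
  have h5 : -1 < n := by exact_mod_cast h3
  omega

/-- A map of the plane that maps the four sides of the unit square to the upper, lower, right and
left half-planes has a zero. -/
theorem exists_eq_zero_of_sides {F : ℝ × ℝ → ℂ} (hF : Continuous F)
    (h0 : ∀ t ∈ Icc (0 : ℝ) 1, 0 < (F (0, t)).im) (h1 : ∀ t ∈ Icc (0 : ℝ) 1, (F (1, t)).im < 0)
    (h2 : ∀ s ∈ Icc (0 : ℝ) 1, 0 < (F (s, 0)).re) (h3 : ∀ s ∈ Icc (0 : ℝ) 1, (F (s, 1)).re < 0) :
    ∃ p, F p = 0 := by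
  by_contra! hne
  -- Without zeros `F` has a continuous logarithm on the plane. Its argument moves by less than `π`
  -- along each side, while the quadrants of the four corners force one full turn around the
  -- boundary.
  obtain ⟨G, ⟨-, hG⟩, -⟩ := Complex.isCoveringMapOn_exp.existsUnique_continuousMap_lifts
    ⟨F, hF⟩ (a₀ := (0, 0)) (e₀ := Complex.log (F (0, 0))) (Complex.exp_log (hne _))
    (fun x => by simpa using hne x)
  have hexp : ∀ p, Complex.exp (G p) = F p := fun p => congrFun hG p
  set θ : ℝ × ℝ → ℝ := fun p => (G p).im
  have hθ : Continuous θ := Complex.continuous_im.comp G.continuous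
  have him : ∀ p, (F p).im = Real.exp (G p).re * Real.sin (θ p) := fun p => by
    rw [← hexp, Complex.exp_im]
  have hre : ∀ p, (F p).re = Real.exp (G p).re * Real.cos (θ p) := fun p => by
    rw [← hexp, Complex.exp_re]
  have sin_pos : ∀ p, 0 < (F p).im → 0 < Real.sin (θ p) := fun p hp =>
    pos_of_mul_pos_right (him p ▸ hp) (Real.exp_pos _).le
  have sin_neg : ∀ p, (F p).im < 0 → Real.sin (θ p) < 0 := fun p hp =>
    neg_of_mul_neg_right (him p ▸ hp) (Real.exp_pos _).le
  have cos_pos : ∀ p, 0 < (F p).re → 0 < Real.cos (θ p) := fun p hp =>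
    pos_of_mul_pos_right (hre p ▸ hp) (Real.exp_pos _).le
  have cos_neg : ∀ p, (F p).re < 0 → Real.cos (θ p) < 0 := fun p hp =>
    neg_of_mul_neg_right (hre p ▸ hp) (Real.exp_pos _).le
  have z0 : (0 : ℝ) ∈ Icc (0 : ℝ) 1 := by simp
  have z1 : (1 : ℝ) ∈ Icc (0 : ℝ) 1 := by simp
  have e0 := abs_sub_lt_pi_of_sin_ne_zero (φ := fun t => θ (0, t)) (by fun_prop)
    fun t ht => (sin_pos _ (h0 t ht)).ne'
  have e1 := abs_sub_lt_pi_of_sin_ne_zero (φ := fun t => θ (1, t)) (by fun_prop)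
    fun t ht => (sin_neg _ (h1 t ht)).ne
  have e2 := abs_sub_lt_pi_of_cos_ne_zero (φ := fun s => θ (s, 0)) (by fun_prop)
    fun t ht => (cos_pos _ (h2 t ht)).ne'
  have e3 := abs_sub_lt_pi_of_cos_ne_zero (φ := fun s => θ (s, 1)) (by fun_prop)
    fun t ht => (cos_neg _ (h3 t ht)).ne
  obtain ⟨ka, a, ha, as, -, ac, -⟩ := exists_int_quadrant (θ (0, 0))
  obtain ⟨kb, b, hb, -, bs, bc, -⟩ := exists_int_quadrant (θ (1, 0))
  obtain ⟨kc, c, hc, -, cs, -, cc⟩ := exists_int_quadrant (θ (1, 1))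
  obtain ⟨kd, d, hd, ds, -, -, dc⟩ := exists_int_quadrant (θ (0, 1))
  have as := as (sin_pos _ (h0 0 z0))
  have ac := ac (cos_pos _ (h2 0 z0))
  have bs := bs (sin_neg _ (h1 0 z0))
  have bc := bc (cos_pos _ (h2 1 z1))
  have cs := cs (sin_neg _ (h1 1 z1))
  have cc := cc (cos_neg _ (h3 1 z1))
  have ds := ds (sin_pos _ (h0 1 z1))
  have dc := dc (cos_neg _ (h3 0 z0))
  have hpi := Real.pi_pos
  have cc : c < -(Real.pi / 2) := cc.resolve_right (by linarith)
  have dc : Real.pi / 2 < d := dc.resolve_left (by linarith)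
  have k0 : kd - ka = 0 := int_eq_zero_of_abs_lt_pi (r := d - a)
    (by convert e0 using 2; rw [ha, hd]; push_cast; ring) (by linarith) (by linarith)
  have k1 : kc - kb = 0 := int_eq_zero_of_abs_lt_pi (r := c - b)
    (by convert e1 using 2; rw [hc, hb]; push_cast; ring) (by linarith) (by linarith)
  have k2 : kb - ka = 0 := int_eq_zero_of_abs_lt_pi (r := b - a)
    (by convert e2 using 2; rw [hb, ha]; push_cast; ring) (by linarith) (by linarith)
  -- Only this side crosses the branch cut on the negative axis, whence the shift by one turn that
  -- contradicts the three other sides.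
  have k3 : kc - kd - 1 = 0 := int_eq_zero_of_abs_lt_pi (r := c - d + 2 * Real.pi)
    (by convert e3 using 2; rw [hc, hd]; push_cast; ring) (by linarith) (by linarith)
  omega

/-- A continuum in a horizontal strip that crosses a rectangle from left to right meets every
path-connected set in the rectangle that crosses the strip. -/
theorem inter_nonempty_of_crossing {Z T : Set ℂ} (hZ : IsCompact Z) (hZc : IsConnected Z)
    (hT : IsPathConnected T) {h l : ℝ} (hZh : ∀ z ∈ Z, |z.im| ≤ h)
    (hTl : ∀ z ∈ T, |z.re| < l) {a b p q : ℂ} (ha : a ∈ Z) (hal : a.re ≤ -l) (hb : b ∈ Z)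
    (hbl : l ≤ b.re) (hp : p ∈ T) (hph : h < p.im) (hq : q ∈ T) (hqh : q.im < -h) :
    (Z ∩ T).Nonempty := by
  by_contra hcon
  rw [← not_disjoint_iff_nonempty_inter, not_not] at hcon
  obtain ⟨f, hf⟩ := hT.joinedIn p hp q hq
  have hfc : IsCompact (range f) := isCompact_range f.continuous
  obtain ⟨δ, hδ, hdis⟩ := (hcon.mono_right (range_subset_iff.2 hf)).exists_thickenings hZ
    hfc.isClosed
  set η := min δ (min (p.im - h) (-h - q.im))
  have hη : 0 < η := lt_min hδ (lt_min (by linarith) (by linarith))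
  have hη1 : η ≤ p.im - h := (min_le_right _ _).trans (min_le_left _ _)
  have hη2 : η ≤ -h - q.im := (min_le_right _ _).trans (min_le_right _ _)
  -- `Z` need not contain any path. Its small neighbourhood is open and, as the image of `Z × ball`
  -- under addition, connected; hence it is path-connected.
  have hth : IsConnected (Metric.thickening η Z) := by
    have h1 : (fun x : ℂ × ℂ => x.1 + x.2) '' (Z ×ˢ Metric.ball (0 : ℂ) η) =
        Metric.thickening η Z := by
      rw [← add_ball_zero, ← image2_add, ← image_uncurry_prod]
      rfl
    rw [← h1]
    refine (hZc.prod ?_).image _ (by fun_prop)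
    exact ((convex_ball (0 : ℂ) η).isPathConnected ⟨0, by simpa using hη⟩).isConnected
  have hpc : IsPathConnected (Metric.thickening η Z) :=
    Metric.isOpen_thickening.isConnected_iff_isPathConnected.1 hth
  obtain ⟨g, hg⟩ := hpc.joinedIn a (Metric.self_subset_thickening hη _ ha) b
    (Metric.self_subset_thickening hη _ hb)
  have hgt : ∀ t, g.extend t ∈ Metric.thickening η Z := fun t => by
    have : g.extend t ∈ range g := g.extend_range ▸ mem_range_self t
    obtain ⟨u, hu⟩ := this
    exact hu ▸ hg u
  have hft : ∀ t, f.extend t ∈ range f := fun t => f.extend_range ▸ mem_range_self t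
  have hfT : ∀ t, f.extend t ∈ T := fun t => by
    obtain ⟨u, hu⟩ := hft t
    exact hu ▸ hf u
  have hgim : ∀ t, |(g.extend t).im| < h + η := fun t => by
    obtain ⟨z, hz, hzt⟩ := Metric.mem_thickening_iff.1 (hgt t)
    have h1 := Complex.abs_im_le_norm (g.extend t - z)
    rw [Complex.sub_im, ← dist_eq_norm] at h1
    have h2 := hZh z hz
    rw [abs_le] at h1 h2
    rw [abs_lt]
    constructor <;> linarith
  obtain ⟨⟨s, t⟩, hst⟩ := exists_eq_zero_of_sides
    (F := fun x : ℝ × ℝ => f.extend x.1 - g.extend x.2)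
    ((f.continuous_extend.comp continuous_fst).sub (g.continuous_extend.comp continuous_snd))
    (fun t _ => by
      have := (abs_lt.1 (hgim t)).2
      simp only [Path.extend_zero, Complex.sub_im]; linarith)
    (fun t _ => by
      have := (abs_lt.1 (hgim t)).1
      simp only [Path.extend_one, Complex.sub_im]; linarith)
    (fun s _ => by
      have := (abs_lt.1 (hTl _ (hfT s))).1
      simp only [Path.extend_zero, Complex.sub_re]; linarith)
    (fun s _ => by
      have := (abs_lt.1 (hTl _ (hfT s))).2
      simp only [Path.extend_one, Complex.sub_re]; linarith)
  have heq : f.extend s = g.extend t := sub_eq_zero.1 hst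
  refine Set.disjoint_left.1 hdis (Metric.thickening_mono (min_le_left _ _) _ (hgt t)) ?_
  rw [← heq]
  exact Metric.self_subset_thickening hδ _ (hft s)

/-! ### Obstacles -/

/-- A path-connected set that is not flat at scale `d` as seen from the point `w`, which is not
close to the set. -/
structure IsObstacle (T : Set ℂ) (w : ℂ) (d η ε : ℝ) : Prop where
  isPathConnected : IsPathConnected T
  disjoint_ball : Disjoint T (Metric.ball w (2 * ε * d))
  exists_le_im : ∀ e : ℂ, ‖e‖ = 1 → ∃ v ∈ T, η * d ≤ ((v - w) * conj e).im

/-- Used to truncate a long continuum to the disk where its straightness is known, while it still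
reaches the boundary circle. -/
theorem exists_subcontinuum_to_sphere {L : Set ℂ} (hL : IsCompact L) (hLc : IsConnected L)
    {b x c : ℂ} {r : ℝ} (hb : b ∈ L) (hbc : dist b c ≤ r) (hx : x ∈ L) (hxc : r < dist x c) :
    ∃ Z ⊆ L, IsCompact Z ∧ IsConnected Z ∧ b ∈ Z ∧ Z ⊆ Metric.closedBall c r ∧
      ∃ u ∈ Z, dist u c = r := by
  have hUo : IsOpen (Metric.closedBall c r)ᶜ := Metric.isClosed_closedBall.isOpen_compl
  have hbm : b ∈ L \ (Metric.closedBall c r)ᶜ := ⟨hb, fun h => h hbc⟩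
  have hsub : connectedComponentIn (L \ (Metric.closedBall c r)ᶜ) b ⊆ Metric.closedBall c r :=
    fun z hz => not_not.1 (connectedComponentIn_subset _ _ hz).2
  refine ⟨connectedComponentIn (L \ (Metric.closedBall c r)ᶜ) b,
    (connectedComponentIn_subset _ _).trans sdiff_subset, ?_,
    isConnected_connectedComponentIn_iff.2 hbm, mem_connectedComponentIn hbm, hsub, ?_⟩
  · have : CompactSpace (L \ (Metric.closedBall c r)ᶜ : Set ℂ) :=
      isCompact_iff_compactSpace.1 (hL.diff hUo)
    rw [connectedComponentIn, dif_pos hbm]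
    exact isClosed_connectedComponent.isCompact.image continuous_subtype_val
  · obtain ⟨u, hu, hu'⟩ := exists_mem_connectedComponentIn_closure hL hLc.isPreconnected hUo hbm
      ⟨x, hx, fun h => (not_le.2 hxc) h⟩
    refine ⟨u, hu, le_antisymm (hsub hu) ?_⟩
    have hcl : closure (Metric.closedBall c r)ᶜ ⊆ {u | r ≤ dist u c} := by
      refine closure_minimal (fun u hu => ?_)
        (isClosed_le continuous_const (continuous_id.dist continuous_const))
      rw [mem_compl_iff, Metric.mem_closedBall, not_le] at hu
      exact hu.le
    exact hcl hu'

theorem re_mul_conj_le (v e : ℂ) (he : ‖e‖ = 1) : (v * conj e).re ≤ ‖v‖ := by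
  have := Complex.re_le_norm (v * conj e)
  rwa [norm_mul, RCLike.norm_conj, he, mul_one] at this

/-- Pythagoras: `v.im ^ 2 = (‖v‖ - v.re) * (‖v‖ + v.re) ≤ 2 * τ * r`. A length excess `τ` thus
permits only a deviation of order `√τ`. -/
theorem abs_im_le_of_norm_sub_re_le {v : ℂ} {τ r h : ℝ} (hτ : ‖v‖ - v.re ≤ τ) (hr : ‖v‖ ≤ r)
    (h0 : 0 ≤ h) (hh : 2 * τ * r ≤ h ^ 2) : |v.im| ≤ h := by
  refine abs_le_of_sq_le_sq ?_ h0
  have h1 : ‖v‖ ^ 2 = v.re ^ 2 + v.im ^ 2 := by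
    rw [Complex.sq_norm, Complex.normSq_apply]; ring
  have h2 := abs_le.1 (Complex.abs_re_le_norm v)
  have h3 := norm_nonneg v
  nlinarith [mul_nonneg (sub_nonneg.2 hτ) (sub_nonneg.2 hr),
    mul_nonneg (sub_nonneg.2 h2.2) (sub_nonneg.2 hr)]

/-- There is no nearly straight pair of continua that passes an obstacle. -/
theorem IsObstacle.false_of_nearly_straight {T L L' : Set ℂ} {w : ℂ} {d η ε : ℝ}
    (hT : IsObstacle T w d η ε) (hd : 0 < d) (hη : 0 < η) (hη1 : η ≤ 1)
    (hε1 : ε ≤ η / 8) (hTw : T ⊆ Metric.closedBall w (2 * d))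
    (hL : IsCompact L) (hLc : IsConnected L) (hL' : IsCompact L') (hLc' : IsConnected L')
    (hLT : Disjoint L T) (hLT' : Disjoint L' T) {z x y b b' : ℂ} {s τ : ℝ}
    (hs : 0 < s) (hs1 : s ≤ ε * d) (hτ : τ ≤ η ^ 2 * d / 100)
    (hz : dist z w < ε * d) (hx : x ∈ L) (hy : y ∈ L') (hxw : 4 * d ≤ dist x w)
    (hyw : 4 * d ≤ dist y w) (hb : b ∈ L) (hbz : dist b z ≤ s) (hb' : b' ∈ L')
    (hbz' : dist b' z ≤ s)
    (hLs : ∀ u ∈ L, dist u w ≤ 6 * d → dist x u + dist u z + dist z y ≤ dist x y + τ)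
    (hLs' : ∀ u ∈ L', dist u w ≤ 6 * d → dist x z + dist z u + dist u y ≤ dist x y + τ) :
    False := by
  have hεd : ε * d ≤ d / 8 := by nlinarith
  have hηd : η * d ≤ d := by nlinarith
  have hεη : ε * d ≤ η * d / 8 := by nlinarith
  have hτd : τ ≤ d / 100 := by
    have : η ^ 2 ≤ 1 := by nlinarith
    nlinarith
  have hxz : 3 * d < dist x z := by
    have := dist_triangle x z w
    linarith
  have hyz : 3 * d < dist y z := by
    have := dist_triangle y z w
    linarith
  have hsum : dist x z + dist z y ≤ dist x y + τ := by
    have h1 := hLs b hb (by have := dist_triangle b z w; linarith)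
    have h2 := dist_triangle x b z
    linarith
  have hxy : 0 < dist x y := by
    rw [dist_comm y z] at hyz
    linarith
  -- Coordinates are rotated and centred at `z`, with the line from `y` to `x` as real direction.
  -- Small excess in the triangle inequality confines both continua to a horizontal strip.
  set e : ℂ := (x - y) / (dist x y : ℂ) with he_def
  have hnorm : ‖e‖ = 1 := by
    rw [he_def, norm_div, ← dist_eq_norm, Complex.norm_real, Real.norm_of_nonneg hxy.le,
      div_self hxy.ne']
  have hexy : ((x - y) * conj e).re = dist x y := by
    have h1 : x - y = e * (dist x y : ℂ) := by
      rw [he_def, div_mul_cancel₀]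
      exact_mod_cast hxy.ne'
    have h2 : e * conj e = 1 := by
      rw [Complex.mul_conj, Complex.normSq_eq_norm_sq, hnorm]; simp
    rw [h1, mul_right_comm, h2, one_mul, Complex.ofReal_re]
  set m : ℂ → ℂ := fun u => (u - z) * conj e
  have hmc : Continuous m := by fun_prop
  have hmn : ∀ u, ‖m u‖ = dist u z := fun u => by
    simp only [m]
    rw [norm_mul, RCLike.norm_conj, hnorm, mul_one, dist_eq_norm]
  have hre : ∀ u ∈ L, dist u w ≤ 6 * d → dist u z - (m u).re ≤ τ := by
    intro u hu huw
    have h1 := hLs u hu huw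
    have h2 := re_mul_conj_le (x - u) e hnorm
    have h3 := re_mul_conj_le (z - y) e hnorm
    rw [← dist_eq_norm] at h2 h3
    have h4 : (x - y) * conj e = (x - u) * conj e + m u + (z - y) * conj e := by
      simp only [m]; ring
    rw [h4, Complex.add_re, Complex.add_re] at hexy
    linarith
  have hre' : ∀ u ∈ L', dist u w ≤ 6 * d → dist u z + (m u).re ≤ τ := by
    intro u hu huw
    have h1 := hLs' u hu huw
    have h2 := re_mul_conj_le (x - z) e hnorm
    have h3 := re_mul_conj_le (u - y) e hnorm
    rw [← dist_eq_norm] at h2 h3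
    have h4 : (x - y) * conj e = (x - z) * conj e - m u + (u - y) * conj e := by
      simp only [m]; ring
    rw [h4, Complex.add_re, Complex.sub_re] at hexy
    rw [dist_comm u z]
    linarith
  obtain ⟨Z, hZL, hZ, hZc, hbZ, hZb, u, hu, huz⟩ := exists_subcontinuum_to_sphere hL hLc hb
    (hbz.trans (by linarith : s ≤ 3 * d)) hx hxz
  obtain ⟨Z', hZL', hZ', hZc', hbZ', hZb', u', hu', huz'⟩ := exists_subcontinuum_to_sphere hL' hLc'
    hb' (hbz'.trans (by linarith : s ≤ 3 * d)) hy hyz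
  have hnear : ∀ v, dist v z ≤ 3 * d → dist v w ≤ 6 * d := fun v hv => by
    have := dist_triangle v z w
    linarith
  have hh : 2 * τ * (3 * d) ≤ (η * d / 4) ^ 2 := by
    nlinarith [mul_le_mul_of_nonneg_right hτ hd.le, mul_pos hη hd]
  have hBc : IsConnected (Metric.closedBall z s) :=
    ((convex_closedBall z s).isPathConnected
      (Metric.nonempty_closedBall.2 hs.le)).isConnected
  -- The gap between the two truncated continua is bridged by the disk about `z`, which lies in the
  -- hole and hence also misses `T`.
  have hWc : IsConnected (Z ∪ Metric.closedBall z s ∪ Z') := by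
    refine IsConnected.union ⟨b', Or.inr hbz', hbZ'⟩ ?_ hZc'
    exact IsConnected.union ⟨b, hbZ, hbz⟩ hZc hBc
  have hW : IsCompact (Z ∪ Metric.closedBall z s ∪ Z') :=
    (hZ.union (isCompact_closedBall z s)).union hZ'
  -- Applying non-flatness to `e` and to `-e` gives points of `T` on both sides of the strip of
  -- half-width `η * d / 4`.
  obtain ⟨p, hp, hpi⟩ := hT.exists_le_im e hnorm
  obtain ⟨q, hq, hqi⟩ := hT.exists_le_im (-e) (by rw [norm_neg, hnorm])
  have hshift : |((w - z) * conj e).im| ≤ ε * d := by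
    refine (Complex.abs_im_le_norm _).trans ?_
    rw [norm_mul, RCLike.norm_conj, hnorm, mul_one, ← dist_eq_norm, dist_comm]
    exact hz.le
  rw [abs_le] at hshift
  obtain ⟨_, ⟨v, hv, rfl⟩, t, ht, htv⟩ := inter_nonempty_of_crossing (T := m '' T)
    (hW.image hmc) (hWc.image m hmc.continuousOn) (hT.isPathConnected.image hmc)
    (h := η * d / 4) (l := 5 / 2 * d) (by
      rintro _ ⟨v, (hv | hv) | hv, rfl⟩
      · refine abs_im_le_of_norm_sub_re_le (τ := τ) (r := 3 * d) ?_ ?_ (by positivity) hh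
        · rw [hmn]; exact hre v (hZL hv) (hnear v (hZb hv))
        · rw [hmn]; exact hZb hv
      · refine (Complex.abs_im_le_norm _).trans ?_
        rw [hmn]
        refine (Metric.mem_closedBall.1 hv).trans ?_
        linarith
      · have := abs_im_le_of_norm_sub_re_le (v := -m v) (τ := τ) (r := 3 * d) (h := η * d / 4) ?_ ?_
          (by positivity) hh
        · simpa using this
        · rw [norm_neg, hmn, Complex.neg_re, sub_neg_eq_add]
          exact hre' v (hZL' hv) (hnear v (hZb' hv))
        · rw [norm_neg, hmn]; exact hZb' hv)
    (by
      rintro _ ⟨v, hv, rfl⟩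
      refine (Complex.abs_re_le_norm _).trans_lt ?_
      rw [hmn]
      have h1 := Metric.mem_closedBall.1 (hTw hv)
      have h2 := dist_triangle_right v z w
      linarith)
    (a := m u') (b := m u) (mem_image_of_mem m (Or.inr hu'))
    (by have := hre' u' (hZL' hu') (hnear u' huz'.le); linarith)
    (mem_image_of_mem m (Or.inl (Or.inl hu)))
    (by have := hre u (hZL hu) (hnear u huz.le); linarith)
    (p := m p) (q := m q) (mem_image_of_mem m hp)
    (by
      have : m p = (p - w) * conj e + (w - z) * conj e := by simp only [m]; ring
      rw [this, Complex.add_im]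
      have := mul_pos hη hd
      linarith)
    (mem_image_of_mem m hq)
    (by
      have : m q = -((q - w) * conj (-e)) + (w - z) * conj e := by
        simp only [m, map_neg]; ring
      rw [this, Complex.add_im, Complex.neg_im]
      have := mul_pos hη hd
      linarith)
  have hconj : conj e ≠ 0 := by
    intro h
    rw [map_eq_zero] at h
    simp [h] at hnorm
  have htv : t = v := by
    have := mul_right_cancel₀ hconj htv
    exact sub_left_injective this
  subst htv
  rcases hv with (hv | hv) | hv
  · exact Set.disjoint_left.1 hLT (hZL hv) ht
  · refine Set.disjoint_left.1 hT.disjoint_ball ht ?_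
    rw [Metric.mem_ball]
    have h1 := dist_triangle t z w
    have h2 := Metric.mem_closedBall.1 hv
    linarith
  · exact Set.disjoint_left.1 hLT' (hZL' hv) ht

/-! ### Detours around an obstacle and discounting of the weights in its hole -/

section

variable {ι : Type*} [Fintype ι] {P : ι → Set ℂ} {ρ : ι → ℝ} {K T : Set ℂ} {E : ℂ → ℝ}
  {w : ℂ} {d η ε σ : ℝ}

/-- A saturated continuum that passes an obstacle without meeting it makes a detour. -/
theorem DominatesDist.add_le_cost_of_obstacle (hD : DominatesDist P ρ E)
    (hP : IsContinuumFamily P)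
    (hρ : ∀ i, 0 ≤ ρ i) (hE : ∀ z, 0 ≤ E z) (hM : ∀ z, E z ≤ 10 * d)
    (hT : IsObstacle T w d η ε) (hd : 0 < d) (hη : 0 < η) (hη1 : η ≤ 1) (hε : 0 < ε)
    (hε1 : ε ≤ η / 8) (hσ : σ = ε ^ 2 / 100) (hTw : T ⊆ Metric.closedBall w (2 * d))
    (he : ∀ u ∈ Metric.closedBall w (8 * d), E u ≤ σ * d / 100)
    (hund : ∀ i, (P i ∩ Metric.closedBall w (8 * d)).Nonempty → σ * d / 2 ≤ Metric.diam (P i) →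
      (4 + 60 / σ) * Metric.diam (P i) ≤ ρ i)
    (hK : IsSaturatedContinuum P K) (hKt : μH[1] (freePart P K) ≠ ⊤) (hKT : Disjoint K T)
    {z x y : ℂ} (hz : z ∈ K) (hzw : dist z w < ε * d) (hx : x ∈ K) (hy : y ∈ K)
    (hxw : 4 * d ≤ dist x w) (hyw : 4 * d ≤ dist y w) :
    dist x y - E x - E y + σ * d / 4 ≤ cost P ρ K := by
  by_contra! hlt
  have hε8 : ε ≤ 1 / 8 := by linarith
  have hσ0 : 0 < σ := by rw [hσ]; positivity
  have hσε : σ ≤ ε / 800 := by rw [hσ]; nlinarith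
  have hs0 : 0 < σ * d := mul_pos hσ0 hd
  have hεd : ε * d ≤ d / 8 := by nlinarith
  have hsε : σ * d ≤ ε * d / 800 := by nlinarith
  -- This fixes the constant in `4 + 60 / σ`: a member of diameter `σ * d / 2` must still outweigh
  -- `s + 2 * M`, where `s = σ * d` and `M = 10 * d`.
  have hAs : 60 / σ * (σ * d / 2) = 30 * d := by field_simp; norm_num
  have h60 : 0 ≤ 60 / σ := by positivity
  have hxz : σ * d ≤ dist x z := by
    have := dist_triangle x z w
    linarith
  have hyz : σ * d ≤ dist y z := by
    have := dist_triangle y z w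
    linarith
  have he8 : ∀ u, dist u w ≤ 8 * d → E u ≤ σ * d / 100 := he
  rcases hD.gain_or_separates hP hρ hE hM hK hKt (z := z) (s := σ * d) (e := σ * d / 100)
    (A := 4 + 60 / σ) hs0 (fun u hu => he8 u (by
      have h1 := dist_triangle u z w
      have h2 := Metric.mem_closedBall.1 hu
      linarith)) (by linarith) (by linarith)
    (fun i hi hdi => hund i (hi.mono (inter_subset_inter_right _ fun u hu => by
      have h1 := dist_triangle u z w
      have h2 := Metric.mem_closedBall.1 hu
      rw [Metric.mem_closedBall]
      linarith)) hdi) hz hx hy hxz hyz with h | ⟨L, L', hL, hL', hLK, hLK', hdis, hxL, hyL',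
      ⟨b, hb, hbz⟩, b', hb', hbz'⟩
  · linarith
  -- Stated for arbitrary pieces and endpoints, so that it also applies with the two sides
  -- exchanged.
  have straight : ∀ L L' : Set ℂ, IsSaturatedContinuum P L → IsSaturatedContinuum P L' →
      L ⊆ K → L' ⊆ K → Disjoint L L' → ∀ x ∈ L, ∀ y ∈ L', ∀ b ∈ L, ∀ b' ∈ L',
      dist b z ≤ σ * d → dist b' z ≤ σ * d →
      cost P ρ K < dist x y - E x - E y + σ * d / 4 →
      ∀ u ∈ L, dist u w ≤ 6 * d →
        dist x u + dist u z + dist z y ≤ dist x y + 20 * (σ * d) := by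
    intro L L' hL hL' hLK hLK' hdis x hxL y hyL' b hb b' hb' hbz hbz' hlt u hu huw
    have hLt := hausdorffMeasure_freePart_ne_top hKt hLK
    have hLt' := hausdorffMeasure_freePart_ne_top hKt hLK'
    have h1 := cost_add_cost_le hP hρ hKt hLK hLK' hdis hL'.isCompact
    have h2 := hD L' hL' hLt' b' hb' y hyL'
    have h3 := hD L hL hLt x hxL b hb
    have hEb : E b ≤ σ * d / 100 := he8 b (by have := dist_triangle b z w; linarith)
    have hEb' : E b' ≤ σ * d / 100 := he8 b' (by have := dist_triangle b' z w; linarith)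
    have hEu : E u ≤ σ * d / 100 := he8 u (by linarith)
    have h4 := dist_triangle x b z
    have h5 := dist_triangle_left z y b'
    have h6 := dist_triangle_right u z b
    have h7 := dist_triangle x u b
    have h8 := dist_triangle_right x u b
    have h9 := dist_triangle x z y
    have h10 := dist_triangle_left u z x
    have h11 := dist_triangle x b u
    have h12 := dist_triangle u b z
    have hbu := dist_comm b u
    have hux := dist_comm u x
    by_cases hxu : dist x u < 8 * (σ * d)
    · linarith
    by_cases hbu' : dist b u < 8 * (σ * d)
    · linarith
    rw [not_lt] at hxu hbu'
    -- The radius `8 * (σ * d)` makes a gain in `L` exceed the admitted excess and the jumps near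
    -- `z`. So `u` separates `x` from `b` in `L`, and the cost of `L` is nearly `dist x u + dist u
    -- b`.
    rcases hD.gain_or_separates hP hρ hE hM hL hLt (z := u) (s := 8 * (σ * d)) (e := σ * d / 100)
      (A := 4 + 60 / σ) (by linarith) (fun v hv => he8 v (by
        have h1 := dist_triangle v u w
        have h2 := Metric.mem_closedBall.1 hv
        linarith)) (by linarith) (by linarith)
      (fun i hi hdi => hund i (hi.mono (inter_subset_inter_right _ fun v hv => by
        have h1 := dist_triangle v u w
        have h2 := Metric.mem_closedBall.1 hv
        rw [Metric.mem_closedBall]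
        linarith)) (by linarith)) hu hxL hb hxu hbu' with h | ⟨N, N', hN, hN', hNL, hNL', hNd, hxN,
        hbN', ⟨c, hc, hcu⟩, c', hc', hcu'⟩
    · have := dist_triangle4 x b b' y
      have := dist_triangle_right b b' z
      linarith
    · have hEc : E c ≤ σ * d / 100 := he8 c (by have := dist_triangle c u w; linarith)
      have hEc' : E c' ≤ σ * d / 100 := he8 c' (by have := dist_triangle c' u w; linarith)
      have g1 := cost_add_cost_le hP hρ hLt hNL hNL' hNd hN'.isCompact
      have g2 := hD N hN (hausdorffMeasure_freePart_ne_top hLt hNL) x hxN c hc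
      have g3 := hD N' hN' (hausdorffMeasure_freePart_ne_top hLt hNL') c' hc' b hbN'
      have g4 := dist_triangle x c u
      have g5 := dist_triangle_left u b c'
      linarith
  have hdisT : ∀ N ⊆ K, Disjoint N T := fun N hN => hKT.mono_left hN
  refine hT.false_of_nearly_straight hd hη hη1 hε1 hTw hL.isCompact hL.isConnected hL'.isCompact
    hL'.isConnected (hdisT L hLK) (hdisT L' hLK') (s := σ * d) (τ := 20 * (σ * d)) hs0
    (by linarith) ?_ hzw hxL hyL' hxw hyw hb hbz hb' hbz'
    (straight L L' hL hL' hLK hLK' hdis x hxL y hyL' b hb b' hb' hbz hbz' hlt) ?_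
  · have h1 : 20 * σ ≤ η ^ 2 / 100 := by rw [hσ]; nlinarith
    nlinarith
  · intro u hu huw
    have h1 := straight L' L hL' hL hLK' hLK hdis.symm y hyL' x hxL b' hb' b hb hbz' hbz
      (by rw [dist_comm y x]; linarith) u hu huw
    rw [dist_comm y u, dist_comm u z, dist_comm z x, dist_comm y x] at h1
    linarith

open Classical in
/-- The weights of the members inside the hole of an obstacle may be diminished. -/
theorem DominatesDist.discount (hD : DominatesDist P ρ E) (hP : IsContinuumFamily P)
    (hρ : ∀ i, 0 ≤ ρ i) (hE : ∀ z, 0 ≤ E z) (hM : ∀ z, E z ≤ 10 * d)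
    (hT : IsObstacle T w d η ε) (hη : 0 < η) (hη1 : η ≤ 1) (hε : 0 < ε)
    (hε1 : ε ≤ η / 8) (hσ : σ = ε ^ 2 / 100) {p : ι} (hTp : T ⊆ P p)
    (hpw : P p ⊆ Metric.closedBall w (2 * d)) (hd : 0 < d) (hpd : Metric.diam (P p) = d)
    (he : ∀ u ∈ Metric.closedBall w (8 * d), E u ≤ σ * d / 100)
    (hund : ∀ i, (P i ∩ Metric.closedBall w (8 * d)).Nonempty → σ * d / 2 ≤ Metric.diam (P i) →
      (4 + 60 / σ) * Metric.diam (P i) ≤ ρ i) :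
    DominatesDist P (fun i => if P i ⊆ Metric.ball w (ε * d) then (1 - σ / 80) * ρ i else ρ i)
      (fun z => if z ∈ Metric.ball w (4 * d) then 10 * d else E z) := by
  intro K hK hKt x hx y hy
  set ρ' : ι → ℝ := fun i => if P i ⊆ Metric.ball w (ε * d) then (1 - σ / 80) * ρ i else ρ i
    with hρ'
  have hε8 : ε ≤ 1 / 8 := by linarith
  have hσ0 : 0 < σ := by rw [hσ]; positivity
  have hσε : σ ≤ ε / 800 := by rw [hσ]; nlinarith
  have hs0 : 0 < σ * d := mul_pos hσ0 hd
  have hεd : ε * d ≤ d / 8 := by nlinarith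
  have hsd : σ * d ≤ d / 6400 := by nlinarith
  have hlam : 0 ≤ 1 - σ / 80 := by linarith
  have hρ'0 : ∀ i, 0 ≤ ρ' i := fun i => by
    simp only [hρ']
    split_ifs
    exacts [mul_nonneg hlam (hρ i), hρ i]
  have hsub : Metric.ball w (ε * d) ⊆ Metric.ball w (4 * d) :=
    Metric.ball_subset_ball (by linarith)
  have hO : IsOpen (Metric.ball w (4 * d)) := Metric.isOpen_ball
  have hle : ∀ z, E z ≤ if z ∈ Metric.ball w (4 * d) then 10 * d else E z := fun z => by
    split_ifs
    exacts [hM z, le_rfl]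
  have hout : ∀ L, IsSaturatedContinuum P L → L ⊆ K \ core P (Metric.ball w (4 * d)) →
      ∀ x ∈ L, ∀ y ∈ L, dist x y - E x - E y ≤ cost P ρ' L := by
    intro L hL hLK x hx y hy
    refine (hD L hL (hausdorffMeasure_freePart_ne_top hKt (hLK.trans sdiff_subset)) x hx y
      hy).trans_eq ?_
    unfold cost
    congr 1
    refine Finset.sum_congr rfl fun i hi => ?_
    rw [Finset.mem_filter] at hi
    simp only [hρ']
    rw [if_neg]
    intro h
    obtain ⟨v, hv⟩ := (hP.isConnected i).nonempty
    exact (hLK (hi.2 hv)).2 (subset_core hP (h.trans hsub) hv)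
  have he4 : ∀ u ∈ Metric.closedBall w (4 * d), E u ≤ σ * d / 100 := fun u hu =>
    he u (Metric.closedBall_subset_closedBall (by linarith) hu)
  change dist x y - (if x ∈ Metric.ball w (4 * d) then 10 * d else E x) -
    (if y ∈ Metric.ball w (4 * d) then 10 * d else E y) ≤ cost P ρ' K
  -- If `K` contains no discounted member, its cost is unchanged and the larger error only helps.
  by_cases hdisc : ∃ i, P i ⊆ K ∧ P i ⊆ Metric.ball w (ε * d)
  swap
  · have h1 : cost P ρ' K = cost P ρ K := by
      unfold cost
      congr 1
      refine Finset.sum_congr rfl fun i hi => ?_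
      rw [Finset.mem_filter] at hi
      simp only [hρ']
      rw [if_neg]
      exact fun h => hdisc ⟨i, hi.2, h⟩
    rw [h1]
    have h2 := hD K hK hKt x hx y hy
    have h3 := hle x
    have h4 := hle y
    linarith
  obtain ⟨i, hiK, hi⟩ := hdisc
  obtain ⟨z, hz⟩ := (hP.isConnected i).nonempty
  have hne : (K ∩ core P (Metric.ball w (4 * d))).Nonempty :=
    ⟨z, hiK hz, subset_core hP (hi.trans hsub) hz⟩
  have hF := dist_sub_add_sum_le_cost hP hρ'0 hE hK hKt he4 hout (by linarith) hne
  -- For an endpoint near the obstacle the new error `10 * d` absorbs the loss of jumping over the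
  -- disk, `8 * d` plus small errors.
  by_cases hxB : x ∈ Metric.ball w (4 * d)
  · rw [if_pos hxB]
    have h1 := hF ∅ (by simp) hx hy
    rw [Finset.sum_empty] at h1
    have h2 := hle y
    have h3 := he4 x (Metric.ball_subset_closedBall hxB)
    linarith
  by_cases hyB : y ∈ Metric.ball w (4 * d)
  · rw [if_pos hyB]
    have h1 := hF ∅ (by simp) hx hy
    rw [Finset.sum_empty] at h1
    have h2 := hle x
    have h3 := he4 y (Metric.ball_subset_closedBall hyB)
    linarith
  rw [if_neg hxB, if_neg hyB]
  have hTne : T.Nonempty := hT.isPathConnected.nonempty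
  -- The obstacle itself is not discounted, since `T` avoids its hole; its weight, at least `14 *
  -- d`, pays for jumping over the disk.
  by_cases hpK : P p ⊆ K
  · have hp4 : P p ⊆ Metric.ball w (4 * d) :=
      hpw.trans (Metric.closedBall_subset_ball (by linarith))
    have hpε : ¬ P p ⊆ Metric.ball w (ε * d) := fun h => by
      obtain ⟨t, ht⟩ := hTne
      refine Set.disjoint_left.1 hT.disjoint_ball ht (Metric.ball_subset_ball ?_ (h (hTp ht)))
      nlinarith
    have h1 := hF {p} (by simp [hpK, hp4]) hx hy
    rw [Finset.sum_singleton] at h1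
    have h2 : ρ' p = ρ p := if_neg hpε
    obtain ⟨t, ht⟩ := hTne
    have h3 := hund p ⟨t, hTp ht, Metric.closedBall_subset_closedBall (by linarith) (hpw (hTp ht))⟩
      (by rw [hpd]; linarith)
    rw [hpd] at h3
    have h4 : 10 ≤ 60 / σ := by
      rw [le_div_iff₀ hσ0]
      linarith
    nlinarith
  have hpKd : Disjoint (P p) K := (hK.saturated p).resolve_left hpK
  set S : Finset ι := Finset.univ.filter fun i => P i ⊆ K ∧ P i ⊆ Metric.ball w (ε * d)
  -- Below the threshold the discount removes at most `σ / 80 * (20 * d) = σ * d / 4`, exactly the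
  -- detour gained. Above it the discounted weights still sum to at least `10 * d`, enough to jump
  -- over the disk.
  by_cases hS : ∑ i ∈ S, ρ i ≤ 20 * d
  · have h1 := hD.add_le_cost_of_obstacle hP hρ hE hM hT hd hη hη1 hε hε1 hσ
      (hTp.trans hpw) he hund hK hKt (hpKd.symm.mono_right hTp) (hiK hz) (hi hz) hx hy
      (not_lt.1 hxB) (not_lt.1 hyB)
    have h3 : S = (Finset.univ.filter fun i => P i ⊆ K).filter
        fun i => P i ⊆ Metric.ball w (ε * d) := by
      rw [Finset.filter_filter]
    have h5 : σ / 80 * ∑ i ∈ S, ρ i = ∑ i ∈ (Finset.univ.filter fun i => P i ⊆ K),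
        if P i ⊆ Metric.ball w (ε * d) then σ / 80 * ρ i else 0 := by
      rw [h3, Finset.mul_sum, Finset.sum_filter]
    have h2 : cost P ρ K - σ / 80 * ∑ i ∈ S, ρ i ≤ cost P ρ' K := by
      unfold cost
      rw [h5, add_sub_assoc, ← Finset.sum_sub_distrib]
      gcongr with i hi
      simp only [hρ']
      split_ifs <;> linarith
    have h4 : σ / 80 * ∑ i ∈ S, ρ i ≤ σ / 80 * (20 * d) := by gcongr
    linarith
  · rw [not_le] at hS
    have h1 := hF S (fun i hi => by
      simp only [S, Finset.mem_filter, Finset.mem_univ, true_and] at hi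
      exact ⟨hi.1, hi.2.trans hsub⟩) hx hy
    have h2 : ∑ i ∈ S, ρ' i = (1 - σ / 80) * ∑ i ∈ S, ρ i := by
      rw [Finset.mul_sum]
      refine Finset.sum_congr rfl fun i hi => ?_
      simp only [S, Finset.mem_filter, Finset.mem_univ, true_and] at hi
      exact if_pos hi.2
    have h3 : (1 / 2 : ℝ) * (20 * d) ≤ (1 - σ / 80) * ∑ i ∈ S, ρ i := by
      apply mul_le_mul _ hS.le (by positivity) hlam
      linarith
    rw [h2] at h1
    linarith

end

/-! ### Induction over a separated family of obstacles -/

section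

variable {ι : Type*}

/-- A choice of obstacles in the members of `A`, with the property that the obstacles are far
apart whenever they have comparable sizes. -/
structure IsSeparatedFamily (P : ι → Set ℂ) (T : ι → Set ℂ) (w : ι → ℂ) (η ε Q : ℝ)
    (A : Finset ι) : Prop where
  isObstacle : ∀ j ∈ A, IsObstacle (T j) (w j) (Metric.diam (P j)) η ε
  subset : ∀ j ∈ A, T j ⊆ P j
  subset_closedBall : ∀ j ∈ A, P j ⊆ Metric.closedBall (w j) (2 * Metric.diam (P j))
  diam_pos : ∀ j ∈ A, 0 < Metric.diam (P j)
  separated : ∀ j ∈ A, ∀ k ∈ A, j ≠ k → Metric.diam (P j) ≤ Metric.diam (P k) →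
    Q * Metric.diam (P j) ≤ Metric.diam (P k) ∨
      Disjoint (Metric.ball (w j) (9 * Metric.diam (P j)))
        (Metric.ball (w k) (9 * Metric.diam (P k)))

open Classical in
/-- The number of obstacles in `s` whose hole contains the `i`-th member of the family. -/
def depth (P : ι → Set ℂ) (w : ι → ℂ) (ε : ℝ) (s : Finset ι) (i : ι) : ℕ :=
  (s.filter fun j => P i ⊆ Metric.ball (w j) (ε * Metric.diam (P j))).card

/-- The diameter, discounted according to the depth. -/
def discountedWeight (P : ι → Set ℂ) (w : ι → ℂ) (ε σ : ℝ) (s : Finset ι) (i : ι) : ℝ :=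
  (4 + 60 / σ) * Metric.diam (P i) * (1 - σ / 80) ^ depth P w ε s i

variable {P : ι → Set ℂ} {T : ι → Set ℂ} {w : ι → ℂ} {η ε σ Q : ℝ} {A : Finset ι}

theorem discountedWeight_nonneg (hσ0 : 0 < σ) (hσ1 : σ ≤ 80) (s : Finset ι) (i : ι) :
    0 ≤ discountedWeight P w ε σ s i := by
  have : 0 ≤ 1 - σ / 80 := by linarith
  unfold discountedWeight
  have := Metric.diam_nonneg (s := P i)
  positivity

variable [Fintype ι]

theorem IsSeparatedFamily.exists_dominatesDist (hA : IsSeparatedFamily P T w η ε Q A)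
    (hP : IsContinuumFamily P) (hη : 0 < η) (hη1 : η ≤ 1) (hε : 0 < ε)
    (hε1 : ε ≤ η / 8) (hσ : σ = ε ^ 2 / 100) (hQ : 1000 / σ ≤ Q) :
    ∃ E : ℂ → ℝ, (∀ z m, 0 ≤ m →
        (∀ j ∈ A, z ∈ Metric.ball (w j) (4 * Metric.diam (P j)) → 10 * Metric.diam (P j) ≤ m) →
        E z ≤ m) ∧ DominatesDist P (discountedWeight P w ε σ A) E := by
  classical
  have hε8 : ε ≤ 1 / 8 := by linarith
  have hσ0 : 0 < σ := by rw [hσ]; positivity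
  have hσε : σ ≤ ε / 800 := by rw [hσ]; nlinarith
  have hQσ : 1000 ≤ Q * σ := by rwa [div_le_iff₀ hσ0] at hQ
  have hQ0 : 0 < Q := (by positivity : 0 < 1000 / σ).trans_le hQ
  have main : ∀ s : Finset ι, s ⊆ A → ∃ E : ℂ → ℝ, (∀ z, 0 ≤ E z) ∧ (∀ z m, 0 ≤ m →
        (∀ j ∈ s, z ∈ Metric.ball (w j) (4 * Metric.diam (P j)) → 10 * Metric.diam (P j) ≤ m) →
        E z ≤ m) ∧ DominatesDist P (discountedWeight P w ε σ s) E := by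
    intro s
    -- The largest obstacle is added last: at that time the errors near it come only from obstacles
    -- that are smaller by the factor `Q`, hence are negligible at its scale.
    induction s using Finset.induction_on_max_value (fun j => Metric.diam (P j)) with
    | empty =>
      intro _
      refine ⟨0, fun _ => le_rfl, fun _ _ h _ => h, dominatesDist_of_diam_le hP fun i => ?_⟩
      have h1 := Metric.diam_nonneg (s := P i)
      have h2 : 0 ≤ 60 / σ := by positivity
      simp only [discountedWeight, depth, Finset.filter_empty, Finset.card_empty, pow_zero, mul_one]
      nlinarith
    | insert a s has hmax ih =>
      intro hsA
      obtain ⟨E, hE0, hE, hD⟩ := ih ((Finset.subset_insert a s).trans hsA)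
      have haA : a ∈ A := hsA (Finset.mem_insert_self a s)
      have hd := hA.diam_pos a haA
      have hscale : ∀ j ∈ s, ∀ u ∈ Metric.closedBall (w a) (8 * Metric.diam (P a)),
          u ∈ Metric.ball (w j) (4 * Metric.diam (P j)) →
          Q * Metric.diam (P j) ≤ Metric.diam (P a) := by
        intro j hj u hua huj
        have hjA := hsA (Finset.mem_insert_of_mem hj)
        refine (hA.separated j hjA a haA (fun h => has (h ▸ hj)) (hmax j hj)).resolve_right
          fun h => Set.disjoint_left.1 h (Metric.ball_subset_ball ?_ huj)
            (Metric.closedBall_subset_ball ?_ hua)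
        · linarith [hA.diam_pos j hjA]
        · linarith
      have hsmall : ∀ j ∈ s, Q * Metric.diam (P j) ≤ Metric.diam (P a) →
          Metric.diam (P j) ≤ σ * Metric.diam (P a) / 1000 := by
        intro j hj h
        have h1 := hA.diam_pos j (hsA (Finset.mem_insert_of_mem hj))
        nlinarith
      have hstep := hD.discount hP (discountedWeight_nonneg hσ0 (by linarith) s) hE0
        (d := Metric.diam (P a))
        (fun z => hE z _ (by positivity) fun j hj _ => by have := hmax j hj; linarith)
        (hA.isObstacle a haA) hη hη1 hε hε1 hσ (hA.subset a haA) (hA.subset_closedBall a haA) hd rfl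
        (fun u hu => hE u _ (by positivity) fun j hj huj => by
          have := hsmall j hj (hscale j hj u hu huj)
          linarith)
        (by
          rintro i ⟨u, hui, hu⟩ hdi
          -- Near the new obstacle a member of diameter at least `σ * d / 2` (with `d` the diameter
          -- of `P a`) is too large for any earlier hole, since the earlier obstacles there are
          -- tiny; so it carries its full weight.
          have h0 : depth P w ε s i = 0 := by
            rw [depth, Finset.card_eq_zero, Finset.filter_eq_empty_iff]
            intro j hj hij
            have hjd := hA.diam_pos j (hsA (Finset.mem_insert_of_mem hj))
            have h1 := hsmall j hj (hscale j hj u hu (Metric.ball_subset_ball (by nlinarith)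
              (hij hui)))
            have h2 : Metric.diam (P i) ≤ 2 * (ε * Metric.diam (P j)) :=
              (Metric.diam_mono hij Metric.isBounded_ball).trans
                (Metric.diam_ball (by positivity))
            have h3 : 0 < σ * Metric.diam (P a) := by positivity
            nlinarith
          rw [discountedWeight, h0, pow_zero, mul_one])
      refine ⟨fun z => if z ∈ Metric.ball (w a) (4 * Metric.diam (P a)) then
        10 * Metric.diam (P a) else E z, fun z => ?_, fun z m hm h => ?_, ?_⟩
      rotate_left 2
      · convert hstep using 1
        funext i
        simp only [discountedWeight, depth, Finset.filter_insert]
        split_ifs with hi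
        · rw [Finset.card_insert_of_notMem fun h => has (Finset.mem_filter.1 h).1, pow_succ]
          ring
        · rfl
      · dsimp only
        split_ifs
        · positivity
        · exact hE0 z
      · dsimp only
        split_ifs with hz
        · exact h a (Finset.mem_insert_self a s) hz
        · exact hE z m hm fun j hj hzj => h j (Finset.mem_insert_of_mem hj) hzj
  obtain ⟨E, -, hE⟩ := main A subset_rfl
  exact ⟨E, hE⟩

end

/-! ### The energy of the discounted weights -/

section

variable {ι : Type*}

theorem sum_pow_le_of_injOn (B : Finset ι) (m : ι → ℕ) (hm : Set.InjOn m B) {θ : ℝ} (h0 : 0 ≤ θ)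
    (h1 : θ < 1) : ∑ q ∈ B, θ ^ m q ≤ (1 - θ)⁻¹ := by
  rw [← Finset.sum_image (f := fun k => θ ^ k) hm, ← tsum_geometric_of_lt_one h0 h1]
  exact (summable_geometric_of_lt_one h0 h1).sum_le_tsum _ fun i _ => pow_nonneg h0 i

variable [DecidableEq ι]

/-- Greedy choice of a maximal family of obstacles that are far apart at comparable scales. -/
theorem exists_separated_subset (d : ι → ℝ) (w : ι → ℂ) {Q : ℝ} (hQ : 1 ≤ Q) (S : Finset ι)
    (hd : ∀ i ∈ S, 0 < d i) :
    ∃ A ⊆ S, (∀ j ∈ A, ∀ k ∈ A, j ≠ k → d j ≤ d k → Q * d j ≤ d k ∨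
        Disjoint (Metric.ball (w j) (9 * d j)) (Metric.ball (w k) (9 * d k))) ∧
      ∀ i ∈ S, ∃ q ∈ A, d i ≤ d q ∧ d q ≤ Q * d i ∧ dist (w i) (w q) ≤ 18 * d q := by
  -- Candidates are treated from large to small. One is discarded only if a selected one of
  -- comparable size is close, and that one serves as its `q`.
  induction S using Finset.induction_on_min_value d with
  | empty => exact ⟨∅, subset_rfl, by simp, by simp⟩
  | insert a s has hmin ih =>
    obtain ⟨A, hAs, hA, hq⟩ := ih fun i hi => hd i (Finset.mem_insert_of_mem hi)
    have hda := hd a (Finset.mem_insert_self a s)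
    by_cases hex : ∃ q ∈ A, ¬ (Q * d a ≤ d q ∨
        Disjoint (Metric.ball (w a) (9 * d a)) (Metric.ball (w q) (9 * d q)))
    · refine ⟨A, hAs.trans (Finset.subset_insert a s), hA, fun i hi => ?_⟩
      rcases Finset.mem_insert.1 hi with rfl | hi
      · obtain ⟨q, hqA, h⟩ := hex
        rw [not_or, not_le] at h
        obtain ⟨u, hu, hu'⟩ := Set.not_disjoint_iff.1 h.2
        have h1 := hmin q (hAs hqA)
        have h2 := dist_triangle_left (w i) (w q) u
        rw [Metric.mem_ball] at hu hu'
        exact ⟨q, hqA, h1, h.1.le, by linarith⟩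
      · exact hq i hi
    · push Not at hex
      refine ⟨insert a A, Finset.insert_subset_insert a hAs, fun j hj k hk hjk hd' => ?_,
        fun i hi => ?_⟩
      · rcases Finset.mem_insert.1 hj with hja | hjA <;>
          rcases Finset.mem_insert.1 hk with hka | hkA
        · exact absurd (hja.trans hka.symm) hjk
        · subst hja
          exact hex k hkA
        · subst hka
          have h1 : d k = d j := le_antisymm (hmin j (hAs hjA)) hd'
          rcases hex j hjA with h | h
          · left; rw [h1] at h ⊢; exact h
          · exact Or.inr h.symm
        · exact hA j hjA k hkA hjk hd'
      · rcases Finset.mem_insert.1 hi with rfl | hi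
        · refine ⟨i, Finset.mem_insert_self i A, le_rfl, ?_, ?_⟩
          · nlinarith
          · rw [dist_self]; positivity
        · obtain ⟨q, hqA, h⟩ := hq i hi
          exact ⟨q, Finset.mem_insert_of_mem hqA, h⟩

end

section

variable {ι : Type*} {P T : ι → Set ℂ} {w : ι → ℂ} {η ε Q : ℝ} {A S : Finset ι}

theorem IsSeparatedFamily.mul_diam_le (hA : IsSeparatedFamily P T w η ε Q A) (hε1 : ε ≤ 1)
    {j k : ι} (hj : j ∈ A) (hk : k ∈ A) (hjk : j ≠ k)
    (hd : Metric.diam (P j) ≤ Metric.diam (P k)) {x : ℂ}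
    (hxj : x ∈ Metric.ball (w j) (ε / 2 * Metric.diam (P j)))
    (hxk : x ∈ Metric.ball (w k) (ε / 2 * Metric.diam (P k))) :
    Q * Metric.diam (P j) ≤ Metric.diam (P k) := by
  refine (hA.separated j hj k hk hjk hd).resolve_right fun h =>
    Set.disjoint_left.1 h (Metric.ball_subset_ball ?_ hxj) (Metric.ball_subset_ball ?_ hxk)
  · nlinarith [hA.diam_pos j hj]
  · nlinarith [hA.diam_pos k hk]

open Classical in
/-- The number of obstacles around `x` that are larger than the obstacle `q`. -/
def rank (P : ι → Set ℂ) (w : ι → ℂ) (ε : ℝ) (A : Finset ι) (x : ℂ) (q : ι) : ℕ :=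
  (A.filter fun j => x ∈ Metric.ball (w j) (ε / 2 * Metric.diam (P j)) ∧
    Metric.diam (P q) < Metric.diam (P j)).card

/-- A larger obstacle `j` around `x` is larger than `q` by the factor `Q`. Since `x` lies in the
half-radius disk of `j`, the margin `ε / 2 * diam (P j)` is at least `21 * diam (P q)`, which covers
all of `P i`; so `P i` lies in the hole of `j`. -/
theorem IsSeparatedFamily.rank_le_depth (hA : IsSeparatedFamily P T w η ε Q A) (hε : 0 < ε)
    (hε1 : ε ≤ 1) (hQ : 42 / ε ≤ Q) {x : ℂ} {q i : ι} (hq : q ∈ A)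
    (hx : x ∈ Metric.ball (w q) (ε / 2 * Metric.diam (P q)))
    (hi : P i ⊆ Metric.closedBall (w i) (2 * Metric.diam (P i)))
    (hiq : Metric.diam (P i) ≤ Metric.diam (P q))
    (hd : dist (w i) (w q) ≤ 18 * Metric.diam (P q)) :
    rank P w ε A x q ≤ depth P w ε A i := by
  classical
  unfold rank depth
  refine Finset.card_le_card fun j hj => ?_
  rw [Finset.mem_filter] at hj ⊢
  obtain ⟨hjA, hxj, hqj⟩ := hj
  refine ⟨hjA, fun u hu => ?_⟩
  have h1 := hA.mul_diam_le hε1 hq hjA (by rintro rfl; exact lt_irrefl _ hqj) hqj.le hx hxj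
  have h2 := Metric.mem_closedBall.1 (hi hu)
  have h3 := dist_triangle u (w i) (w q)
  have h4 := dist_triangle u (w q) (w j)
  have h5 := dist_triangle_left (w q) (w j) x
  rw [Metric.mem_ball] at hx hxj ⊢
  have h6 := hA.diam_pos q hq
  have h7 : 42 * Metric.diam (P q) ≤ ε * Metric.diam (P j) := by
    rw [div_le_iff₀ hε] at hQ
    nlinarith
  nlinarith

/-- Obstacles around the same point have different sizes, hence different ranks, and the sum is
dominated by the geometric series. -/
theorem IsSeparatedFamily.sum_pow_rank_le (hA : IsSeparatedFamily P T w η ε Q A) 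
    (hε1 : ε ≤ 1) (hQ : 1 < Q) {θ : ℝ} (h0 : 0 ≤ θ) (h1 : θ < 1) (x : ℂ) (B : Finset ι)
    (hB : B ⊆ A) (hBx : ∀ q ∈ B, x ∈ Metric.ball (w q) (ε / 2 * Metric.diam (P q))) :
    ∑ q ∈ B, θ ^ rank P w ε A x q ≤ (1 - θ)⁻¹ := by
  classical
  refine sum_pow_le_of_injOn B _ ?_ h0 h1
  have key : ∀ q ∈ B, ∀ q' ∈ B, q ≠ q' → Metric.diam (P q) ≤ Metric.diam (P q') →
      rank P w ε A x q' < rank P w ε A x q := by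
    intro q hq q' hq' hne hd
    have h2 := hA.mul_diam_le hε1 (hB hq) (hB hq') hne hd (hBx q hq) (hBx q' hq')
    have h3 := hA.diam_pos q (hB hq)
    have h4 : Metric.diam (P q) < Metric.diam (P q') := by nlinarith
    refine Finset.card_lt_card ⟨fun j hj => ?_, fun hsub => ?_⟩
    · rw [Finset.mem_filter] at hj ⊢
      exact ⟨hj.1, hj.2.1, h4.trans hj.2.2⟩
    · have : q' ∈ A.filter fun j => x ∈ Metric.ball (w j) (ε / 2 * Metric.diam (P j)) ∧
          Metric.diam (P q) < Metric.diam (P j) :=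
        Finset.mem_filter.2 ⟨hB hq', hBx q' hq', h4⟩
      exact lt_irrefl _ (Finset.mem_filter.1 (hsub this)).2.2
  intro q hq q' hq' heq
  by_contra hne
  rcases le_total (Metric.diam (P q)) (Metric.diam (P q')) with h | h
  · exact (key q hq q' hq' hne h).ne heq.symm
  · exact (key q' hq' q hq (Ne.symm hne) h).ne heq

open Classical in
theorem IsSeparatedFamily.sum_sq_diam_mul_pow_depth_le (hA : IsSeparatedFamily P T w η ε Q A)
    (hε : 0 < ε) (hε1 : ε ≤ 1) (hQ : 42 / ε ≤ Q) {θ : ℝ} (h0 : 0 ≤ θ) (h1 : θ < 1)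
    (hS : ∀ i ∈ S, P i ⊆ Metric.closedBall (w i) (2 * Metric.diam (P i)))
    {q : ι → ι} (hqA : ∀ i ∈ S, q i ∈ A)
    (hqd : ∀ i ∈ S, Metric.diam (P i) ≤ Metric.diam (P (q i)))
    (hqw : ∀ i ∈ S, dist (w i) (w (q i)) ≤ 18 * Metric.diam (P (q i)))
    {N : ℕ} (hN : ∀ k ∈ A, (S.filter fun i => q i = k).card ≤ N) {c : ℂ} {r : ℝ} (hr : 0 < r)
    (hAr : ∀ k ∈ A, Metric.ball (w k) (ε / 2 * Metric.diam (P k)) ⊆ Metric.ball c r) :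
    ∑ i ∈ S, Metric.diam (P i) ^ 2 * θ ^ depth P w ε A i ≤ 4 / ε ^ 2 * (N * (1 - θ)⁻¹) * r ^ 2 := by
  have hvol : ∀ (z : ℂ) (s : ℝ), 0 ≤ s → volume.real (Metric.ball z s) = Real.pi * s ^ 2 := by
    intro z s hs
    rw [Measure.real, Complex.volume_ball]
    simp [ENNReal.toReal_ofReal hs, mul_comm]
  have hpi := Real.pi_pos
  have h1θ : 0 ≤ (1 - θ)⁻¹ := inv_nonneg.2 (by linarith)
  set D : ι → Set ℂ := fun k => Metric.ball (w k) (ε / 2 * Metric.diam (P k))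
  set g : ι → ℝ := fun k => ∑ i ∈ S.filter fun i => q i = k, θ ^ depth P w ε A i
  have hD : ∀ k, volume.real (D k) = Real.pi * (ε / 2 * Metric.diam (P k)) ^ 2 := fun k =>
    hvol _ _ (mul_nonneg (by positivity) Metric.diam_nonneg)
  -- The integral of the left side is a multiple of the sum to be estimated, because the area of `D
  -- k` is comparable to the squared diameter. The inequality is proved pointwise and then
  -- integrated.
  have hpt : ∀ x, ∑ k ∈ A, (D k).indicator (fun _ => g k) x ≤
      (Metric.ball c r).indicator (fun _ => N * (1 - θ)⁻¹) x := by
    intro x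
    have e1 : ∑ k ∈ A, (D k).indicator (fun _ => g k) x = ∑ k ∈ A.filter fun k => x ∈ D k, g k := by
      rw [Finset.sum_filter]
      rfl
    rw [e1]
    by_cases hx : x ∈ Metric.ball c r
    · rw [indicator_of_mem hx]
      calc ∑ k ∈ A.filter fun k => x ∈ D k, g k
          ≤ ∑ k ∈ A.filter fun k => x ∈ D k, N * θ ^ rank P w ε A x k := by
            refine Finset.sum_le_sum fun k hk => ?_
            rw [Finset.mem_filter] at hk
            have : g k ≤ (S.filter fun i => q i = k).card • θ ^ rank P w ε A x k := by
              refine Finset.sum_le_card_nsmul _ _ _ fun i hi => ?_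
              rw [Finset.mem_filter] at hi
              obtain ⟨hiS, rfl⟩ := hi
              exact pow_le_pow_of_le_one h0 h1.le (hA.rank_le_depth hε hε1 hQ hk.1 hk.2
                (hS i hiS) (hqd i hiS) (hqw i hiS))
            refine this.trans ?_
            rw [nsmul_eq_mul]
            have := hN k hk.1
            gcongr
        _ = N * ∑ k ∈ A.filter fun k => x ∈ D k, θ ^ rank P w ε A x k := by rw [Finset.mul_sum]
        _ ≤ N * (1 - θ)⁻¹ := by
            gcongr
            have hQ1 : 1 < Q := by
              rw [div_le_iff₀ hε] at hQ
              nlinarith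
            exact hA.sum_pow_rank_le hε1 hQ1 h0 h1 x _ (Finset.filter_subset _ _)
              fun k hk => (Finset.mem_filter.1 hk).2
    · rw [indicator_of_notMem hx, Finset.filter_false_of_mem fun k hk h => hx (hAr k hk h),
        Finset.sum_empty]
  have hint : ∀ (z : ℂ) (s b : ℝ),
      Integrable ((Metric.ball z s).indicator fun _ => b) (volume : Measure ℂ) := fun z s b =>
    (integrable_indicator_iff Metric.isOpen_ball.measurableSet).2
      (integrableOn_const measure_ball_lt_top.ne)
  have hmono := integral_mono (μ := (volume : Measure ℂ))
    (integrable_finsetSum A fun k _ => hint (w k) (ε / 2 * Metric.diam (P k)) (g k))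
    (hint c r (N * (1 - θ)⁻¹)) hpt
  rw [integral_finsetSum A fun k _ => hint (w k) (ε / 2 * Metric.diam (P k)) (g k)] at hmono
  simp only [integral_indicator_const _ Metric.isOpen_ball.measurableSet, smul_eq_mul] at hmono
  rw [hvol c r hr.le] at hmono
  have e2 : ∑ i ∈ S, Metric.diam (P i) ^ 2 * θ ^ depth P w ε A i ≤
      ∑ k ∈ A, Metric.diam (P k) ^ 2 * g k := by
    rw [← Finset.sum_fiberwise_of_maps_to hqA]
    refine Finset.sum_le_sum fun k _ => ?_
    rw [Finset.mul_sum]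
    refine Finset.sum_le_sum fun i hi => ?_
    rw [Finset.mem_filter] at hi
    have := hqd i hi.1
    rw [hi.2] at this
    have := Metric.diam_nonneg (s := P i)
    gcongr
  have e3 : ∑ k ∈ A, volume.real (D k) * g k =
      Real.pi * ε ^ 2 / 4 * ∑ k ∈ A, Metric.diam (P k) ^ 2 * g k := by
    rw [Finset.mul_sum]
    refine Finset.sum_congr rfl fun k _ => ?_
    rw [hD]; ring
  rw [show ∑ k ∈ A, volume.real (Metric.ball (w k) (ε / 2 * Metric.diam (P k))) * g k =
    ∑ k ∈ A, volume.real (D k) * g k from rfl, e3] at hmono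
  refine e2.trans ?_
  have h2 : ∑ k ∈ A, Metric.diam (P k) ^ 2 * g k ≤
      Real.pi * r ^ 2 * (N * (1 - θ)⁻¹) / (Real.pi * ε ^ 2 / 4) := by
    rw [le_div_iff₀ (by positivity)]
    linarith
  refine h2.trans_eq ?_
  field_simp

end

/-! ### Quasitripods are obstacles -/

theorem exists_mem_uIcc_succ (u : ℕ → ℝ) {m : ℝ} (n : ℕ) (hm : m ∈ uIcc (u 0) (u (n + 1))) :
    ∃ k ≤ n, m ∈ uIcc (u k) (u (k + 1)) := by
  induction n with
  | zero => exact ⟨0, le_rfl, hm⟩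
  | succ n ih =>
    rcases uIcc_subset_uIcc_union_uIcc (b := u (n + 1)) hm with h | h
    · obtain ⟨k, hk, h⟩ := ih h
      exact ⟨k, hk.trans n.le_succ, h⟩
    · exact ⟨n + 1, le_rfl, h⟩

/-- Arcs of bounded turning are porous. -/
theorem exists_ball_disjoint_arc {α : ℝ → ℂ} (hα : ContinuousOn α (Icc 0 1)) {H : ℝ} (hH : 1 ≤ H)
    (hturn : ∀ s ∈ Icc (0 : ℝ) 1, ∀ m ∈ Icc (0 : ℝ) 1, ∀ t ∈ Icc (0 : ℝ) 1, |m - s| ≤ |t - s| →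
      dist (α m) (α s) ≤ H * dist (α t) (α s)) (w : ℂ) {r : ℝ} (hr : 0 < r) :
    ∃ w', Metric.ball w' (r / (8 * (3 * H + 1))) ⊆ Metric.ball w r ∧
      Disjoint (Metric.ball w' (r / (8 * (3 * H + 1)))) (α '' Icc 0 1) := by
  by_contra! hcon
  -- Chosen so that `H * (3 * κ) + κ = r / 8`: the parameters of two consecutive chain points give
  -- points of the arc at distance at most `3 * κ`, which bounded turning multiplies by `H`.
  set κ := r / (8 * (3 * H + 1)) with hκ
  have hH0 : 0 < 8 * (3 * H + 1) := by positivity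
  have hκ0 : 0 < κ := by positivity
  have hκr : (3 * H + 1) * κ = r / 8 := by rw [hκ]; field_simp
  have hκ2 : κ ≤ r / 32 := by nlinarith
  have hu : ∀ q : ℂ, ∃ u ∈ Icc (0 : ℝ) 1, dist q w ≤ r / 2 → dist (α u) q < κ := by
    intro q
    by_cases hq : dist q w ≤ r / 2
    · have := hcon q (Metric.ball_subset_ball' (by linarith))
      obtain ⟨_, hz, t, ht, rfl⟩ := Set.not_disjoint_iff.1 this
      exact ⟨t, ht, fun _ => hz⟩
    · exact ⟨0, by simp, fun h => absurd h hq⟩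
  choose u hu01 hu using hu
  obtain ⟨n, hn⟩ := exists_nat_gt (2 * r / κ)
  have hn0 : (0 : ℝ) < n + 1 := by positivity
  have hstep : 2 * (r / (n + 1)) ≤ κ := by
    rw [div_lt_iff₀ hκ0] at hn
    rw [← mul_div_assoc, div_le_iff₀ hn0]
    linarith
  set x : ℕ → ℝ := fun k => -(r / 2) + k * (r / (n + 1)) with hx
  have hxle : ∀ k ≤ n + 1, |x k| ≤ r / 2 := by
    intro k hk
    have h1 : (k : ℝ) ≤ n + 1 := by exact_mod_cast hk
    have h2 : (k : ℝ) * (r / (n + 1)) ≤ r := by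
      rw [← mul_div_assoc, div_le_iff₀ hn0]
      nlinarith
    have h3 : 0 ≤ (k : ℝ) * (r / (n + 1)) := by positivity
    rw [abs_le]
    constructor <;> simp only [hx] <;> linarith
  -- If the arc came close to every point, it could be compared with a fine chain along the upper
  -- (`s = 1`) or lower (`s = -1`) half of a diamond. The same subarc would then follow both halves,
  -- impossible where it crosses the vertical axis through `w`.
  have main : ∀ s : ℝ, |s| = 1 → ∀ m ∈ uIcc (u (w - (r / 2 : ℝ))) (u (w + (r / 2 : ℝ))),
      (α m).re = w.re → r / 4 ≤ s * ((α m).im - w.im) := by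
    intro s hs m hm hmre
    set q : ℕ → ℂ := fun k => w + ⟨x k, s * (r / 2 - |x k|)⟩ with hq
    have hqw : ∀ k ≤ n + 1, dist (q k) w ≤ r / 2 := by
      intro k hk
      have h1 := hxle k hk
      rw [dist_eq_norm, hq, add_sub_cancel_left]
      refine (Complex.norm_le_abs_re_add_abs_im _).trans ?_
      simp only [abs_mul, hs, one_mul]
      rw [abs_of_nonneg (by linarith : 0 ≤ r / 2 - |x k|)]
      linarith
    have hqq : ∀ k, dist (q (k + 1)) (q k) ≤ κ := by
      intro k
      have h1 : x (k + 1) - x k = r / (n + 1) := by simp only [hx]; push_cast; ring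
      have h2 : q (k + 1) - q k = ⟨x (k + 1) - x k, s * (|x k| - |x (k + 1)|)⟩ := by
        apply Complex.ext
        · simp [hq]
        · simp [hq]; ring
      rw [dist_eq_norm, h2]
      refine (Complex.norm_le_abs_re_add_abs_im _).trans ?_
      have h3 := abs_abs_sub_abs_le_abs_sub (x k) (x (k + 1))
      rw [abs_sub_comm (x k), h1] at h3
      simp only [abs_mul, hs, one_mul]
      rw [h1]
      have h4 : |r / (n + 1 : ℝ)| = r / (n + 1) := abs_of_pos (by positivity)
      linarith
    have hq0 : q 0 = w - (r / 2 : ℝ) := by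
      have h1 : x 0 = -(r / 2) := by simp [hx]
      have h2 : |x 0| = r / 2 := by rw [h1, abs_neg, abs_of_pos (by positivity)]
      apply Complex.ext
      · simp only [hq, Complex.add_re, Complex.sub_re, Complex.ofReal_re]; rw [h1]; ring
      · simp only [hq, Complex.add_im, Complex.sub_im, Complex.ofReal_im]; rw [h2]; ring
    have hqn : q (n + 1) = w + (r / 2 : ℝ) := by
      have h1 : x (n + 1) = r / 2 := by
        simp only [hx]; push_cast
        rw [mul_div_cancel₀ _ hn0.ne']; ring
      have h2 : |x (n + 1)| = r / 2 := by rw [h1, abs_of_pos (by positivity)]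
      apply Complex.ext
      · simp only [hq, Complex.add_re, Complex.ofReal_re]; rw [h1]
      · simp only [hq, Complex.add_im, Complex.ofReal_im]; rw [h2]; ring
    obtain ⟨k, hk, hmk⟩ := exists_mem_uIcc_succ (fun k => u (q k)) n
      (by simpa only [hq0, hqn] using hm)
    have h1 := hu (q k) (hqw k (by omega))
    have h2 := hu (q (k + 1)) (hqw (k + 1) (by omega))
    have hm01 : m ∈ Icc (0 : ℝ) 1 := by
      have h3 := hu01 (q k)
      have h4 := hu01 (q (k + 1))
      exact (uIcc_subset_Icc h3 h4) hmk
    have h3 := hturn (u (q k)) (hu01 _) m hm01 (u (q (k + 1))) (hu01 _)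
      (abs_sub_left_of_mem_uIcc hmk)
    have h4 := dist_triangle4 (α (u (q (k + 1)))) (q (k + 1)) (q k) (α (u (q k)))
    rw [dist_comm (q k) (α _)] at h4
    have h5 := hqq k
    have h6 : dist (α m) (q k) ≤ r / 8 := by
      have := dist_triangle (α m) (α (u (q k))) (q k)
      have h7 : H * dist (α (u (q (k + 1)))) (α (u (q k))) ≤ H * (3 * κ) := by
        gcongr
        linarith
      linarith
    rw [dist_eq_norm] at h6
    have h7 := (Complex.abs_re_le_norm _).trans h6
    have h8 := (Complex.abs_im_le_norm _).trans h6
    have h9 : |x k| ≤ r / 8 := by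
      simpa [hq, hmre] using h7
    have h10 : α m - q k = ⟨(α m).re - w.re - x k, (α m).im - w.im - s * (r / 2 - |x k|)⟩ := by
      apply Complex.ext
      · simp [hq]; ring
      · simp [hq]; ring
    rw [h10] at h8
    dsimp only at h8
    have h11 : s * s = 1 := by rw [← abs_mul_abs_self, hs, one_mul]
    have h12 : |s * ((α m).im - w.im - s * (r / 2 - |x k|))| ≤ r / 8 := by
      rw [abs_mul, hs, one_mul]; exact h8
    have h13 : s * ((α m).im - w.im - s * (r / 2 - |x k|)) =
        s * ((α m).im - w.im) - (r / 2 - |x k|) := by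
      rw [mul_sub, ← mul_assoc s s, h11, one_mul]
    rw [h13, abs_le] at h12
    linarith
  have hends : ∀ s : ℝ, |s| = 1 → dist (w + (s * (r / 2) : ℝ)) w ≤ r / 2 := by
    intro s hs
    rw [dist_eq_norm, add_sub_cancel_left, Complex.norm_real, Real.norm_eq_abs, abs_mul, hs,
      one_mul, abs_of_pos (by positivity)]
  have e1 := hu (w - (r / 2 : ℝ)) (by
    have := hends (-1) (by simp)
    rwa [neg_one_mul, Complex.ofReal_neg, ← sub_eq_add_neg] at this)
  have e2 := hu (w + (r / 2 : ℝ)) (by simpa using hends 1 (by simp))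
  rw [dist_eq_norm] at e1 e2
  have e3 := (abs_lt.1 ((Complex.abs_re_le_norm _).trans_lt e1)).2
  have e4 := (abs_lt.1 ((Complex.abs_re_le_norm _).trans_lt e2)).1
  simp only [Complex.sub_re, Complex.add_re, Complex.ofReal_re] at e3 e4
  have hsub : uIcc (u (w - (r / 2 : ℝ))) (u (w + (r / 2 : ℝ))) ⊆ Icc 0 1 :=
    uIcc_subset_Icc (hu01 _) (hu01 _)
  have hivt := intermediate_value_uIcc (f := fun t => (α t).re)
    (Complex.continuous_re.comp_continuousOn (hα.mono hsub))
  obtain ⟨m, hm, hmre⟩ := hivt (Icc_subset_uIcc ⟨by linarith, by linarith⟩ :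
    w.re ∈ uIcc (α (u (w - (r / 2 : ℝ)))).re (α (u (w + (r / 2 : ℝ)))).re)
  have f1 := main 1 (by simp) m hm hmre
  have f2 := main (-1) (by simp) m hm hmre
  linarith

/-- The endpoints of the standard tripod. -/
def tripodEnd (j : Fin 3) : ℂ :=
  Complex.exp (2 * Real.pi * Complex.I * ((j : ℕ) : ℂ) / 3)

theorem tripodEnd_eq (j : Fin 3) :
    tripodEnd j = Complex.exp ((2 * Real.pi * ((j : ℕ) : ℝ) / 3 : ℝ) * Complex.I) := by
  unfold tripodEnd
  congr 1
  push_cast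
  ring

theorem norm_tripodEnd (j : Fin 3) : ‖tripodEnd j‖ = 1 := by
  rw [tripodEnd_eq, Complex.norm_exp_ofReal_mul_I]

theorem re_tripodEnd_mul_conj {i j : Fin 3} (h : i ≠ j) :
    (tripodEnd i * conj (tripodEnd j)).re ≤ 0 := by
  have h1 : tripodEnd i * conj (tripodEnd j) =
      Complex.exp ((2 * Real.pi * (((i : ℕ) : ℝ) - ((j : ℕ) : ℝ)) / 3 : ℝ) * Complex.I) := by
    rw [tripodEnd_eq, tripodEnd_eq, ← Complex.exp_conj, ← Complex.exp_add]
    congr 1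
    simp only [map_mul, Complex.conj_ofReal, Complex.conj_I]
    push_cast
    ring
  rw [h1, Complex.exp_ofReal_mul_I_re]
  have hpi := Real.pi_pos
  have c1 : Real.cos (2 * Real.pi / 3) ≤ 0 :=
    Real.cos_nonpos_of_pi_div_two_le_of_le (by linarith) (by linarith)
  have c2 : Real.cos (4 * Real.pi / 3) ≤ 0 :=
    Real.cos_nonpos_of_pi_div_two_le_of_le (by linarith) (by linarith)
  have hij : ((i : ℕ) : ℝ) - ((j : ℕ) : ℝ) = 1 ∨ ((i : ℕ) : ℝ) - ((j : ℕ) : ℝ) = -1 ∨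
      ((i : ℕ) : ℝ) - ((j : ℕ) : ℝ) = 2 ∨ ((i : ℕ) : ℝ) - ((j : ℕ) : ℝ) = -2 := by
    fin_cases i <;> fin_cases j <;> first | exact absurd rfl h | norm_num
  rcases hij with h | h | h | h <;> rw [h]
  · convert c1 using 2; ring
  · rw [← Real.cos_neg]; convert c1 using 2; ring
  · convert c2 using 2; ring
  · rw [← Real.cos_neg]; convert c2 using 2; ring

/-- Distinct arms form an obtuse angle, so from the end of one arm the centre is no farther than any
point of another arm. Weak quasisymmetry is applied to this comparison. -/
theorem one_le_norm_smul_sub_tripodEnd {i j : Fin 3} (h : i ≠ j) {t : ℝ} (ht : 0 ≤ t) :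
    1 ≤ ‖(t : ℂ) * tripodEnd i - tripodEnd j‖ := by
  have h1 : 1 ≤ Complex.normSq ((t : ℂ) * tripodEnd i - tripodEnd j) := by
    rw [Complex.normSq_sub, mul_assoc, Complex.re_ofReal_mul, Complex.normSq_eq_norm_sq (tripodEnd j),
      norm_tripodEnd]
    have h2 := mul_nonneg ht (neg_nonneg.2 (re_tripodEnd_mul_conj h))
    have h3 := Complex.normSq_nonneg ((t : ℂ) * tripodEnd i)
    linarith
  rw [Complex.normSq_eq_norm_sq] at h1
  nlinarith [norm_nonneg ((t : ℂ) * tripodEnd i - tripodEnd j)]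

theorem smul_tripodEnd_mem (j : Fin 3) {t : ℝ} (ht : t ∈ Icc (0 : ℝ) 1) :
    (t : ℂ) * tripodEnd j ∈ standardTripod := by
  refine mem_iUnion.2 ⟨j, 1 - t, t, by linarith [ht.2], ht.1, by ring, ?_⟩
  rw [smul_zero, zero_add, Complex.real_smul]
  rfl

theorem zero_mem_standardTripod : (0 : ℂ) ∈ standardTripod :=
  mem_iUnion.2 ⟨0, left_mem_segment ℝ _ _⟩

theorem exists_eq_smul_tripodEnd {z : ℂ} (hz : z ∈ standardTripod) :
    ∃ j, ∃ t ∈ Icc (0 : ℝ) 1, z = (t : ℂ) * tripodEnd j := by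
  obtain ⟨j, a, b, ha, hb, hab, rfl⟩ := mem_iUnion.1 hz
  refine ⟨j, b, ⟨hb, by linarith⟩, ?_⟩
  rw [smul_zero, zero_add, Complex.real_smul]
  rfl

theorem isCompact_standardTripod : IsCompact standardTripod := by
  have : standardTripod = ⋃ j, (fun t : ℝ => (t : ℂ) * tripodEnd j) '' Icc 0 1 := by
    ext z
    constructor
    · intro hz
      obtain ⟨j, t, ht, rfl⟩ := exists_eq_smul_tripodEnd hz
      exact mem_iUnion.2 ⟨j, t, ht, rfl⟩
    · intro hz
      obtain ⟨j, t, ht, rfl⟩ := mem_iUnion.1 hz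
      exact smul_tripodEnd_mem j ht
  rw [this]
  exact isCompact_iUnion fun j => isCompact_Icc.image (by fun_prop)

theorem isPathConnected_standardTripod : IsPathConnected standardTripod := by
  have : StarConvex ℝ (0 : ℂ) standardTripod := starConvex_iUnion fun j =>
    (convex_segment _ _).starConvex (left_mem_segment ℝ _ _)
  exact this.isPathConnected zero_mem_standardTripod

theorem IsQuasitripod.exists_map {H : ℝ} {T : Set ℂ} (hT : IsQuasitripod H T) :
    ∃ g : ℂ → ℂ, ContinuousOn g standardTripod ∧ g '' standardTripod = T ∧
      ∀ z₁ ∈ standardTripod, ∀ z₂ ∈ standardTripod, ∀ z₃ ∈ standardTripod,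
        ‖z₂ - z₁‖ ≤ ‖z₃ - z₁‖ → dist (g z₂) (g z₁) ≤ H * dist (g z₃) (g z₁) := by
  classical
  obtain ⟨φ, hφ⟩ := hT
  have hg : ∀ z (hz : z ∈ standardTripod),
      (if h : z ∈ standardTripod then (φ ⟨z, h⟩ : ℂ) else 0) = φ ⟨z, hz⟩ := fun z hz => dif_pos hz
  refine ⟨fun z => if h : z ∈ standardTripod then (φ ⟨z, h⟩ : ℂ) else 0, ?_, ?_, ?_⟩
  · rw [continuousOn_iff_continuous_domRestrict]
    refine (continuous_subtype_val.comp φ.continuous).congr fun z => ?_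
    exact (hg z z.2).symm
  · ext z
    constructor
    · rintro ⟨x, hx, rfl⟩
      dsimp only
      rw [hg x hx]
      exact (φ ⟨x, hx⟩).2
    · intro hz
      refine ⟨φ.symm ⟨z, hz⟩, (φ.symm ⟨z, hz⟩).2, ?_⟩
      dsimp only
      rw [hg _ (φ.symm ⟨z, hz⟩).2]
      simp
  · intro z₁ h₁ z₂ h₂ z₃ h₃ h
    dsimp only
    rw [hg _ h₁, hg _ h₂, hg _ h₃, dist_eq_norm, dist_eq_norm]
    exact hφ ⟨z₁, h₁⟩ ⟨z₂, h₂⟩ ⟨z₃, h₃⟩ h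

theorem IsCompact.exists_dist_eq_metric_diam {T : Set ℂ} (hT : IsCompact T) (hne : T.Nonempty) :
    ∃ a ∈ T, ∃ b ∈ T, dist b a = Metric.diam T := by
  obtain ⟨⟨a, b⟩, hab, hmax⟩ := (hT.prod hT).exists_isMaxOn (hne.prod hne)
    (f := fun x : ℂ × ℂ => dist x.2 x.1) (by fun_prop)
  refine ⟨a, hab.1, b, hab.2, le_antisymm
    (Metric.dist_le_diam_of_mem hT.isBounded hab.2 hab.1) ?_⟩
  refine Metric.diam_le_of_forall_dist_le dist_nonneg fun x hx y hy => ?_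
  exact hmax (show (y, x) ∈ T ×ˢ T from ⟨hy, hx⟩)

/-- A fat triangle is not flat as seen from its centroid. -/
theorem exists_le_im_of_fat_triangle {a b c u : ℂ} {D ω : ℝ} (hD : 0 < D) (hω : 0 < ω)
    (hω1 : ω ≤ 1) (hu : ‖u‖ = 1) (hab : b - a = D * u) (hc : dist c a ≤ D)
    (hcu : ω * D ≤ |((c - a) * conj u).im|) {e : ℂ} (he : ‖e‖ = 1) :
    ∃ v ∈ ({a, b, c} : Set ℂ), ω * D / 7 ≤ ((v - (a + b + c) / 3) * conj e).im := by
  by_contra! hcon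
  have ha := hcon a (by simp)
  have hb := hcon b (by simp)
  have hc' := hcon c (by simp)
  set m := ω * D / 7 with hm
  have hm0 : 0 < m := by positivity
  have hsum : ((a - (a + b + c) / 3) * conj e).im + ((b - (a + b + c) / 3) * conj e).im +
      ((c - (a + b + c) / 3) * conj e).im = 0 := by
    rw [← Complex.add_im, ← Complex.add_im]
    have : (a - (a + b + c) / 3) * conj e + (b - (a + b + c) / 3) * conj e +
      (c - (a + b + c) / 3) * conj e = 0 := by ring
    rw [this, Complex.zero_im]
  have hba : ((b - a) * conj e).im = ((b - (a + b + c) / 3) * conj e).im -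
      ((a - (a + b + c) / 3) * conj e).im := by
    rw [← Complex.sub_im]; congr 1; ring
  have hca : ((c - a) * conj e).im = ((c - (a + b + c) / 3) * conj e).im -
      ((a - (a + b + c) / 3) * conj e).im := by
    rw [← Complex.sub_im]; congr 1; ring
  have h1 : |((b - a) * conj e).im| ≤ 3 * m := by rw [hba, abs_le]; constructor <;> linarith
  have h2 : |((c - a) * conj e).im| ≤ 3 * m := by rw [hca, abs_le]; constructor <;> linarith
  set f := u * conj e with hf
  have hfn : f.re ^ 2 + f.im ^ 2 = 1 := by
    have : ‖f‖ = 1 := by rw [hf, norm_mul, RCLike.norm_conj, hu, he, one_mul]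
    have h3 := Complex.normSq_eq_norm_sq f
    rw [this, Complex.normSq_apply] at h3
    nlinarith
  have hbf : ((b - a) * conj e).im = D * f.im := by
    rw [hab, mul_assoc, Complex.im_ofReal_mul]
  rw [hbf, abs_mul, abs_of_pos hD] at h1
  have huu : u * conj u = 1 := by
    rw [Complex.mul_conj, Complex.normSq_eq_norm_sq, hu]; simp
  set g := (c - a) * conj u with hg
  have hcf : ((c - a) * conj e).im = g.re * f.im + g.im * f.re := by
    rw [← Complex.mul_im]
    congr 1
    calc (c - a) * conj e = (c - a) * (u * conj u) * conj e := by rw [huu, mul_one]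
      _ = _ := by rw [hg, hf]; ring
  have hgre : |g.re| ≤ D := by
    refine (Complex.abs_re_le_norm _).trans ?_
    rw [hg, norm_mul, RCLike.norm_conj, hu, mul_one, ← dist_eq_norm]
    exact hc
  have h3 : |g.im * f.re| ≤ 6 * m := by
    have h4 : g.im * f.re = ((c - a) * conj e).im - g.re * f.im := by rw [hcf]; ring
    rw [h4]
    refine (abs_sub _ _).trans ?_
    rw [abs_mul]
    have h5 : |g.re| * |f.im| ≤ D * |f.im| := by gcongr
    linarith
  rw [abs_mul] at h3
  have h6 : |f.im| ≤ 3 / 7 := by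
    have : D * |f.im| ≤ D * (3 / 7) := by
      refine h1.trans ?_
      rw [hm]
      nlinarith
    exact le_of_mul_le_mul_left this hD
  have h7 : |f.re| ≤ 6 / 7 := by
    have h8 : ω * D * |f.re| ≤ |g.im| * |f.re| := by gcongr
    have : ω * D * |f.re| ≤ ω * D * (6 / 7) := by
      rw [hm] at h3
      linarith
    exact le_of_mul_le_mul_left this (by positivity)
  have h9 : f.im ^ 2 ≤ (3 / 7) ^ 2 := sq_le_sq' (by linarith [(abs_le.1 h6).1]) (abs_le.1 h6).2
  have h10 : f.re ^ 2 ≤ (6 / 7) ^ 2 := sq_le_sq' (by linarith [(abs_le.1 h7).1]) (abs_le.1 h7).2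
  norm_num at h9 h10
  linarith

/-- A quasitripod is not flat. -/
theorem exists_far_from_line {H : ℝ} (hH : 1 ≤ H) {g : ℂ → ℂ} (hg : ContinuousOn g standardTripod)
    (hqs : ∀ z₁ ∈ standardTripod, ∀ z₂ ∈ standardTripod, ∀ z₃ ∈ standardTripod,
        ‖z₂ - z₁‖ ≤ ‖z₃ - z₁‖ → dist (g z₂) (g z₁) ≤ H * dist (g z₃) (g z₁))
    {a b u : ℂ} (ha : a ∈ g '' standardTripod) (hb : b ∈ g '' standardTripod) {D : ℝ} (hD : 0 < D)
    (hu : ‖u‖ = 1) (hab : dist b a = D) :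
    ∃ c ∈ g '' standardTripod, 1 / (16 * H ^ 2) * D ≤ |((c - a) * conj u).im| := by
  by_contra! hcon
  set h := 1 / (16 * H ^ 2) * D with hh
  have hH2 : 16 * H ^ 2 * h = D := by rw [hh]; field_simp
  have hh0 : 0 < h := by rw [hh]; positivity
  set m : ℂ → ℂ := fun z => (z - a) * conj u
  have hmd : ∀ z w, m z - m w = (z - w) * conj u := fun z w => by simp only [m]; ring
  have hmn : ∀ z w, ‖m z - m w‖ = dist z w := fun z w => by
    rw [hmd, norm_mul, RCLike.norm_conj, hu, mul_one, dist_eq_norm]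
  have him : ∀ z ∈ standardTripod, ∀ w ∈ standardTripod, |(m (g z) - m (g w)).im| ≤ 2 * h := by
    intro z hz w hw
    have h1 := abs_lt.1 (hcon _ (mem_image_of_mem g hz))
    have h2 := abs_lt.1 (hcon _ (mem_image_of_mem g hw))
    rw [Complex.sub_im, abs_le]
    constructor <;> linarith
  have hS0 := zero_mem_standardTripod
  have hend : ∀ j, tripodEnd j ∈ standardTripod := fun j => by
    simpa using smul_tripodEnd_mem j (t := 1) (by simp)
  -- Seen from the centre, each end is at maximal distance in the standard tripod, so every arm has
  -- an image comparable to the whole.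
  have hr : ∀ j, D ≤ 2 * H * dist (g (tripodEnd j)) (g 0) := by
    intro j
    have hz : ∀ z ∈ standardTripod, dist (g z) (g 0) ≤ H * dist (g (tripodEnd j)) (g 0) := by
      intro z hz
      refine hqs 0 hS0 z hz _ (hend j) ?_
      obtain ⟨i, t, ht, rfl⟩ := exists_eq_smul_tripodEnd hz
      rw [sub_zero, sub_zero, norm_mul, norm_tripodEnd, norm_tripodEnd, mul_one, Complex.norm_real,
        Real.norm_of_nonneg ht.1]
      exact ht.2
    obtain ⟨za, hza, rfl⟩ := ha
    obtain ⟨zb, hzb, rfl⟩ := hb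
    have h1 := dist_triangle_right (g zb) (g za) (g 0)
    have h2 := hz za hza
    have h3 := hz zb hzb
    linarith
  set X : Fin 3 → ℝ := fun j => (m (g (tripodEnd j)) - m (g 0)).re
  have hX : ∀ j, X j ≠ 0 := by
    intro j hj
    have h1 := Complex.norm_le_abs_re_add_abs_im (m (g (tripodEnd j)) - m (g 0))
    rw [hmn] at h1
    have h2 := him _ (hend j) 0 hS0
    have h3 : |(m (g (tripodEnd j)) - m (g 0)).re| = 0 := by rw [abs_eq_zero]; exact hj
    have h4 := hr j
    have h5 : 2 * H * dist (g (tripodEnd j)) (g 0) ≤ 2 * H * (2 * h) := by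
      gcongr
      linarith
    nlinarith
  -- In a thin strip an arm that extends past the end of another one on the same side must come
  -- within `2 * h` of that end; by weak quasisymmetry the centre would then be within `2 * H * h`
  -- of it.
  have key : ∀ i j, i ≠ j → X i ∈ uIcc 0 (X j) → False := by
    intro i j hij hXij
    have hcont : ContinuousOn (fun t : ℝ => (m (g ((t : ℂ) * tripodEnd j)) - m (g 0)).re)
        (uIcc 0 1) := by
      refine Complex.continuous_re.comp_continuousOn (ContinuousOn.sub ?_ continuousOn_const)
      have hmc : Continuous m := by fun_prop
      refine hmc.comp_continuousOn (hg.comp (Continuous.continuousOn (by fun_prop)) fun t ht => ?_)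
      rw [uIcc_of_le zero_le_one] at ht
      exact smul_tripodEnd_mem j ht
    have hivt := intermediate_value_uIcc hcont
    simp only [Complex.ofReal_zero, zero_mul, sub_self, Complex.zero_re, Complex.ofReal_one,
      one_mul] at hivt
    obtain ⟨t, ht, hti⟩ := hivt hXij
    rw [uIcc_of_le zero_le_one] at ht
    have hre : (m (g ((t : ℂ) * tripodEnd j)) - m (g (tripodEnd i))).re = 0 := by
      have h1 : (m (g ((t : ℂ) * tripodEnd j)) - m (g 0)).re =
        (m (g (tripodEnd i)) - m (g 0)).re := hti
      rw [Complex.sub_re] at h1 ⊢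
      rw [Complex.sub_re] at h1
      linarith
    have h2 := Complex.norm_le_abs_re_add_abs_im
      (m (g ((t : ℂ) * tripodEnd j)) - m (g (tripodEnd i)))
    rw [hmn, hre, abs_zero, zero_add] at h2
    have h3 := him _ (smul_tripodEnd_mem j ht) _ (hend i)
    have h4 := hqs _ (hend i) 0 hS0 _ (smul_tripodEnd_mem j ht) (by
      rw [zero_sub, norm_neg, norm_tripodEnd]
      exact one_le_norm_smul_sub_tripodEnd hij.symm ht.1)
    rw [dist_comm] at h4
    have h5 := hr i
    have h6 : H * dist (g ((t : ℂ) * tripodEnd j)) (g (tripodEnd i)) ≤ H * (2 * h) := by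
      gcongr
      linarith
    have h7 : 2 * H * dist (g (tripodEnd i)) (g 0) ≤ 2 * H * (H * (2 * h)) := by
      gcongr
      linarith
    nlinarith
  have key2 : ∀ i j, i ≠ j → ¬ (0 < X i ∧ 0 < X j) := by
    rintro i j hij ⟨hi, hj⟩
    rcases le_total (X i) (X j) with h | h
    · exact key i j hij (by rw [uIcc_of_le hj.le]; exact ⟨hi.le, h⟩)
    · exact key j i hij.symm (by rw [uIcc_of_le hi.le]; exact ⟨hj.le, h⟩)
  have key3 : ∀ i j, i ≠ j → ¬ (X i < 0 ∧ X j < 0) := by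
    rintro i j hij ⟨hi, hj⟩
    rcases le_total (X i) (X j) with h | h
    · exact key j i hij.symm (by rw [uIcc_of_ge hi.le]; exact ⟨h, hj.le⟩)
    · exact key i j hij (by rw [uIcc_of_ge hj.le]; exact ⟨h, hi.le⟩)
  have k01 : (0 : Fin 3) ≠ 1 := by decide
  have k02 : (0 : Fin 3) ≠ 2 := by decide
  have k12 : (1 : Fin 3) ≠ 2 := by decide
  -- Pigeonhole: two of the three arms end on the same side of the centre.
  rcases lt_or_gt_of_ne (hX 0) with h0 | h0 <;> rcases lt_or_gt_of_ne (hX 1) with h1 | h1 <;>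
    rcases lt_or_gt_of_ne (hX 2) with h2 | h2
  exacts [key3 0 1 k01 ⟨h0, h1⟩, key3 0 1 k01 ⟨h0, h1⟩, key3 0 2 k02 ⟨h0, h2⟩,
    key2 1 2 k12 ⟨h1, h2⟩, key3 1 2 k12 ⟨h1, h2⟩, key2 0 2 k02 ⟨h0, h2⟩,
    key2 0 1 k01 ⟨h0, h1⟩, key2 0 1 k01 ⟨h0, h1⟩]

/-- The porosity constant of the arms of an `H`-quasitripod. -/
def porosity (H : ℝ) : ℝ := 1 / (8 * (3 * H + 1))

/-- The non-flatness constant of an `H`-quasitripod. -/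
def nonflatness (H : ℝ) : ℝ := 1 / (224 * H ^ 3)

theorem porosity_pos {H : ℝ} (hH : 1 ≤ H) : 0 < porosity H := by
  unfold porosity
  positivity

theorem porosity_le {H : ℝ} (hH : 1 ≤ H) : porosity H ≤ 1 / 32 := by
  unfold porosity
  exact one_div_le_one_div_of_le (by norm_num) (by linarith)

theorem nonflatness_pos {H : ℝ} (hH : 1 ≤ H) : 0 < nonflatness H := by
  unfold nonflatness
  positivity

/-- A continuum that contains a large quasitripod contains an obstacle. -/
theorem IsQuasitripod.exists_isObstacle {H : ℝ} (hH : 1 ≤ H) {T P : Set ℂ} (hT : IsQuasitripod H T)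
    (hTP : T ⊆ P) (hP : Bornology.IsBounded P) (hP0 : 0 < Metric.diam P)
    (hd : Metric.diam P ≤ H * Metric.diam T) :
    ∃ w, IsObstacle T w (Metric.diam P) (nonflatness H) (porosity H ^ 3 * nonflatness H / 2) ∧
      P ⊆ Metric.closedBall w (2 * Metric.diam P) := by
  obtain ⟨g, hg, rfl, hqs⟩ := hT.exists_map
  set T := g '' standardTripod
  set D := Metric.diam T with hD
  have hTc : IsCompact T := isCompact_standardTripod.image_of_continuousOn hg
  have hTp : IsPathConnected T := isPathConnected_standardTripod.image' hg
  have hD0 : 0 < D := by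
    by_contra! h
    nlinarith
  have hDP : D ≤ Metric.diam P := Metric.diam_mono hTP hP
  obtain ⟨a, ha, b, hb, hab⟩ := hTc.exists_dist_eq_metric_diam hTp.nonempty
  set u : ℂ := (b - a) / (D : ℂ) with hu
  have hDc : (D : ℂ) ≠ 0 := by exact_mod_cast hD0.ne'
  have hun : ‖u‖ = 1 := by
    rw [hu, norm_div, ← dist_eq_norm, hab, Complex.norm_real, Real.norm_of_nonneg hD0.le,
      div_self hD0.ne']
  obtain ⟨c, hc, hcu⟩ := exists_far_from_line hH hg hqs ha hb hD0 hun hab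
  have hω1 : 1 / (16 * H ^ 2) ≤ 1 := by
    rw [div_le_one (by positivity)]
    nlinarith
  have htri : ∀ e : ℂ, ‖e‖ = 1 → ∃ v ∈ T,
      1 / (16 * H ^ 2) * D / 7 ≤ ((v - (a + b + c) / 3) * conj e).im := by
    intro e he
    obtain ⟨v, hv, h⟩ := exists_le_im_of_fat_triangle hD0 (by positivity) hω1 hun
      (by rw [hu, mul_div_cancel₀ _ hDc]) (Metric.dist_le_diam_of_mem hTc.isBounded hc ha) hcu he
    refine ⟨v, ?_, h⟩
    simp only [mem_insert_iff, mem_singleton_iff] at hv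
    rcases hv with h' | h' | h' <;> rw [h'] <;> assumption
  set w₀ := (a + b + c) / 3 with hw₀
  set r := nonflatness H * (H * D) with hr
  have hη := nonflatness_pos hH
  have hκ := porosity_pos hH
  have hr0 : 0 < r := by positivity
  have hr2 : 1 / (16 * H ^ 2) * D / 7 = 2 * r := by
    rw [hr, nonflatness]; field_simp; norm_num
  rw [hr2] at htri
  have hηd : nonflatness H * Metric.diam P ≤ r := by
    rw [hr]; gcongr
  have hporous : ∀ (j : Fin 3) (w : ℂ) (s : ℝ), 0 < s → ∃ w',
      Metric.ball w' (porosity H * s) ⊆ Metric.ball w s ∧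
      Disjoint (Metric.ball w' (porosity H * s))
        ((fun t : ℝ => g ((t : ℂ) * tripodEnd j)) '' Icc 0 1) := by
    intro j w s hs
    have h1 : porosity H * s = s / (8 * (3 * H + 1)) := by rw [porosity]; ring
    rw [h1]
    refine exists_ball_disjoint_arc (hg.comp (by fun_prop) fun t ht => smul_tripodEnd_mem j ht) hH
      (fun p hp m hm t ht hmt => hqs _ (smul_tripodEnd_mem j hp) _ (smul_tripodEnd_mem j hm) _
        (smul_tripodEnd_mem j ht) ?_) w hs
    rw [← sub_mul, ← sub_mul, norm_mul, norm_mul, norm_tripodEnd, mul_one, mul_one,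
      ← Complex.ofReal_sub, ← Complex.ofReal_sub, Complex.norm_real, Complex.norm_real]
    exact hmt
  -- Porosity is used once per arm, in nested disks, which explains the factor `porosity H ^ 3`. The
  -- centre moves from the centroid by less than `r`, half of the height `2 * r` available there.
  obtain ⟨w₁, hw₁, hd₁⟩ := hporous 0 w₀ r hr0
  obtain ⟨w₂, hw₂, hd₂⟩ := hporous 1 w₁ (porosity H * r) (by positivity)
  obtain ⟨w, hw, hd₃⟩ := hporous 2 w₂ (porosity H * (porosity H * r)) (by positivity)
  have hww : dist w w₀ < r :=
    hw₁ (hw₂ (hw (Metric.mem_ball_self (by positivity))))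
  have hball : Metric.ball w (2 * (porosity H ^ 3 * nonflatness H / 2) * Metric.diam P) ⊆
      Metric.ball w (porosity H * (porosity H * (porosity H * r))) := by
    refine Metric.ball_subset_ball ?_
    have : porosity H ^ 3 * (nonflatness H * Metric.diam P) ≤ porosity H ^ 3 * r := by gcongr
    linarith
  refine ⟨w, ⟨hTp, ?_, fun e he => ?_⟩, fun p hp => ?_⟩
  · rw [Set.disjoint_left]
    rintro z hzT hzw
    obtain ⟨x, hx, rfl⟩ := hzT
    obtain ⟨j, t, ht, rfl⟩ := exists_eq_smul_tripodEnd hx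
    have hz := hball hzw
    fin_cases j
    · exact Set.disjoint_left.1 hd₁ (hw₂ (hw hz)) ⟨t, ht, rfl⟩
    · exact Set.disjoint_left.1 hd₂ (hw hz) ⟨t, ht, rfl⟩
    · exact Set.disjoint_left.1 hd₃ hz ⟨t, ht, rfl⟩
  · obtain ⟨v, hv, hve⟩ := htri e he
    refine ⟨v, hv, ?_⟩
    have h1 : (v - w) * conj e = (v - w₀) * conj e - (w - w₀) * conj e := by ring
    have h2 : ((w - w₀) * conj e).im ≤ dist w w₀ := by
      have := Complex.im_le_norm ((w - w₀) * conj e)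
      rwa [norm_mul, RCLike.norm_conj, he, mul_one, ← dist_eq_norm] at this
    rw [h1, Complex.sub_im]
    linarith
  · have h1 : ∀ q ∈ T, ‖p - q‖ ≤ Metric.diam P := fun q hq => by
      rw [← dist_eq_norm]
      exact Metric.dist_le_diam_of_mem hP hp (hTP hq)
    have h2 : p - w₀ = ((p - a) + (p - b) + (p - c)) / 3 := by rw [hw₀]; ring
    have h3 : dist p w₀ ≤ Metric.diam P := by
      rw [dist_eq_norm, h2, norm_div]
      have h4 := norm_add₃_le (a := p - a) (b := p - b) (c := p - c)
      have h5 := h1 a ha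
      have h6 := h1 b hb
      have h7 := h1 c hc
      have h8 : ‖(3 : ℂ)‖ = 3 := by simp
      rw [h8, div_le_iff₀ (by norm_num)]
      linarith
    have h4 : r ≤ Metric.diam P := by
      have : nonflatness H * H ≤ 1 := by
        rw [nonflatness, one_div, inv_mul_le_iff₀ (by positivity)]
        nlinarith [pow_le_pow_right₀ hH (show 1 ≤ 3 by norm_num)]
      rw [hr, ← mul_assoc]
      nlinarith
    have h5 := dist_triangle_right p w w₀
    rw [Metric.mem_closedBall]
    linarith

/-! ### Topology of the quotient and traces of paths -/

section

variable {G : Set Sphere}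

theorem continuous_proj : Continuous (proj G) := continuous_coinduced_rng

theorem surjective_proj : Function.Surjective (proj G) := Quotient.mk_surjective

theorem isCoinducing_proj : Topology.IsCoinducing (proj G) := ⟨rfl⟩

theorem isOpen_hat_iff {U : Set (Hat G)} : IsOpen U ↔ IsOpen (proj G ⁻¹' U) := isOpen_coinduced

theorem subset_compl_of_mem_compl𝒞 {p : Set Sphere} (hp : p ∈ compl𝒞 G) : p ⊆ Gᶜ := by
  obtain ⟨x, -, rfl⟩ := hp
  exact connectedComponentIn_subset _ _

theorem isConnected_of_mem_compl𝒞 {p : Set Sphere} (hp : p ∈ compl𝒞 G) : IsConnected p := by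
  obtain ⟨x, hx, rfl⟩ := hp
  exact isConnected_connectedComponentIn_iff.2 hx

theorem isClosed_of_mem_compl𝒞 (hG : IsOpen G) {p : Set Sphere} (hp : p ∈ compl𝒞 G) :
    IsClosed p := by
  obtain ⟨x, hx, rfl⟩ := hp
  refine isClosed_of_closure_subset ?_
  refine (isPreconnected_connectedComponentIn.closure).subset_connectedComponentIn
    (subset_closure (mem_connectedComponentIn hx)) ?_
  exact closure_minimal (connectedComponentIn_subset _ _) hG.isClosed_compl

theorem exists_mem_compl𝒞 {z : Sphere} (hz : z ∉ G) : ∃ p ∈ compl𝒞 G, z ∈ p :=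
  ⟨_, ⟨z, hz, rfl⟩, mem_connectedComponentIn hz⟩

theorem proj_eq_of_mem {p : Set Sphere} (hp : p ∈ compl𝒞 G) {z w : Sphere} (hz : z ∈ p)
    (hw : w ∈ p) : proj G z = proj G w :=
  proj_eq_proj_iff.2 (Or.inr ⟨p, hp, hz, hw⟩)

theorem eq_of_proj_eq {z w : Sphere} (hz : z ∈ G) (h : proj G w = proj G z) : w = z := by
  rcases proj_eq_proj_iff.1 h with ⟨h, -⟩ | ⟨p, hp, -, hzp⟩
  · exact h
  · exact absurd hz (subset_compl_of_mem_compl𝒞 hp hzp)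

theorem mem_of_proj_eq {p : Set Sphere} (hp : p ∈ compl𝒞 G) {z w : Sphere} (hz : z ∈ p)
    (h : proj G w = proj G z) : w ∈ p := by
  rcases proj_eq_proj_iff.1 h with ⟨rfl, -⟩ | ⟨q, hq, hwq, hzq⟩
  · exact hz
  · rwa [componentsOf_eq hp hq hz hzq]

theorem preimage_proj_singleton_of_mem {z : Sphere} (hz : z ∈ G) :
    proj G ⁻¹' {proj G z} = {z} := by
  ext w
  exact ⟨fun h => eq_of_proj_eq hz h, fun h => congrArg _ h⟩

theorem preimage_proj_singleton_of_mem_compl𝒞 {p : Set Sphere} (hp : p ∈ compl𝒞 G) {z : Sphere}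
    (hz : z ∈ p) : proj G ⁻¹' {proj G z} = p := by
  ext w
  exact ⟨fun h => mem_of_proj_eq hp hz h, fun h => proj_eq_of_mem hp h hz⟩

theorem isConnected_preimage_proj_singleton (q : Hat G) : IsConnected (proj G ⁻¹' {q}) := by
  obtain ⟨z, rfl⟩ := surjective_proj q
  by_cases hz : z ∈ G
  · rw [preimage_proj_singleton_of_mem hz]
    exact isConnected_singleton
  · obtain ⟨p, hp, hzp⟩ := exists_mem_compl𝒞 hz
    rw [preimage_proj_singleton_of_mem_compl𝒞 hp hzp]
    exact isConnected_of_mem_compl𝒞 hp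

theorem isClosed_preimage_proj_singleton (hG : IsOpen G) (q : Hat G) :
    IsClosed (proj G ⁻¹' {q}) := by
  obtain ⟨z, rfl⟩ := surjective_proj q
  by_cases hz : z ∈ G
  · rw [preimage_proj_singleton_of_mem hz]
    exact isClosed_singleton
  · obtain ⟨p, hp, hzp⟩ := exists_mem_compl𝒞 hz
    rw [preimage_proj_singleton_of_mem_compl𝒞 hp hzp]
    exact isClosed_of_mem_compl𝒞 hG hp

/-- Finite connectivity enters here: the saturation of a closed set adds only finitely many
components, each of them closed. -/
theorem isClosedMap_proj (hG : IsOpen G) (hfin : (compl𝒞 G).Finite) : IsClosedMap (proj G) := by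
  intro A hA
  rw [← isCoinducing_proj.isClosed_preimage]
  have : proj G ⁻¹' (proj G '' A) = A ∪ ⋃ p ∈ {p ∈ compl𝒞 G | (p ∩ A).Nonempty}, p := by
    ext z
    simp only [mem_preimage, mem_image, mem_union, mem_iUnion, mem_ofPred_eq, exists_prop]
    constructor
    · rintro ⟨w, hw, h⟩
      rcases proj_eq_proj_iff.1 h with ⟨rfl, -⟩ | ⟨q, hq, hwq, hzq⟩
      · exact Or.inl hw
      · exact Or.inr ⟨q, ⟨hq, w, hwq, hw⟩, hzq⟩
    · rintro (h | ⟨p, ⟨hp, w, hwp, hwA⟩, hz⟩)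
      · exact ⟨z, h, rfl⟩
      · exact ⟨w, hwA, proj_eq_of_mem hp hwp hz⟩
  rw [this]
  exact hA.union ((hfin.subset (sep_subset _ _)).isClosed_biUnion fun p hp =>
    isClosed_of_mem_compl𝒞 hG hp.1)

theorem t2Space_hat (hG : IsOpen G) (hfin : (compl𝒞 G).Finite) : T2Space (Hat G) := by
  refine ⟨fun x y hxy => ?_⟩
  obtain ⟨U, V, hU, hV, hxU, hyV, hUV⟩ := normal_separation
    (isClosed_preimage_proj_singleton hG x) (isClosed_preimage_proj_singleton hG y)
    (Disjoint.preimage _ (disjoint_singleton.2 hxy))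
  have hk : ∀ {u : Set Sphere}, IsOpen u → IsOpen (kernImage (proj G) u) :=
    isClosedMap_iff_kernImage.1 (isClosedMap_proj hG hfin)
  refine ⟨_, _, hk hU, hk hV, fun z hz => hxU hz, fun z hz => hyV hz, ?_⟩
  rw [Set.disjoint_left]
  intro q hqU hqV
  obtain ⟨z, rfl⟩ := surjective_proj q
  exact Set.disjoint_left.1 hUV (hqU rfl) (hqV rfl)

theorem isClosed_preimage_range (hG : IsOpen G) (hfin : (compl𝒞 G).Finite) (γ : HatPath G) :
    IsClosed (proj G ⁻¹' range γ) := by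
  have := t2Space_hat hG hfin
  exact (isCompact_range γ.continuous).isClosed.preimage continuous_proj

theorem isConnected_preimage_range (hG : IsOpen G) (hfin : (compl𝒞 G).Finite) (γ : HatPath G) :
    IsConnected (proj G ⁻¹' range γ) := by
  have := t2Space_hat hG hfin
  exact isCoinducing_proj.isConnected_preimage_of_isClosed isConnected_preimage_proj_singleton
    (isCompact_range γ.continuous).isClosed (isConnected_range γ.continuous)

/-! ### The plane inside the quotient -/

theorem isOpen_planePart {U : Set Sphere} (hU : IsOpen U) : IsOpen (planePart U) :=
  hU.preimage OnePoint.continuous_coe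

theorem preimage_projC {U : Set ℂ} (hU : U ⊆ planePart G) :
    proj G ⁻¹' projC G U = (fun z : ℂ => (z : Sphere)) '' U := by
  ext z
  constructor
  · rintro ⟨w, hw, h⟩
    exact ⟨w, hw, (eq_of_proj_eq (hU hw) h.symm).symm⟩
  · rintro ⟨w, hw, rfl⟩
    exact ⟨w, hw, rfl⟩

theorem isOpen_projC {U : Set ℂ} (hU : IsOpen U) (hUG : U ⊆ planePart G) :
    IsOpen (projC G U) := by
  rw [isOpen_hat_iff, preimage_projC hUG]
  exact OnePoint.isOpenEmbedding_coe.isOpenMap U hU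

theorem isOpen_hatPlane (hG : IsOpen G) : IsOpen (hatPlane G) :=
  isOpen_projC (isOpen_planePart hG) Subset.rfl

theorem continuousOn_planeCoord (hG : IsOpen G) : ContinuousOn (planeCoord G) (hatPlane G) := by
  rw [continuousOn_open_iff (isOpen_hatPlane hG)]
  intro U hU
  have : hatPlane G ∩ planeCoord G ⁻¹' U = projC G (U ∩ planePart G) := by
    ext q
    constructor
    · rintro ⟨⟨z, hz, rfl⟩, hq⟩
      refine ⟨z, ⟨?_, hz⟩, rfl⟩
      have : planeCoord G (proj G z) ∈ U := hq
      rwa [planeCoord_proj hz] at this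
    · rintro ⟨z, ⟨hzU, hz⟩, rfl⟩
      refine ⟨⟨z, hz, rfl⟩, ?_⟩
      change planeCoord G (proj G z) ∈ U
      rwa [planeCoord_proj hz]
  rw [this]
  exact isOpen_projC (hU.inter (isOpen_planePart hG)) inter_subset_right

theorem continuousOn_planePath (hG : IsOpen G) (γ : HatPath G) :
    ContinuousOn (planePath γ) (γ ⁻¹' hatPlane G) :=
  (continuousOn_planeCoord hG).comp γ.continuous.continuousOn fun _ h => h

theorem proj_planePath (γ : HatPath G) {t : unitInterval} (ht : γ t ∈ hatPlane G) :
    planePath γ t ∈ planePart G ∧ proj G (planePath γ t) = γ t := by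
  obtain ⟨z, hz, h⟩ := ht
  have h' : proj G z = γ t := h
  rw [planePath, ← h', planeCoord_proj hz]
  exact ⟨hz, rfl⟩

/-! ### The trace of a path in the plane -/

/-- The set of points of the plane that project to the image of `γ`. -/
def planeTrace (γ : HatPath G) : Set ℂ :=
  {z | proj G z ∈ range γ}

theorem planeTrace_inter_planePart (γ : HatPath G) :
    planeTrace γ ∩ planePart G = planePath γ '' (γ ⁻¹' hatPlane G) := by
  ext z
  constructor
  · rintro ⟨⟨t, ht⟩, hz⟩
    refine ⟨t, ⟨z, hz, ht.symm⟩, ?_⟩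
    rw [planePath, ht, planeCoord_proj hz]
  · rintro ⟨t, ht, rfl⟩
    obtain ⟨h1, h2⟩ := proj_planePath γ ht
    exact ⟨⟨t, h2.symm⟩, h1⟩

/-- A set containing `∞` and having nonempty bounded plane part would be split by a neighbourhood of
`∞` and a large disk. -/
theorem infty_notMem_of_isBounded {F : Set Sphere} (hF : IsPreconnected F)
    (hne : (planePart F).Nonempty) (hb : Bornology.IsBounded (planePart F)) :
    OnePoint.infty ∉ F := by
  intro hinf
  obtain ⟨w, hw⟩ := hne
  obtain ⟨r, hr⟩ := hb.subset_ball (0 : ℂ)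
  obtain ⟨z, hz, hz1, hz2⟩ := hF ((fun z : ℂ => (z : Sphere)) '' Metric.ball 0 r)
    (((fun z : ℂ => (z : Sphere)) '' Metric.closedBall 0 r)ᶜ)
    (OnePoint.isOpenEmbedding_coe.isOpenMap _ Metric.isOpen_ball)
    (((isCompact_closedBall 0 r).image OnePoint.continuous_coe).isClosed.isOpen_compl)
    (by
      intro z hz
      induction z using OnePoint.rec with
      | infty => exact Or.inr (by simp)
      | coe z => exact Or.inl ⟨z, hr hz, rfl⟩)
    ⟨w, hw, w, hr hw, rfl⟩ ⟨_, hinf, by simp⟩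
  exact hz2 (image_mono Metric.ball_subset_closedBall hz1)

theorem isCompact_planePart {F : Set Sphere} (hF : IsClosed F) (hinf : OnePoint.infty ∉ F) :
    IsCompact (planePart F) := by
  refine OnePoint.isOpenEmbedding_coe.isInducing.isCompact_preimage_iff ?_ |>.2 hF.isCompact
  intro z hz
  induction z using OnePoint.rec with
  | infty => exact absurd hz hinf
  | coe z => exact ⟨z, rfl⟩

theorem isConnected_planePart {F : Set Sphere} (hF : IsConnected F) (hinf : OnePoint.infty ∉ F) :
    IsConnected (planePart F) := by
  refine hF.preimage_of_isOpenMap OnePoint.coe_injective OnePoint.isOpenEmbedding_coe.isOpenMap ?_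
  intro z hz
  induction z using OnePoint.rec with
  | infty => exact absurd hz hinf
  | coe z => exact ⟨z, rfl⟩

/-- The complementary components of diameter less than `R / 20` that meet the annulus. -/
def smallComponents (G : Set Sphere) (a : ℂ) (R : ℝ) : Set (Set Sphere) :=
  {p | p ∈ compl𝒞 G ∧ ediamC p < ENNReal.ofReal (R / 20) ∧
    (planePart p ∩ closedAnnulus a R).Nonempty}

/-- The complementary components of diameter at least `R / 20` that meet the annulus. -/
def bigComponents (G : Set Sphere) (a : ℂ) (R : ℝ) : Set (Set Sphere) :=
  {p | p ∈ compl𝒞 G ∧ ENNReal.ofReal (R / 20) ≤ ediamC p ∧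
    (planePart p ∩ closedAnnulus a R).Nonempty}

theorem isBounded_of_mem_smallComponents {a : ℂ} {R : ℝ} {p : Set Sphere}
    (hp : p ∈ smallComponents G a R) : Bornology.IsBounded (planePart p) :=
  Metric.isBounded_iff_ediam_ne_top.2 (hp.2.1.trans ENNReal.ofReal_lt_top).ne

theorem infty_notMem_of_mem_smallComponents {a : ℂ} {R : ℝ} {p : Set Sphere}
    (hp : p ∈ smallComponents G a R) : OnePoint.infty ∉ p :=
  infty_notMem_of_isBounded (isConnected_of_mem_compl𝒞 hp.1).isPreconnected
    (hp.2.2.mono inter_subset_left) (isBounded_of_mem_smallComponents hp)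

theorem isContinuumFamily_smallComponents (hG : IsOpen G) (a : ℂ) (R : ℝ) :
    IsContinuumFamily fun p : smallComponents G a R => planePart (p : Set Sphere) where
  isCompact p := isCompact_planePart (isClosed_of_mem_compl𝒞 hG p.2.1)
    (infty_notMem_of_mem_smallComponents p.2)
  isConnected p := isConnected_planePart (isConnected_of_mem_compl𝒞 p.2.1)
    (infty_notMem_of_mem_smallComponents p.2)
  disjoint p q hpq := by
    refine Set.disjoint_left.2 fun z hzp hzq => ?_
    exact hpq (Subtype.ext (componentsOf_eq p.2.1 q.2.1 hzp hzq))

variable {γ : HatPath G} {a : ℂ} {R : ℝ}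

theorem mem_or_exists_smallComponents (hγ : range γ ⊆ projC G (closedAnnulus a R))
    (hbig : ∀ p ∈ bigComponents G a R, ∀ z ∈ p, proj G z ∉ range γ) {z : Sphere}
    (hz : proj G z ∈ range γ) :
    (∃ w ∈ planePart G ∩ closedAnnulus a R, (w : Sphere) = z) ∨
      ∃ p ∈ smallComponents G a R, z ∈ p := by
  obtain ⟨w, hw, h⟩ := hγ hz
  rcases proj_eq_proj_iff.1 h with ⟨h, hwG⟩ | ⟨p, hp, hwp, hzp⟩
  · exact Or.inl ⟨w, ⟨hwG, hw⟩, h⟩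
  · refine Or.inr ⟨p, ⟨hp, not_le.1 fun hd => ?_, w, hwp, hw⟩, hzp⟩
    exact hbig p ⟨hp, hd, w, hwp, hw⟩ z hzp hz

theorem isSaturatedContinuum_planeTrace (hG : IsOpen G) (hfin : (compl𝒞 G).Finite)
    (hγ : range γ ⊆ projC G (closedAnnulus a R))
    (hbig : ∀ p ∈ bigComponents G a R, ∀ z ∈ p, proj G z ∉ range γ) :
    IsSaturatedContinuum (fun p : smallComponents G a R => planePart (p : Set Sphere))
      (planeTrace γ) := by
  have hinf : OnePoint.infty ∉ proj G ⁻¹' range γ := by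
    intro h
    rcases mem_or_exists_smallComponents hγ hbig h with ⟨w, -, h⟩ | ⟨p, hp, h⟩
    · exact OnePoint.coe_ne_infty w h
    · exact infty_notMem_of_mem_smallComponents hp h
  refine ⟨isCompact_planePart (isClosed_preimage_range hG hfin γ) hinf,
    isConnected_planePart (isConnected_preimage_range hG hfin γ) hinf, fun p => ?_⟩
  rw [or_iff_not_imp_right, Set.not_disjoint_iff]
  rintro ⟨z, hzp, hz⟩ w hw
  have : proj G w = proj G z := proj_eq_of_mem p.2.1 hw hzp
  change proj G w ∈ range γ
  rw [this]
  exact hz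

theorem freePart_planeTrace_subset (hγ : range γ ⊆ projC G (closedAnnulus a R))
    (hbig : ∀ p ∈ bigComponents G a R, ∀ z ∈ p, proj G z ∉ range γ) :
    freePart (fun p : smallComponents G a R => planePart (p : Set Sphere)) (planeTrace γ) ⊆
      planeTrace γ ∩ planePart G := by
  rintro z ⟨hz, hzP⟩
  refine ⟨hz, ?_⟩
  rcases mem_or_exists_smallComponents hγ hbig hz with ⟨w, hw, h⟩ | ⟨p, hp, h⟩
  · rw [← OnePoint.coe_injective h]
    exact hw.1
  · exact absurd (mem_iUnion.2 ⟨⟨p, hp⟩, h⟩) hzP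

theorem planeTrace_inter_planePart_subset (hγ : range γ ⊆ projC G (closedAnnulus a R)) :
    planeTrace γ ∩ planePart G ⊆ closedAnnulus a R := by
  rintro z ⟨hz, hzG⟩
  obtain ⟨w, hw, h⟩ := hγ hz
  rwa [← OnePoint.coe_injective (eq_of_proj_eq hzG h)]

end

/-! ### Arc length integrals and one-dimensional Hausdorff measure -/

section

variable {f : unitInterval → ℂ} {c d : unitInterval}

theorem LocallyBoundedVariationOn.continuousOn_variationOnFromTo {s : Set unitInterval}
    (hf : LocallyBoundedVariationOn f s) (hfc : ContinuousOn f s) (hc : c ∈ s) :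
    ContinuousOn (variationOnFromTo f s c) s := by
  intro b hb
  have hl : ContinuousWithinAt (variationOnFromTo f s c) (s ∩ Iio b) b := by
    have := variationOnFromTo.tendsto_left hc hb hf (((hfc b hb).mono inter_subset_left))
    rwa [dist_self, sub_zero] at this
  have hr : ContinuousWithinAt (variationOnFromTo f s c) (s ∩ Ioi b) b := by
    have := variationOnFromTo.tendsto_right hc hb hf (((hfc b hb).mono inter_subset_left))
    rwa [dist_self, add_zero] at this
  -- A one-sided jump of the variation equals the jump of `f`, which vanishes by continuity.
  refine ((hl.union hr).union (continuousWithinAt_singleton (x := b))).mono fun x hx => ?_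
  rcases lt_trichotomy x b with h | h | h
  · exact Or.inl (Or.inl ⟨hx, h⟩)
  · exact Or.inr h
  · exact Or.inl (Or.inr ⟨hx, h⟩)

theorem naturalParameterization_mem_image (hcd : c ≤ d) (hfc : ContinuousOn f (Icc c d))
    (hf : eVariationOn f (Icc c d) ≠ ⊤) {x : ℝ}
    (hx : x ∈ Icc 0 (variationOnFromTo f (Icc c d) c d)) :
    x ∈ variationOnFromTo f (Icc c d) c '' Icc c d ∧
      naturalParameterization f (Icc c d) c x ∈ f '' Icc c d := by
  have hbv : LocallyBoundedVariationOn f (Icc c d) :=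
    BoundedVariationOn.locallyBoundedVariationOn hf
  have hc : c ∈ Icc c d := left_mem_Icc.2 hcd
  have hd : d ∈ Icc c d := right_mem_Icc.2 hcd
  have hV := isPreconnected_Icc.intermediate_value hc hd
    (hbv.continuousOn_variationOnFromTo hfc hc)
  rw [variationOnFromTo.self] at hV
  obtain ⟨u, hu, rfl⟩ := hV hx
  refine ⟨⟨u, hu, rfl⟩, u, hu, ?_⟩
  exact (edist_eq_zero.1 (edist_naturalParameterization_eq_zero hbv hc hu)).symm

/-- The arc length parametrization is 1-Lipschitz, so the Hausdorff measure of the image is at most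
the length of the path. -/
theorem mul_hausdorffMeasure_image_le_arcIntegral (hcd : c ≤ d) (hfc : ContinuousOn f (Icc c d))
    (hf : eVariationOn f (Icc c d) ≠ ⊤) {ρ : ℂ → ℝ≥0∞} {m : ℝ≥0∞}
    (hρ : ∀ z ∈ f '' Icc c d, m ≤ ρ z) :
    m * μH[1] (f '' Icc c d) ≤ arcIntegral f c d ρ := by
  have hbv : LocallyBoundedVariationOn f (Icc c d) :=
    BoundedVariationOn.locallyBoundedVariationOn hf
  have hc : c ∈ Icc c d := left_mem_Icc.2 hcd
  have hd : d ∈ Icc c d := right_mem_Icc.2 hcd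
  set V := variationOnFromTo f (Icc c d) c with hV
  set g := naturalParameterization f (Icc c d) c with hg
  have hunit := has_unit_speed_naturalParameterization f hbv hc
  have hsub : f '' Icc c d ⊆ g '' (V '' Icc c d) := by
    rintro _ ⟨u, hu, rfl⟩
    exact ⟨_, ⟨u, hu, rfl⟩, edist_eq_zero.1 (edist_naturalParameterization_eq_zero hbv hc hu)⟩
  have hVsub : V '' Icc c d ⊆ Icc 0 (V d) := by
    rintro _ ⟨u, hu, rfl⟩
    exact ⟨variationOnFromTo.nonneg_of_le _ _ hu.1,
      variationOnFromTo.monotoneOn hbv hc hu hd hu.2⟩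
  have hle : ∀ x ∈ V '' Icc c d, ∀ y ∈ V '' Icc c d, x ≤ y → edist (g x) (g y) ≤ edist x y := by
    intro x hx y hy hxy
    have h := hunit hx hy
    rw [NNReal.coe_one, one_mul] at h
    rw [edist_comm x y, edist_dist y x, Real.dist_eq, abs_of_nonneg (sub_nonneg.2 hxy), ← h]
    exact eVariationOn.edist_le _ ⟨hx, le_rfl, hxy⟩ ⟨hy, hxy, le_rfl⟩
  have hlip : LipschitzOnWith 1 g (V '' Icc c d) := by
    intro x hx y hy
    rw [ENNReal.coe_one, one_mul]
    rcases le_total x y with h | h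
    · exact hle x hx y hy h
    · rw [edist_comm, edist_comm x y]
      exact hle y hy x hx h
  have h1 : μH[1] (f '' Icc c d) ≤ volume (Icc 0 (V d)) := by
    refine (measure_mono hsub).trans ((hlip.hausdorffMeasure_image_le zero_le_one).trans ?_)
    rw [ENNReal.coe_one, ENNReal.one_rpow, one_mul, hausdorffMeasure_real]
    exact measure_mono hVsub
  calc m * μH[1] (f '' Icc c d) ≤ m * volume (Icc 0 (V d)) := by gcongr
    _ = ∫⁻ _ in Icc 0 (V d), m := by rw [setLIntegral_const]
    _ ≤ arcIntegral f c d ρ := by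
      refine setLIntegral_mono' measurableSet_Icc fun x hx => hρ _ ?_
      exact (naturalParameterization_mem_image hcd hfc hf hx).2

/-- The images of compact subintervals with endpoints in a countable dense set form a directed
cover, along which the measure is continuous; no measurability of the images is needed. -/
theorem measure_image_eq_iSup_Icc {X : Type*} [MeasurableSpace X] (μ : Measure X)
    (g : unitInterval → X) {J : Set unitInterval} (hJ : J.OrdConnected) :
    μ (g '' J) = ⨆ (c : unitInterval) (d : unitInterval) (_ : c ≤ d) (_ : Icc c d ⊆ J),
      μ (g '' Icc c d) := by
  refine le_antisymm ?_ (by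
    simp only [iSup_le_iff]
    exact fun c d _ h => measure_mono (image_mono h))
  obtain ⟨s, hsc, hsd, hbot, htop⟩ := exists_countable_dense_bot_top J
  have := hsc.to_subtype
  have hlo : ∀ x : J, ∃ y ∈ s, y ≤ x := fun x => by
    by_cases hx : IsBot x
    · exact ⟨x, hbot x hx, le_rfl⟩
    · obtain ⟨y, hy⟩ := not_forall.1 hx
      obtain ⟨z, hz, hzs⟩ := hsd.exists_mem_open isOpen_Iio ⟨y, not_le.1 hy⟩
      exact ⟨z, hz, hzs.le⟩
  have hhi : ∀ x : J, ∃ y ∈ s, x ≤ y := fun x => by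
    by_cases hx : IsTop x
    · exact ⟨x, htop x hx, le_rfl⟩
    · obtain ⟨y, hy⟩ := not_forall.1 hx
      obtain ⟨z, hz, hzs⟩ := hsd.exists_mem_open isOpen_Ioi ⟨y, not_le.1 hy⟩
      exact ⟨z, hz, hzs.le⟩
  have hcover : g '' J = ⋃ q : s × s, g '' Icc (q.1 : J).1 (q.2 : J).1 := by
    rw [← image_iUnion]
    congr 1
    ext x
    simp only [mem_iUnion]
    constructor
    · intro hx
      obtain ⟨y, hy, hyx⟩ := hlo ⟨x, hx⟩
      obtain ⟨z, hz, hxz⟩ := hhi ⟨x, hx⟩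
      exact ⟨(⟨y, hy⟩, ⟨z, hz⟩), hyx, hxz⟩
    · rintro ⟨⟨y, z⟩, hx⟩
      exact hJ.out (y : J).2 (z : J).2 hx
  have hdir : Directed (· ⊆ ·) fun q : s × s => g '' Icc (q.1 : J).1 (q.2 : J).1 := by
    rintro ⟨y, z⟩ ⟨y', z'⟩
    refine ⟨(min y y', max z z'), image_mono ?_, image_mono ?_⟩
    · exact Icc_subset_Icc (Subtype.coe_le_coe.2 (Subtype.coe_le_coe.2 (min_le_left y y')))
        (Subtype.coe_le_coe.2 (Subtype.coe_le_coe.2 (le_max_left z z')))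
    · exact Icc_subset_Icc (Subtype.coe_le_coe.2 (Subtype.coe_le_coe.2 (min_le_right y y')))
        (Subtype.coe_le_coe.2 (Subtype.coe_le_coe.2 (le_max_right z z')))
  rw [hcover, hdir.measure_iUnion]
  refine iSup_le fun q => ?_
  rcases le_or_gt (q.1 : J).1 (q.2 : J).1 with h | h
  · exact le_iSup_of_le _ (le_iSup_of_le _ (le_iSup_of_le h
      (le_iSup_of_le (hJ.out (q.1 : J).2 (q.2 : J).2) le_rfl)))
  · rw [Icc_eq_empty (not_le.2 h), image_empty, measure_empty]
    exact zero_le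

theorem IsOpen.connectedComponentIn_unitInterval {W : Set unitInterval} (hW : IsOpen W)
    {x : unitInterval} : IsOpen (connectedComponentIn W x) := by
  rw [Metric.isOpen_iff]
  intro y hy
  obtain ⟨ε, hε, hsub⟩ := Metric.isOpen_iff.1 hW y (connectedComponentIn_subset _ _ hy)
  refine ⟨ε, hε, ?_⟩
  have hord : (Metric.ball y ε).OrdConnected := by
    refine ⟨fun u hu v hv t ht => ?_⟩
    rw [Metric.mem_ball, Subtype.dist_eq, Real.dist_eq, abs_lt] at hu hv ⊢
    have h1 : (u : ℝ) ≤ t := ht.1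
    have h2 : (t : ℝ) ≤ v := ht.2
    constructor <;> linarith [hu.1, hv.2]
  rw [connectedComponentIn_eq hy]
  exact hord.isPreconnected.subset_connectedComponentIn (Metric.mem_ball_self hε) hsub

theorem countable_componentsOf {W : Set unitInterval} (hW : IsOpen W) :
    (componentsOf W).Countable := by
  have h : ∀ J ∈ componentsOf W, IsOpen J ∧ J.Nonempty := by
    rintro _ ⟨x, hx, rfl⟩
    exact ⟨hW.connectedComponentIn_unitInterval, x, mem_connectedComponentIn hx⟩
  refine Set.PairwiseDisjoint.countable_of_isOpen (s := id) ?_ (fun J hJ => (h J hJ).1)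
    fun J hJ => (h J hJ).2
  intro J hJ J' hJ' hne
  refine Set.disjoint_left.2 fun x hx hx' => hne (componentsOf_eq hJ hJ' hx hx')

theorem mul_hausdorffMeasure_le_pathIntegral {G : Set Sphere} (hG : IsOpen G) {γ : HatPath G}
    (hγ : IsLocallyRectifiable γ) {ρ : Hat G → ℝ≥0∞} {m : ℝ≥0∞}
    (hρ : ∀ z ∈ planeTrace γ ∩ planePart G, m ≤ ρ (proj G z)) :
    m * μH[1] (planeTrace γ ∩ planePart G) ≤ pathIntegral ρ γ := by
  set W := γ ⁻¹' hatPlane G with hW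
  have hWo : IsOpen W := (isOpen_hatPlane hG).preimage γ.continuous
  have := (countable_componentsOf hWo).to_subtype
  have hcover : planeTrace γ ∩ planePart G =
      ⋃ J : componentsOf W, planePath γ '' (J : Set unitInterval) := by
    rw [planeTrace_inter_planePart, ← image_iUnion]
    congr 1
    ext x
    simp only [mem_iUnion]
    constructor
    · exact fun hx => ⟨⟨_, x, hx, rfl⟩, mem_connectedComponentIn hx⟩
    · rintro ⟨⟨_, y, hy, rfl⟩, hx⟩
      exact connectedComponentIn_subset _ _ hx
  have hJ : ∀ J : componentsOf W, m * μH[1] (planePath γ '' (J : Set unitInterval)) ≤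
      ⨆ (c : unitInterval) (d : unitInterval) (_ : c ≤ d) (_ : Icc c d ⊆ (J : Set unitInterval)),
        arcIntegral (planePath γ) c d (fun z => ρ (proj G z)) := by
    rintro ⟨J, y, hy, rfl⟩
    rw [measure_image_eq_iSup_Icc _ _ isPreconnected_connectedComponentIn.ordConnected]
    simp only [ENNReal.mul_iSup]
    refine iSup_mono fun c => iSup_mono fun d => iSup_mono fun hcd => iSup_mono fun hsub => ?_
    have hsubW : Icc c d ⊆ W := hsub.trans (connectedComponentIn_subset _ _)
    refine mul_hausdorffMeasure_image_le_arcIntegral hcd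
      ((continuousOn_planePath hG γ).mono hsubW) (hγ c d hsubW) ?_
    intro z hz
    refine hρ z ?_
    rw [planeTrace_inter_planePart]
    exact image_mono hsubW hz
  calc m * μH[1] (planeTrace γ ∩ planePart G)
      ≤ m * ∑' J : componentsOf W, μH[1] (planePath γ '' (J : Set unitInterval)) := by
        rw [hcover]
        gcongr
        exact measure_iUnion_le _
    _ = ∑' J : componentsOf W, m * μH[1] (planePath γ '' (J : Set unitInterval)) :=
        ENNReal.tsum_mul_left.symm
    _ ≤ pathIntegral ρ γ := ENNReal.tsum_le_tsum hJ

end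

/-! ### Consequences of the packing condition -/

/-- The disk of radius `L * r` is covered by a number of disks of radius `r` that depends only on
`L`. -/
theorem exists_encard_le_of_packingCondition (L : ℝ) :
    ∃ n : ℕ, ∀ (N : ℕ) (G : Set Sphere), PackingCondition N G → ∀ (z : ℂ) (r : ℝ), 0 < r →
      {p | p ∈ compl𝒞N G ∧ ENNReal.ofReal r ≤ ediamC p ∧
        (planePart p ∩ Metric.closedBall z (L * r)).Nonempty}.encard ≤ ((n * N : ℕ) : ℕ∞) := by
  obtain ⟨t, -, htf, ht⟩ := (isCompact_closedBall (0 : ℂ) L).finite_cover_balls zero_lt_one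
  refine ⟨htf.toFinset.card, fun N G hG z r hr => ?_⟩
  have hsub : {p | p ∈ compl𝒞N G ∧ ENNReal.ofReal r ≤ ediamC p ∧
        (planePart p ∩ Metric.closedBall z (L * r)).Nonempty} ⊆
      ⋃ x ∈ htf.toFinset, {p | p ∈ compl𝒞N G ∧ ENNReal.ofReal r ≤ ediamC p ∧
        (planePart p ∩ Metric.ball (z + r * x) r).Nonempty} := by
    rintro p ⟨hp, hd, v, hv, hvb⟩
    have hrc : (r : ℂ) ≠ 0 := by exact_mod_cast hr.ne'
    have hmem : (v - z) / r ∈ Metric.closedBall (0 : ℂ) L := by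
      rw [mem_closedBall_zero_iff, norm_div, Complex.norm_real, Real.norm_of_nonneg hr.le,
        div_le_iff₀ hr, ← dist_eq_norm]
      exact hvb
    obtain ⟨x, hx, hxb⟩ := mem_iUnion₂.1 (ht hmem)
    refine mem_iUnion₂.2 ⟨x, htf.mem_toFinset.2 hx, hp, hd, v, hv, ?_⟩
    rw [Metric.mem_ball, dist_eq_norm] at hxb ⊢
    have : v - (z + r * x) = r * ((v - z) / r - x) := by
      field_simp
      ring
    rw [this, norm_mul, Complex.norm_real, Real.norm_of_nonneg hr.le]
    nlinarith
  refine (encard_le_encard hsub).trans ((Finset.set_encard_biUnion_le _ _).trans ?_)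
  refine (Finset.sum_le_card_nsmul _ _ (N : ℕ∞) fun x _ => hG _ r hr).trans ?_
  rw [nsmul_eq_mul]
  push_cast
  exact le_rfl

/-! ### Weights on the small components -/

theorem nonflatness_le_one {H : ℝ} (hH : 1 ≤ H) : nonflatness H ≤ 1 := by
  unfold nonflatness
  have : 1 ≤ H ^ 3 := one_le_pow₀ hH
  rw [div_le_one (by positivity)]
  linarith

section

variable {G : Set Sphere} {a : ℂ} {R : ℝ}

theorem ofReal_diam_planePart {p : Set Sphere} (hp : p ∈ smallComponents G a R) :
    ENNReal.ofReal (Metric.diam (planePart p)) = ediamC p :=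
  ENNReal.ofReal_toReal (hp.2.1.trans ENNReal.ofReal_lt_top).ne

theorem diam_planePart_lt {p : Set Sphere} (hp : p ∈ smallComponents G a R) :
    Metric.diam (planePart p) < R / 20 := by
  have := hp.2.1
  rw [← ofReal_diam_planePart hp] at this
  exact (ENNReal.ofReal_lt_ofReal_iff'.1 this).1

theorem mem_compl𝒞N_of_diam_pos {p : Set Sphere} (hp : p ∈ smallComponents G a R)
    (h : 0 < Metric.diam (planePart p)) : p ∈ compl𝒞N G := by
  refine ⟨hp.1, ?_⟩
  rw [← ofReal_diam_planePart hp]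
  exact ENNReal.ofReal_pos.2 h

theorem QuasitripodCondition.exists_isObstacle {H : ℝ} (hH : 1 ≤ H) (hG : QuasitripodCondition H G)
    {p : Set Sphere} (hp : p ∈ smallComponents G a R) (h : 0 < Metric.diam (planePart p)) :
    ∃ (T : Set ℂ) (w : ℂ), T ⊆ planePart p ∧
      IsObstacle T w (Metric.diam (planePart p)) (nonflatness H)
        (porosity H ^ 3 * nonflatness H / 2) ∧
      planePart p ⊆ Metric.closedBall w (2 * Metric.diam (planePart p)) := by
  obtain ⟨T, hTp, hT, hd⟩ := hG p (mem_compl𝒞N_of_diam_pos hp h)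
  have hb := isBounded_of_mem_smallComponents hp
  have hH0 : 0 < H := by linarith
  have hd' : Metric.diam (planePart p) ≤ H * Metric.diam T := by
    rw [ENNReal.div_le_iff (ENNReal.ofReal_pos.2 hH0).ne' ENNReal.ofReal_ne_top] at hd
    have := ENNReal.toReal_mono (ENNReal.mul_ne_top
      (Metric.isBounded_iff_ediam_ne_top.1 (hb.subset hTp)) ENNReal.ofReal_ne_top) hd
    rwa [ENNReal.toReal_mul, ENNReal.toReal_ofReal hH0.le, mul_comm] at this
  obtain ⟨w, hw, hw'⟩ := hT.exists_isObstacle hH hTp hb h hd'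
  exact ⟨T, w, hTp, hw, hw'⟩

end

/-- Weights on the small components that make paths across the annulus long. -/
theorem exists_weights {H : ℝ} (hH : 1 ≤ H) (N : ℕ) :
    ∃ C : ℝ, 0 ≤ C ∧ ∀ G : Set Sphere, IsOpen G → QuasitripodCondition H G → PackingCondition N G →
      ∀ (a : ℂ) (R : ℝ), 0 < R → ∀ [Fintype (smallComponents G a R)],
        ∃ ρ : smallComponents G a R → ℝ, (∀ i, 0 ≤ ρ i) ∧ ∑ i, ρ i ^ 2 ≤ C * R ^ 2 ∧
          ∃ E : ℂ → ℝ, (∀ z, E z ≤ R / 2) ∧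
            DominatesDist (fun p : smallComponents G a R => planePart (p : Set Sphere)) ρ E := by
  classical
  have hη := nonflatness_pos hH
  have hη1 := nonflatness_le_one hH
  have hκ := porosity_pos hH
  have hκ1 := porosity_le hH
  set η := nonflatness H with hηdef
  obtain ⟨ε, hεdef⟩ : ∃ ε, ε = porosity H ^ 3 * η / 2 := ⟨_, rfl⟩
  have hε : 0 < ε := by rw [hεdef]; positivity
  have hεη : ε ≤ η / 8 := by
    have : porosity H ^ 3 ≤ (1 / 32) ^ 3 := by gcongr
    rw [hεdef]
    nlinarith
  obtain ⟨σ, hσdef⟩ : ∃ σ, σ = ε ^ 2 / 100 := ⟨_, rfl⟩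
  have hσ : 0 < σ := by rw [hσdef]; positivity
  have hε1 : ε ≤ 1 := by linarith
  have hσ1 : σ ≤ 1 := by rw [hσdef]; nlinarith
  -- The first summand serves the induction on obstacles, the second the comparison of rank and
  -- depth.
  obtain ⟨Q, hQdef⟩ : ∃ Q, Q = 1000 / σ + 42 / ε + 1 := ⟨_, rfl⟩
  have h1000 : 0 < 1000 / σ := by positivity
  have h42 : 0 < 42 / ε := by positivity
  have hQ1 : 1 ≤ Q := by linarith
  have hQ0 : 0 < Q := by linarith
  -- Members charged to `k` have diameter at least `diam (P k) / Q` and lie within `20 * diam (P k)`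
  -- of `w k`: `18` from the selection and `2` from their own size.
  obtain ⟨n, hn⟩ := exists_encard_le_of_packingCondition (20 * Q)
  obtain ⟨θ, hθdef⟩ : ∃ θ, θ = (1 - σ / 80) ^ 2 := ⟨_, rfl⟩
  have hθ0 : 0 ≤ θ := by rw [hθdef]; positivity
  have hθ1 : θ < 1 := by rw [hθdef]; nlinarith
  have hθ' : 0 < (1 - θ)⁻¹ := inv_pos.2 (by linarith)
  refine ⟨(4 + 60 / σ) ^ 2 * (4 / ε ^ 2 * ((n * N : ℕ) * (1 - θ)⁻¹) * 5 ^ 2), by positivity, ?_⟩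
  intro G hG hquasi hpack a R hR _
  set P : smallComponents G a R → Set ℂ := fun p => planePart (p : Set Sphere) with hP
  have hd0 : ∀ i, 0 ≤ Metric.diam (P i) := fun i => Metric.diam_nonneg
  have hobst : ∀ i : smallComponents G a R, ∃ (T : Set ℂ) (w : ℂ), 0 < Metric.diam (P i) →
      T ⊆ P i ∧ IsObstacle T w (Metric.diam (P i)) η ε ∧
        P i ⊆ Metric.closedBall w (2 * Metric.diam (P i)) := by
    intro i
    by_cases h : 0 < Metric.diam (P i)
    · obtain ⟨T, w, h'⟩ := hquasi.exists_isObstacle hH i.2 h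
      rw [← hηdef, ← hεdef] at h'
      exact ⟨T, w, fun _ => h'⟩
    · exact ⟨∅, 0, fun h' => absurd h' h⟩
  choose T w hTw using hobst
  set S : Finset (smallComponents G a R) := Finset.univ.filter fun i => 0 < Metric.diam (P i)
  have hS : ∀ {i}, i ∈ S ↔ 0 < Metric.diam (P i) := by
    intro i
    simp [S]
  obtain ⟨A, hAS, hsep, hsel⟩ := exists_separated_subset (fun i => Metric.diam (P i)) w hQ1 S
    fun i hi => hS.1 hi
  have hfam : IsSeparatedFamily P T w η ε Q A :=
    { isObstacle := fun j hj => (hTw j (hS.1 (hAS hj))).2.1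
      subset := fun j hj => (hTw j (hS.1 (hAS hj))).1
      subset_closedBall := fun j hj => (hTw j (hS.1 (hAS hj))).2.2
      diam_pos := fun j hj => hS.1 (hAS hj)
      separated := hsep }
  choose! q hqA hqd hqQ hqw using hsel
  have hcont := isContinuumFamily_smallComponents hG a R
  obtain ⟨E, hE, hdom⟩ := hfam.exists_dominatesDist hcont hη hη1 hε hεη hσdef (by linarith)
  refine ⟨discountedWeight P w ε σ A, discountedWeight_nonneg hσ (by linarith) A, ?_, E, ?_, hdom⟩
  · have hcard : ∀ k ∈ A, (S.filter fun i => q i = k).card ≤ n * N := by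
      intro k hk
      have hdk := hfam.diam_pos k hk
      have hsub : Subtype.val '' ((S.filter fun i => q i = k : Finset _) :
          Set (smallComponents G a R)) ⊆
          {p | p ∈ compl𝒞N G ∧ ENNReal.ofReal (Metric.diam (P k) / Q) ≤ ediamC p ∧
            (planePart p ∩ Metric.closedBall (w k)
              (20 * Q * (Metric.diam (P k) / Q))).Nonempty} := by
        rintro _ ⟨i, hi, rfl⟩
        obtain ⟨hiS, rfl⟩ := Finset.mem_filter.1 (Finset.mem_coe.1 hi)
        refine ⟨mem_compl𝒞N_of_diam_pos i.2 (hS.1 hiS), ?_, ?_⟩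
        · rw [← ofReal_diam_planePart i.2]
          refine ENNReal.ofReal_le_ofReal ?_
          rw [div_le_iff₀ hQ0, mul_comm]
          exact hqQ i hiS
        · obtain ⟨v, hv⟩ := (hcont.isConnected i).nonempty
          refine ⟨v, hv, ?_⟩
          have h1 := (hTw i (hS.1 hiS)).2.2 hv
          have h2 := hqw i hiS
          have h3 := hqd i hiS
          have h4 := dist_triangle v (w i) (w (q i))
          rw [Metric.mem_closedBall] at h1 ⊢
          have h5 : 20 * Q * (Metric.diam (P (q i)) / Q) = 20 * Metric.diam (P (q i)) := by
            field_simp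
          rw [h5]
          linarith
      have h := (encard_le_encard hsub).trans (hn N G hpack (w k) _ (div_pos hdk hQ0))
      rw [Subtype.val_injective.encard_image, encard_coe_eq_coe_finsetCard] at h
      exact_mod_cast h
    have hball : ∀ k ∈ A, Metric.ball (w k) (ε / 2 * Metric.diam (P k)) ⊆ Metric.ball a (5 * R) := by
      intro k hk
      refine Metric.ball_subset_ball' ?_
      obtain ⟨v, hv, hva⟩ := k.2.2.2
      have h1 := hfam.subset_closedBall k hk hv
      rw [Metric.mem_closedBall] at h1
      have h2 := diam_planePart_lt k.2
      have h3 := dist_triangle_left (w k) a v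
      have h4 : dist v a ≤ 4 * R := hva.2
      change Metric.diam (P k) < R / 20 at h2
      nlinarith [hd0 k]
    have hsum := hfam.sum_sq_diam_mul_pow_depth_le hε hε1 (by linarith) hθ0 hθ1
      (fun i hi => (hTw i (hS.1 hi)).2.2) hqA hqd hqw (N := n * N)
      (fun k hk => by convert hcard k hk) (by positivity : 0 < 5 * R) hball
    have heq : ∑ i, discountedWeight P w ε σ A i ^ 2 =
        (4 + 60 / σ) ^ 2 * ∑ i ∈ S, Metric.diam (P i) ^ 2 * θ ^ depth P w ε A i := by
      rw [Finset.mul_sum, ← Finset.sum_subset (Finset.subset_univ S)]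
      · refine Finset.sum_congr rfl fun i _ => ?_
        rw [discountedWeight, hθdef, ← pow_mul, mul_comm 2, pow_mul, mul_pow, mul_pow, mul_assoc]
      · intro i _ hi
        rw [hS, not_lt] at hi
        rw [discountedWeight, le_antisymm hi (hd0 i)]
        ring
    rw [heq, mul_assoc, mul_assoc]
    refine mul_le_mul_of_nonneg_left (hsum.trans (le_of_eq ?_)) (by positivity)
    ring
  · intro z
    refine hE z _ (by positivity) fun j _ _ => ?_
    -- The threshold `R / 20` for small components is chosen so that the error `10 * diam` is at
    -- most `R / 2`.
    have : Metric.diam (P j) < R / 20 := diam_planePart_lt j.2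
    linarith

/-! ### The admissible density -/

section

variable {G : Set Sphere} {a : ℂ} {R : ℝ}

open Classical in
/-- The values of the density on the complementary components. -/
def componentDensity (w : smallComponents G a R → ℝ) (p : Set Sphere) : ℝ≥0∞ :=
  if p ∈ bigComponents G a R then 1
  else if h : p ∈ smallComponents G a R then ENNReal.ofReal (w ⟨p, h⟩ / R) else 0

open Classical in
/-- The density `1 / R` in the disk of radius `5 R`, together with the given weights on the small
components and the weight `1` on the big components. -/
def annulusDensity (w : smallComponents G a R → ℝ) (q : Hat G) : ℝ≥0∞ :=
  if q ∈ projC G (planePart G ∩ Metric.ball a (5 * R)) then ENNReal.ofReal (1 / R)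
  else componentDensity w (proj G ⁻¹' {q})

variable {w : smallComponents G a R → ℝ}

theorem componentDensity_of_mem_bigComponents {p : Set Sphere} (hp : p ∈ bigComponents G a R) :
    componentDensity w p = 1 :=
  if_pos hp

theorem notMem_bigComponents_of_mem_smallComponents {p : Set Sphere}
    (hp : p ∈ smallComponents G a R) : p ∉ bigComponents G a R :=
  fun h => not_lt.2 h.2.1 hp.2.1

theorem componentDensity_coe (i : smallComponents G a R) :
    componentDensity w (i : Set Sphere) = ENNReal.ofReal (w i / R) := by
  rw [componentDensity, if_neg (notMem_bigComponents_of_mem_smallComponents i.2), dif_pos i.2]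

theorem componentDensity_of_notMem {p : Set Sphere} (hp : p ∉ bigComponents G a R)
    (hp' : p ∉ smallComponents G a R) : componentDensity w p = 0 := by
  rw [componentDensity, if_neg hp, dif_neg hp']

theorem proj_mem_projC_iff {U : Set ℂ} {z : ℂ} (hz : z ∈ planePart G) :
    proj G z ∈ projC G U ↔ z ∈ U := by
  constructor
  · rintro ⟨w, hw, h⟩
    rwa [← OnePoint.coe_injective (eq_of_proj_eq hz h)]
  · exact fun h => ⟨z, h, rfl⟩

theorem annulusDensity_of_mem_compl𝒞 {p : Set Sphere} (hp : p ∈ compl𝒞 G) {z : Sphere}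
    (hz : z ∈ p) : annulusDensity w (proj G z) = componentDensity w p := by
  rw [annulusDensity, if_neg, preimage_proj_singleton_of_mem_compl𝒞 hp hz]
  rintro ⟨v, hv, h⟩
  exact subset_compl_of_mem_compl𝒞 hp hz (eq_of_proj_eq hv.1 h.symm ▸ hv.1)

theorem annulusDensity_proj {z : ℂ} (hz : z ∈ planePart G) :
    annulusDensity w (proj G z) =
      (Metric.ball a (5 * R)).indicator (fun _ => ENNReal.ofReal (1 / R)) z := by
  rw [annulusDensity, proj_mem_projC_iff hz]
  by_cases h : z ∈ Metric.ball a (5 * R)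
  · rw [if_pos ⟨hz, h⟩, indicator_of_mem h]
  · rw [if_neg fun h' => h h'.2, indicator_of_notMem h,
      preimage_proj_singleton_of_mem (show (z : Sphere) ∈ G from hz)]
    have hG : {(z : Sphere)} ∉ compl𝒞 G := fun h' => subset_compl_of_mem_compl𝒞 h' rfl hz
    exact componentDensity_of_notMem (fun h' => hG h'.1) fun h' => hG h'.1

theorem injective_preimage_proj_singleton :
    Function.Injective fun q : Hat G => proj G ⁻¹' {q} :=
  (surjective_proj.preimage_injective).comp singleton_injective

theorem finite_hat𝒞 (hfin : (compl𝒞 G).Finite) : (hat𝒞 G).Finite := by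
  refine Set.Finite.of_injOn (f := fun q : Hat G => proj G ⁻¹' {q}) ?_
    injective_preimage_proj_singleton.injOn hfin
  rintro _ ⟨z, hz, rfl⟩
  obtain ⟨p, hp, hzp⟩ := exists_mem_compl𝒞 hz
  simp only [preimage_proj_singleton_of_mem_compl𝒞 hp hzp]
  exact hp

theorem annulusDensity_of_mem_hat𝒞 {q : Hat G} (hq : q ∈ hat𝒞 G) :
    annulusDensity w q = componentDensity w (proj G ⁻¹' {q}) := by
  obtain ⟨z, hz, rfl⟩ := hq
  obtain ⟨p, hp, hzp⟩ := exists_mem_compl𝒞 hz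
  rw [annulusDensity_of_mem_compl𝒞 hp hzp, preimage_proj_singleton_of_mem_compl𝒞 hp hzp]

theorem measurable_annulusDensity (hG : IsOpen G) (hfin : (compl𝒞 G).Finite) :
    Measurable (annulusDensity w) := by
  classical
  have := t2Space_hat hG hfin
  refine Measurable.ite ?_ measurable_const ?_
  · exact (isOpen_projC ((isOpen_planePart hG).inter Metric.isOpen_ball)
      inter_subset_left).measurableSet
  · refine (measurable_const (a := (0 : ℝ≥0∞))).measurable_of_countable_ne
      -- Off the finite set of collapsed components the preimage of a point is a singleton of `G`,
      -- where the component density is zero.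
      ((finite_hat𝒞 hfin).countable.mono fun q hq => ?_)
    by_contra hq'
    obtain ⟨z, rfl⟩ := surjective_proj q
    have hz : z ∈ G := by
      by_contra hz
      exact hq' ⟨z, hz, rfl⟩
    have hzG : {z} ∉ compl𝒞 G := fun h' => subset_compl_of_mem_compl𝒞 h' rfl hz
    refine hq ?_
    rw [preimage_proj_singleton_of_mem hz]
    exact (componentDensity_of_notMem (fun h' => hzG h'.1) fun h' => hzG h'.1).symm

theorem energy_annulusDensity_le (hG : IsOpen G) (hR : 0 < R) [Fintype (smallComponents G a R)]
    (hw : ∀ i, 0 ≤ w i) {C : ℝ} (hC : 0 ≤ C) (hwC : ∑ i, w i ^ 2 ≤ C * R ^ 2) {n : ℕ}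
    (hn : (bigComponents G a R).encard ≤ n) :
    energy (annulusDensity w) ≤ ENNReal.ofReal (25 * Real.pi + (n + C)) := by
  have hpi := Real.pi_pos
  rw [ENNReal.ofReal_add (by positivity) (by positivity)]
  refine add_le_add ?_ ?_
  · calc ∫⁻ z in planePart G, annulusDensity w (proj G z) ^ 2
        = ∫⁻ z in planePart G, (Metric.ball a (5 * R)).indicator
            (fun _ => ENNReal.ofReal (1 / R) ^ 2) z := by
          refine setLIntegral_congr_fun (isOpen_planePart hG).measurableSet fun z hz => ?_
          rw [annulusDensity_proj hz]
          by_cases h : z ∈ Metric.ball a (5 * R)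
          · rw [indicator_of_mem h, indicator_of_mem h]
          · rw [indicator_of_notMem h, indicator_of_notMem h, zero_pow two_ne_zero]
      _ ≤ ∫⁻ z, (Metric.ball a (5 * R)).indicator (fun _ => ENNReal.ofReal (1 / R) ^ 2) z :=
          setLIntegral_le_lintegral _ _
      _ = ENNReal.ofReal (25 * Real.pi) := by
          rw [lintegral_indicator_const Metric.isOpen_ball.measurableSet, Complex.volume_ball,
            ← ENNReal.ofReal_pow (by positivity), ← ENNReal.ofReal_pow (by positivity),
            ← ENNReal.ofReal_coe_nnreal, ← ENNReal.ofReal_mul (by positivity),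
            ← ENNReal.ofReal_mul (by positivity)]
          congr 1
          rw [NNReal.coe_real_pi]
          field_simp
          norm_num
  · have h1 : ∀ p : Set Sphere, componentDensity w p ^ 2 =
        (bigComponents G a R).indicator 1 p +
          (smallComponents G a R).indicator (fun p => componentDensity w p ^ 2) p := by
      intro p
      by_cases hb : p ∈ bigComponents G a R
      · have hs : p ∉ smallComponents G a R :=
          fun h => notMem_bigComponents_of_mem_smallComponents h hb
        rw [indicator_of_mem hb, indicator_of_notMem hs, componentDensity_of_mem_bigComponents hb]
        simp
      · rw [indicator_of_notMem hb, zero_add]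
        by_cases hs : p ∈ smallComponents G a R
        · rw [indicator_of_mem hs]
        · rw [indicator_of_notMem hs, componentDensity_of_notMem hb hs, zero_pow two_ne_zero]
    calc ∑' q : hat𝒞 G, annulusDensity w (q : Hat G) ^ 2
        = ∑' q : hat𝒞 G, componentDensity w (proj G ⁻¹' {(q : Hat G)}) ^ 2 :=
          tsum_congr fun q => by rw [annulusDensity_of_mem_hat𝒞 q.2]
      _ ≤ ∑' p : Set Sphere, componentDensity w p ^ 2 :=
          ENNReal.tsum_comp_le_tsum_of_injective
            (injective_preimage_proj_singleton.comp Subtype.val_injective)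
            fun p => componentDensity w p ^ 2
      _ = (bigComponents G a R).encard +
            ∑ i : smallComponents G a R, ENNReal.ofReal (w i / R) ^ 2 := by
          have h2 : ∑ i : smallComponents G a R, ENNReal.ofReal (w i / R) ^ 2 =
              ∑' i : smallComponents G a R, ENNReal.ofReal (w i / R) ^ 2 := (tsum_fintype _).symm
          rw [h2, tsum_congr h1, ENNReal.tsum_add, ← tsum_subtype, ← tsum_subtype,
            ← ENNReal.tsum_set_one]
          simp only [componentDensity_coe, Pi.one_apply]
      _ ≤ ENNReal.ofReal (n + C) := by
          rw [ENNReal.ofReal_add (by positivity) hC, ENNReal.ofReal_natCast]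
          refine add_le_add (by exact_mod_cast hn) ?_
          have h2 : ∀ i, ENNReal.ofReal (w i / R) ^ 2 = ENNReal.ofReal (w i ^ 2 / R ^ 2) := fun i => by
            rw [← ENNReal.ofReal_pow (div_nonneg (hw i) hR.le), div_pow]
          simp only [h2]
          rw [← ENNReal.ofReal_sum_of_nonneg fun i _ => by positivity, ← Finset.sum_div]
          refine ENNReal.ofReal_le_ofReal ?_
          rwa [div_le_iff₀ (by positivity)]

theorem isAdmissible_annulusDensity (hG : IsOpen G) (hfin : (compl𝒞 G).Finite) (hR : 0 < R)
    [Fintype (smallComponents G a R)] (hw : ∀ i, 0 ≤ w i) {E : ℂ → ℝ} (hE : ∀ z, E z ≤ R / 2)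
    (hdom : DominatesDist (fun p : smallComponents G a R => planePart (p : Set Sphere)) w E)
    (p : Hat G) : IsAdmissible (annulusPaths G p a R) (annulusDensity w) := by
  classical
  refine ⟨measurable_annulusDensity hG hfin, fun γ hγ hrect => ?_⟩
  have hrange : range γ ⊆ projC G (closedAnnulus a R) := hγ.1.trans sdiff_subset
  by_cases hbig : ∀ p ∈ bigComponents G a R, ∀ z ∈ p, proj G z ∉ range γ
  swap
  · push Not at hbig
    obtain ⟨p, hp, z, hz, hzγ⟩ := hbig
    have hzG : z ∈ Gᶜ := subset_compl_of_mem_compl𝒞 hp.1 hz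
    calc (1 : ℝ≥0∞) = annulusDensity w (proj G z) := by
          rw [annulusDensity_of_mem_compl𝒞 hp.1 hz, componentDensity_of_mem_bigComponents hp]
      _ ≤ ∑' q : ↥(hat𝒞 G ∩ range γ), annulusDensity w q :=
          ENNReal.le_tsum (f := fun q : ↥(hat𝒞 G ∩ range γ) => annulusDensity w q)
            ⟨proj G z, ⟨z, hzG, rfl⟩, hzγ⟩
      _ ≤ _ := le_add_self
  set P : smallComponents G a R → Set ℂ := fun p => planePart (p : Set Sphere) with hP
  set K := planeTrace γ with hK
  have hsat := isSaturatedContinuum_planeTrace hG hfin hrange hbig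
  have hlen : ENNReal.ofReal (1 / R) * μH[1] (freePart P K) ≤ pathIntegral (annulusDensity w) γ := by
    refine le_trans ?_ (mul_hausdorffMeasure_le_pathIntegral hG hrect
      (m := ENNReal.ofReal (1 / R)) fun z hz => ?_)
    · gcongr
      exact freePart_planeTrace_subset hrange hbig
    · have hza := planeTrace_inter_planePart_subset hrange hz
      rw [annulusDensity_proj hz.2, indicator_of_mem]
      rw [Metric.mem_ball]
      linarith [hza.2]
  -- The length estimate assumes a free part of finite measure; otherwise the path integral is
  -- already infinite.
  by_cases hfree : μH[1] (freePart P K) = ⊤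
  · rw [hfree, ENNReal.mul_top (ENNReal.ofReal_pos.2 (by positivity)).ne', top_le_iff] at hlen
    exact le_top.trans (hlen.ge.trans le_self_add)
  have hxy : ∃ x ∈ K, ∃ y ∈ K, dist x a = 4 * R ∧ dist y a = R / 2 := by
    rcases hγ.2 with ⟨⟨x, hx, hx'⟩, y, hy, hy'⟩ | ⟨⟨y, hy, hy'⟩, x, hx, hx'⟩
    · exact ⟨x, ⟨0, hx'.symm⟩, y, ⟨1, hy'.symm⟩, hx, hy⟩
    · exact ⟨x, ⟨1, hx'.symm⟩, y, ⟨0, hy'.symm⟩, hx, hy⟩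
  obtain ⟨x, hxK, y, hyK, hx, hy⟩ := hxy
  -- The endpoints are at least `4 * R - R / 2` apart, and the two errors take away at most `R`.
  have hcost : R ≤ cost P w K := by
    have h1 := hdom K hsat hfree x hxK y hyK
    have h2 := dist_triangle x y a
    linarith [hE x, hE y]
  have hsum : ∑ i with P i ⊆ K, ENNReal.ofReal (w i / R) ≤
      ∑' q : ↥(hat𝒞 G ∩ range γ), annulusDensity w q := by
    have hpt : ∀ i : {i // P i ⊆ K}, ∃ z : ℂ, z ∈ P i ∧ proj G z ∈ range γ := by
      rintro ⟨i, hi⟩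
      obtain ⟨z, hz, -⟩ := i.2.2.2
      exact ⟨z, hz, hi hz⟩
    choose z hzP hzγ using hpt
    have hmem : ∀ i, proj G (z i) ∈ hat𝒞 G ∩ range γ := fun i =>
      ⟨⟨z i, subset_compl_of_mem_compl𝒞 i.1.2.1 (hzP i), rfl⟩, hzγ i⟩
    -- Different small components give different points of the quotient, so no weight in the cost is
    -- counted twice on the path.
    have hinj : Function.Injective fun i : {i // P i ⊆ K} =>
        (⟨proj G (z i), hmem i⟩ : ↥(hat𝒞 G ∩ range γ)) := by
      intro i j hij
      have h := congrArg Subtype.val hij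
      have h1 : (z i : Sphere) ∈ (j.1 : Set Sphere) := mem_of_proj_eq j.1.2.1 (hzP j) h
      exact Subtype.ext (Subtype.ext (componentsOf_eq i.1.2.1 j.1.2.1 (hzP i) h1))
    refine le_trans (le_of_eq ?_) (ENNReal.tsum_comp_le_tsum_of_injective hinj
      fun q => annulusDensity w q)
    rw [tsum_fintype, Finset.sum_subtype (Finset.univ.filter fun i => P i ⊆ K)
      (p := fun i => P i ⊆ K) (fun i => by simp)]
    refine Finset.sum_congr rfl fun i _ => ?_
    rw [annulusDensity_of_mem_compl𝒞 i.1.2.1 (hzP i), componentDensity_coe]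
  refine le_trans ?_ (add_le_add hlen hsum)
  rw [← ENNReal.ofReal_sum_of_nonneg fun i _ => div_nonneg (hw i) hR.le,
    ← ENNReal.ofReal_toReal hfree, ← ENNReal.ofReal_mul (by positivity),
    ← ENNReal.ofReal_add (by positivity)
      (Finset.sum_nonneg fun i _ => div_nonneg (hw i) hR.le), ← Finset.sum_div]
  rw [ENNReal.one_le_ofReal, one_div_mul_eq_div, ← add_div, one_le_div hR]
  refine hcost.trans (le_of_eq ?_)
  rw [cost]

theorem encard_bigComponents_le {N n : ℕ} (hR : 0 < R)
    (hn : ∀ (N : ℕ) (G : Set Sphere), PackingCondition N G → ∀ (z : ℂ) (r : ℝ), 0 < r →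
      {p | p ∈ compl𝒞N G ∧ ENNReal.ofReal r ≤ ediamC p ∧
        (planePart p ∩ Metric.closedBall z (80 * r)).Nonempty}.encard ≤ ((n * N : ℕ) : ℕ∞))
    (hG : PackingCondition N G) : (bigComponents G a R).encard ≤ ((n * N : ℕ) : ℕ∞) := by
  have hR' : 0 < R / 20 := by positivity
  refine (encard_le_encard ?_).trans (hn N G hG a (R / 20) hR')
  rintro p ⟨hp, hd, v, hv, hva⟩
  refine ⟨⟨hp, (ENNReal.ofReal_pos.2 hR').trans_le hd⟩, hd, v, hv, ?_⟩
  rw [Metric.mem_closedBall]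
  linarith [hva.2]

end

theorem exists_transboundaryModulus_le {H : ℝ} (hH : 1 ≤ H) (N : ℕ) :
    ∃ M : ℝ, 0 < M ∧ ∀ G : Set Sphere, IsOpen G → (compl𝒞 G).Finite →
      QuasitripodCondition H G → PackingCondition N G → ∀ (p : Hat G) (a : ℂ) (R : ℝ), 0 < R →
        transboundaryModulus (annulusPaths G p a R) ≤ ENNReal.ofReal M := by
  obtain ⟨C, hC, hweights⟩ := exists_weights hH N
  obtain ⟨n, hn⟩ := exists_encard_le_of_packingCondition 80
  have hpi := Real.pi_pos
  refine ⟨25 * Real.pi + ((n * N : ℕ) + C), by positivity, ?_⟩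
  intro G hG hfin hquasi hpack p a R hR
  have : Finite (smallComponents G a R) := (hfin.subset fun q hq => hq.1).to_subtype
  have := Fintype.ofFinite (smallComponents G a R)
  obtain ⟨w, hw, hwC, E, hE, hdom⟩ := hweights G hG hquasi hpack a R hR
  exact (iInf₂_le _ (isAdmissible_annulusDensity hG hfin hR hw hE hdom p)).trans
    (energy_annulusDensity_le hG hR hw hC hwC (encard_bigComponents_le hR hn hpack))

end

/-- The point `p` of the quotient may be a point of `Ω` or a complementary component; that `a`
belongs to `p` is the equation `proj Ω a = p`. -/
theorem theorem3p1 (H : ℝ) (hH : 1 ≤ H) (N : ℕ) (hN : 1 ≤ N) :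
    ∃ M : ℝ, 0 < M ∧
      ∀ Ω : Set Sphere, IsOpen Ω → IsConnected Ω → (compl𝒞 Ω).Finite →
        QuasitripodCondition H Ω → PackingCondition N Ω →
        ∀ (p : Hat Ω) (a : ℂ), proj Ω a = p → ∀ R : ℝ, 0 < R →
          transboundaryModulus (annulusPaths Ω p a R) ≤ ENNReal.ofReal M := by
  obtain ⟨M, hM, h⟩ := exists_transboundaryModulus_le hH N
  exact ⟨M, hM, fun Ω hΩ _ hfin hq hp p a _ R hR => h Ω hΩ hfin hq hp p a R hR⟩
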